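/- Let $F$ be a perfect field of characteristic $p>0$ with algebraic closure $\bar F$, and let $(L,[p])$ be a finite-dimensional restricted Lie algebra over $F$. For an $F$-space $X$ write $\bar X=\bar F\otimes_F X$. A *character* of $L$ is an $F$-linear map $c:L\to\bar F$; for $\alpha\in\operatorname{Aut}(\bar F/F)$ its conjugate is $c^\alpha=\alpha\circ c$. For an $\bar L$-module $M$ with representation $\rho$ put $\phi_x=\rho(x)^p-\rho(x^{[p]})$ for $x\in L$; $M$ *has character* $c$ if $\phi_x m=c(x)^p m$ for all $x\in L$, $m\in M$, and its component $M_c$ is the set of all $m\in M$ for which there is an $r$ with $(\phi_x-c(x)^p)^r m=0$ for all $x\in L$. The *cluster* $\mathrm{cl}(V)$ of an $L$-module $V$ is the set of characters of the composition factors of the $\bar L$-module $\bar V$. A *simple cluster* is a set of characters consisting of a single conjugacy class. The $c$-reduced enveloping algebra $u(\bar L,c)$ is the quotient of the universal enveloping algebra of $\bar L$ by the relations $x^p-x^{[p]}=c(x)^p$. Let $S$ be a $p$-subalgebra of $L$ (a Lie subalgebra closed under $[p]$); the same notions are used for $S$. Let $C$ be a simple cluster of $L$ that restricts simply to $S$,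 i.e. distinct members of $C$ have distinct restrictions to $S$. Let $W$ be a finite-dimensional $S$-module with $\mathrm{cl}(W)=C|_S=\{c|_S: c\in C\}$ that is amenable, i.e. for every $d\in\mathrm{cl}(W)$ the component $\bar W_d$ has character $d$. For $c\in C$ write $\bar W_c$ for $\bar W_{c|_S}$, and form the $\bar L$-module $$\bar V=\bigoplus_{c\in C}u(\bar L,c)\otimes_{u(\bar S,c|_S)}\bar W_c .$$ Then $\bar W=\bigoplus_{c\in C}\bar W_c$; write $w=\sum_c w_c$ for the decomposition of $w\in\bar W$. For $e_1,\dots,e_n\in L$ and $r\in\{0,\dots,p-1\}^n$ let $e(r)\otimes w=\sum_{c\in C}e_1^{r_1}\cdots e_n^{r_n}\otimes w_c\in\bar V$, where the product in the summand for $c$ is taken in $u(\bar L,c)$. There is an $F$-subspace $V$ of $\bar V$, closed under the action of $L$ and hence an $L$-module (the $C$-induced module $\mathrm{ind}^L_S(W,C)$), such that: 1. For every cobasis $e_1,\dots,e_n$ of $S$ in $L$ (a basis of a subspace complementary to $S$) and every $F$-basis $b^1,\dots,b^m$ of $W$, the elements $e(r)\otimes b^i$ with $r\in\{0,\dots,p-1\}^n$,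 $1\le i\le m$, form an $\bar F$-basis of $\bar V$. Let $\alpha\in\operatorname{Aut}(\bar F/F)$ act on $\bar V$ by acting on the coefficients with respect to this basis. Then $\alpha(e(r)\otimes w)=e(r)\otimes w^\alpha$ for all $w\in\bar W$, where $(\lambda\otimes w_0)^\alpha=\alpha(\lambda)\otimes w_0$ for $\lambda\in\bar F$, $w_0\in W$. Moreover $V$ is exactly the set of all elements of $\bar V$ that are invariant under all $\alpha$, and it is the $F$-span of the $e(r)\otimes b^i$. In particular, if $v\in\bar V$ is invariant, then $xv$ is invariant for all $x\in L$. 2. The natural map $\bar F\otimes_F V\to\bar V$ is an isomorphism. 3. $\mathrm{cl}(V)=C$. -/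

import Mathlib

open scoped TensorProduct DirectSum

section PMap

/-- `adCoeff a b n k` is the coefficient of `X ^ k` in `ad (a X + b) ^ n (a)`, computed in
`L[X] = L ⊗ F[X]`. -/
def adCoeff {L : Type*} [LieRing L] (a b : L) : ℕ → ℕ → L
  | 0, 0 => a
  | 0, _ + 1 => 0
  | n + 1, 0 => ⁅b, adCoeff a b n 0⁆
  | n + 1, k + 1 => ⁅b, adCoeff a b n (k + 1)⁆ + ⁅a, adCoeff a b n k⁆

/-- Jacobson's Lie polynomials `s_i(a, b)`, determined for `1 ≤ i ≤ p - 1` by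
`ad (a X + b) ^ (p - 1) (a) = ∑ i s_i(a, b) X ^ (i - 1)`. -/
def jacobsonS (F : Type*) {L : Type*} [Field F] [LieRing L] [LieAlgebra F L]
    (p i : ℕ) (a b : L) : L :=
  (i : F)⁻¹ • adCoeff a b (p - 1) (i - 1)

/-- A `p`-operation on a Lie algebra `L` over a field `F` (of characteristic `p`): the pair
of `L` and such an operation is a restricted Lie algebra. -/
structure PMap (p : ℕ) (F L : Type*) [Field F] [LieRing L] [LieAlgebra F L] where
  /-- the map `x ↦ x^[p]` -/
  toFun : L → L
  ad_toFun : ∀ x : L, LieAlgebra.ad F L (toFun x) = LieAlgebra.ad F L x ^ p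
  smul : ∀ (t : F) (x : L), toFun (t • x) = t ^ p • toFun x
  add : ∀ x y : L, toFun (x + y) =
    toFun x + toFun y + ∑ i ∈ Finset.Icc 1 (p - 1), jacobsonS F p i x y

variable {p : ℕ} {F L : Type*} [Field F] [LieRing L] [LieAlgebra F L]

theorem adCoeff_coe (S : LieSubalgebra F L) (a b : S) (n k : ℕ) :
    ((adCoeff a b n k : S) : L) = adCoeff (a : L) (b : L) n k := by
  induction n generalizing k with
  | zero => cases k <;> simp [adCoeff]
  | succ n ih => cases k <;> simp [adCoeff, ih]

/-- The `p`-operation induced on a `p`-subalgebra `S`, that is, a Lie subalgebra closed under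
the `p`-operation of `L`. -/
def PMap.restrict (P : PMap p F L) (S : LieSubalgebra F L) (hS : ∀ s ∈ S, P.toFun s ∈ S) :
    PMap p F S where
  toFun s := ⟨P.toFun s, hS s s.2⟩
  ad_toFun s := by
    have key : ∀ (n : ℕ) (y : S), (((LieAlgebra.ad F S s ^ n) y : S) : L)
        = (LieAlgebra.ad F L (s : L) ^ n) (y : L) := by
      intro n
      induction n with
      | zero => intro y; simp
      | succ n ih => intro y; simp [pow_succ, ih]
    ext y
    rw [key, ← P.ad_toFun]
    simp
  smul t s := Subtype.ext (by simp [P.smul])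
  add a b := Subtype.ext (by simp [P.add, jacobsonS, adCoeff_coe])

end PMap

section Characters

variable {p : ℕ} {F L : Type*} [Field F] [LieRing L] [LieAlgebra F L] (P : PMap p F L)
variable (K : Type*) [Field K] [Algebra F K]

/-- The operator `φ_x = ρ(x)^p - ρ(x^[p])`, for `x ∈ L`, on a module `M` over `K ⊗ L`. -/
noncomputable def phi (M : Type*) [AddCommGroup M] [Module K M] [LieRingModule (K ⊗[F] L) M]
    [LieModule K (K ⊗[F] L) M] (x : L) : Module.End K M :=
  LieModule.toEnd K (K ⊗[F] L) M ((1 : K) ⊗ₜ[F] x) ^ p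
    - LieModule.toEnd K (K ⊗[F] L) M ((1 : K) ⊗ₜ[F] P.toFun x)

variable {K} in
/-- The module `M` over `K ⊗ L` has character `c`, where `c : L → K` is an `F`-linear map. -/
def HasCharacter (c : L →ₗ[F] K) (M : Type*) [AddCommGroup M] [Module K M]
    [LieRingModule (K ⊗[F] L) M] [LieModule K (K ⊗[F] L) M] : Prop :=
  ∀ (x : L) (m : M), phi P K M x m = c x ^ p • m

/-- The cluster of an `L`-module `V`: the set of the characters of the composition factors
(irreducible subquotients `B / A`) of the `K ⊗ L`-module `K ⊗ V`. Here `K` is an algebraic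
closure of `F`. -/
def cluster (V : Type*) [AddCommGroup V] [Module F V] [LieRingModule L V] [LieModule F L V] :
    Set (L →ₗ[F] K) :=
  {c | ∃ A B : LieSubmodule K (K ⊗[F] L) (K ⊗[F] V), A ≤ B ∧
    LieModule.IsIrreducible K (K ⊗[F] L) (B ⧸ A.comap B.incl) ∧
    HasCharacter P c (B ⧸ A.comap B.incl)}

variable {K} in
/-- The conjugate `c^α` of a character `c`. -/
def conjChar (α : K ≃ₐ[F] K) (c : L →ₗ[F] K) : L →ₗ[F] K := α.toLinearMap ∘ₗ c

variable {K} in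
/-- A simple cluster of `L`: a set of characters which consists of a single conjugacy class. -/
def IsSimpleCluster (C : Set (L →ₗ[F] K)) : Prop :=
  ∃ c : L →ₗ[F] K, C = Set.range fun α : K ≃ₐ[F] K => conjChar α c

variable {K} in
/-- The restriction to a subalgebra `S` of a character of `L`. -/
def resChar (S : LieSubalgebra F L) (c : L →ₗ[F] K) : S →ₗ[F] K := c ∘ₗ S.toSubmodule.subtype

variable {K} in
/-- `C` restricts simply to `S`: distinct members of `C` have distinct restrictions. -/
def RestrictsSimply (S : LieSubalgebra F L) (C : Set (L →ₗ[F] K)) : Prop :=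
  Set.InjOn (resChar S) C

section

attribute [local instance 100] LieRing.ofAssociativeRing

theorem phi_lie [Fact p.Prime] [CharP F p] {M : Type*} [AddCommGroup M] [Module K M]
    [LieRingModule (K ⊗[F] L) M] [LieModule K (K ⊗[F] L) M] (x : L) (y : K ⊗[F] L) (m : M) :
    phi P K M x ⁅y, m⁆ = ⁅y, phi P K M x m⁆ := by
  rcases subsingleton_or_nontrivial M with hM | hM
  · exact Subsingleton.elim _ _
  have hK : CharP K p := charP_of_injective_algebraMap (algebraMap F K).injective p
  have hE : CharP (Module.End K (Module.End K M)) p :=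
    charP_of_injective_algebraMap (algebraMap K (Module.End K (Module.End K M))).injective p
  set ρ := LieModule.toEnd K (K ⊗[F] L) M with hρ
  have h1 : ∀ (n : ℕ) (z : K ⊗[F] L), (LieAlgebra.ad K (Module.End K M) (ρ (1 ⊗ₜ x)) ^ n) (ρ z)
      = ρ ((LieAlgebra.ad K (K ⊗[F] L) (1 ⊗ₜ x) ^ n) z) := by
    intro n
    induction n with
    | zero => intro z; simp
    | succ n ih =>
      intro z
      rw [pow_succ, pow_succ, Module.End.mul_apply, Module.End.mul_apply, LieAlgebra.ad_apply,
        LieAlgebra.ad_apply, ← LieHom.map_lie, ih]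
  have h2 : (LieAlgebra.ad K (K ⊗[F] L) (1 ⊗ₜ x) ^ p) y = ⁅(1 : K) ⊗ₜ[F] P.toFun x, y⁆ := by
    have h3 : ∀ (n : ℕ) (t : K) (z : L), (LieAlgebra.ad K (K ⊗[F] L) (1 ⊗ₜ x) ^ n) (t ⊗ₜ z)
        = t ⊗ₜ ((LieAlgebra.ad F L x ^ n) z) := by
      intro n
      induction n with
      | zero => intro t z; simp
      | succ n ih => intro t z; simp [pow_succ, ih]
    induction y with
    | zero => simp
    | add a b ha hb => simp [ha, hb]
    | tmul t z => rw [h3, ← P.ad_toFun]; simp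
  have h4 : (LieAlgebra.ad K (Module.End K M) (ρ (1 ⊗ₜ x)) ^ p) (ρ y)
      = ρ (1 ⊗ₜ x) ^ p * ρ y - ρ y * ρ (1 ⊗ₜ x) ^ p := by
    rw [LieAlgebra.ad_eq_lmul_left_sub_lmul_right, Pi.sub_apply,
      sub_pow_char_of_commute _ (LinearMap.commute_mulLeft_right _ _),
      LinearMap.pow_mulLeft, LinearMap.pow_mulRight]
    simp
  have h5 : ρ (1 ⊗ₜ x) ^ p * ρ y - ρ y * ρ (1 ⊗ₜ x) ^ p
      = ρ (1 ⊗ₜ P.toFun x) * ρ y - ρ y * ρ (1 ⊗ₜ P.toFun x) := by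
    rw [← h4, h1, h2, LieHom.map_lie, LieRing.of_associative_ring_bracket]
  have h6 := congrArg (fun f : Module.End K M => f m) h5
  simp only [LinearMap.sub_apply, Module.End.mul_apply] at h6
  have h7 : ∀ m : M, ρ y m = ⁅y, m⁆ := fun _ => rfl
  simp only [h7] at h6
  simp only [phi, ← hρ, LinearMap.sub_apply, lie_sub]
  rw [sub_eq_sub_iff_add_eq_add] at h6 ⊢
  rw [h6]; abel

end

variable {K} in
/-- The component `M_c` of a module `M` over `K ⊗ L`: the set of all `m` annihilated by some power
`(φ_x - c(x)^p) ^ r`, for all `x ∈ L`. -/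
noncomputable def component [Fact p.Prime] [CharP F p] (c : L →ₗ[F] K) (M : Type*)
    [AddCommGroup M] [Module K M] [LieRingModule (K ⊗[F] L) M] [LieModule K (K ⊗[F] L) M] :
    LieSubmodule K (K ⊗[F] L) M where
  carrier := {m | ∃ r : ℕ, ∀ x : L,
    ((phi P K M x - algebraMap K (Module.End K M) (c x ^ p)) ^ r) m = 0}
  zero_mem' := ⟨0, fun x => by simp⟩
  add_mem' := by
    rintro a b ⟨r, hr⟩ ⟨s, hs⟩
    refine ⟨r + s, fun x => ?_⟩
    rw [map_add]
    nth_rewrite 1 [add_comm r s]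
    rw [pow_add, pow_add, Module.End.mul_apply, Module.End.mul_apply, hr, hs]
    simp
  smul_mem' := by
    rintro t a ⟨r, hr⟩
    exact ⟨r, fun x => by rw [map_smul, hr, smul_zero]⟩
  lie_mem := by
    rintro y a ⟨r, hr⟩
    refine ⟨r, fun x => ?_⟩
    have key : ∀ (n : ℕ) (m : M),
        ((phi P K M x - algebraMap K (Module.End K M) (c x ^ p)) ^ n) ⁅y, m⁆
        = ⁅y, ((phi P K M x - algebraMap K (Module.End K M) (c x ^ p)) ^ n) m⁆ := by
      intro n
      induction n with
      | zero => intro m; simp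
      | succ n ih =>
        intro m
        rw [pow_succ, Module.End.mul_apply, Module.End.mul_apply, ← ih]
        congr 1
        simp only [LinearMap.sub_apply, Module.algebraMap_end_apply, phi_lie, lie_sub, lie_smul]
    rw [key, hr, lie_zero]

/-- The `L`-module `W` is amenable: for each `c ∈ cl(W)`, the component of `K ⊗ W` for `c` has
character `c`. -/
def IsAmenable [Fact p.Prime] [CharP F p] (W : Type*) [AddCommGroup W] [Module F W]
    [LieRingModule L W] [LieModule F L W] : Prop :=
  ∀ c ∈ cluster P K W, HasCharacter P c (component P c (K ⊗[F] W))

end Characters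

section Reduced

variable {p : ℕ} {F L : Type*} [Field F] [LieRing L] [LieAlgebra F L] (P : PMap p F L)
variable {K : Type*} [Field K] [Algebra F K]

/-- The relations `x ^ p = x^[p] + c(x) ^ p` in the universal enveloping algebra of `K ⊗ L`.
Since `x ^ p - x^[p]` and `c(x) ^ p` are `p`-semilinear in `x`, the relations for `x ∈ L` imply those
for all `x ∈ K ⊗ L`. -/
inductive ReducedRel (c : L →ₗ[F] K) : UniversalEnvelopingAlgebra K (K ⊗[F] L) →
    UniversalEnvelopingAlgebra K (K ⊗[F] L) → Prop
  | rel (x : L) : ReducedRel c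
      (UniversalEnvelopingAlgebra.ι K ((1 : K) ⊗ₜ[F] x) ^ p)
      (UniversalEnvelopingAlgebra.ι K ((1 : K) ⊗ₜ[F] P.toFun x) + algebraMap K _ (c x ^ p))

/-- The `c`-reduced enveloping algebra `u(K ⊗ L, c)`. -/
def ReducedEnv (c : L →ₗ[F] K) : Type _ := RingQuot (ReducedRel P c)

noncomputable instance (c : L →ₗ[F] K) : Ring (ReducedEnv P c) :=
  inferInstanceAs (Ring (RingQuot (ReducedRel P c)))

noncomputable instance (c : L →ₗ[F] K) : Algebra K (ReducedEnv P c) :=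
  inferInstanceAs (Algebra K (RingQuot (ReducedRel P c)))

namespace ReducedEnv

attribute [local instance 100] LieRing.ofAssociativeRing

/-- The quotient map from the universal enveloping algebra. -/
noncomputable def mk (c : L →ₗ[F] K) :
    UniversalEnvelopingAlgebra K (K ⊗[F] L) →ₐ[K] ReducedEnv P c :=
  RingQuot.mkAlgHom K (ReducedRel P c)

/-- The canonical map `K ⊗ L → u(K ⊗ L, c)`. -/
noncomputable def ι (c : L →ₗ[F] K) : (K ⊗[F] L) →ₗ[K] ReducedEnv P c :=
  (mk P c).toLinearMap ∘ₗ
    (UniversalEnvelopingAlgebra.ι K : (K ⊗[F] L) →ₗ⁅K⁆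
      UniversalEnvelopingAlgebra K (K ⊗[F] L)).toLinearMap

theorem ι_apply (c : L →ₗ[F] K) (x : K ⊗[F] L) :
    ι P c x = mk P c (UniversalEnvelopingAlgebra.ι K x) := rfl

theorem ι_lie (c : L →ₗ[F] K) (x y : K ⊗[F] L) :
    ι P c ⁅x, y⁆ = ι P c x * ι P c y - ι P c y * ι P c x := by
  simp only [ι_apply, LieHom.map_lie, LieRing.of_associative_ring_bracket, map_sub, map_mul]

theorem ι_pow (c : L →ₗ[F] K) (x : L) :
    ι P c ((1 : K) ⊗ₜ[F] x) ^ p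
      = ι P c ((1 : K) ⊗ₜ[F] P.toFun x) + algebraMap K _ (c x ^ p) := by
  have h : mk P c (UniversalEnvelopingAlgebra.ι K ((1 : K) ⊗ₜ[F] x) ^ p) = _ :=
    RingQuot.mkAlgHom_rel K (ReducedRel.rel (P := P) (c := c) x)
  rw [map_pow] at h
  refine h.trans ?_
  exact ((mk P c).map_add _ _).trans (congrArg _ ((mk P c).commutes _))

variable {P}

/-- The universal property of `u(K ⊗ L, c)`. -/
noncomputable def lift {c : L →ₗ[F] K} {A : Type*} [Ring A] [Algebra K A]
    (f : (K ⊗[F] L) →ₗ⁅K⁆ A)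
    (hf : ∀ x : L, f ((1 : K) ⊗ₜ[F] x) ^ p
      = f ((1 : K) ⊗ₜ[F] P.toFun x) + algebraMap K A (c x ^ p)) :
    ReducedEnv P c →ₐ[K] A :=
  RingQuot.liftAlgHom K ⟨UniversalEnvelopingAlgebra.lift K f, by
    rintro _ _ ⟨x⟩
    simpa using hf x⟩

/-- The action of `u(K ⊗ L, c)` on a `K ⊗ L`-module with character `c`. -/
noncomputable def act {c : L →ₗ[F] K} {M : Type*} [AddCommGroup M] [Module K M]
    [LieRingModule (K ⊗[F] L) M] [LieModule K (K ⊗[F] L) M] (h : HasCharacter P c M) :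
    ReducedEnv P c →ₐ[K] Module.End K M :=
  lift (LieModule.toEnd K (K ⊗[F] L) M) fun x => by
    have h1 : phi P K M x = algebraMap K (Module.End K M) (c x ^ p) :=
      LinearMap.ext fun m => h x m
    rw [← h1, phi]
    abel

/-- The algebra homomorphism `u(K ⊗ S, c|S) → u(K ⊗ L, c)` induced by the inclusion of a
`p`-subalgebra `S` in `L`. -/
noncomputable def incl (S : LieSubalgebra F L) (hS : ∀ s ∈ S, P.toFun s ∈ S) (c : L →ₗ[F] K) :
    ReducedEnv (P.restrict S hS) (resChar S c) →ₐ[K] ReducedEnv P c :=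
  lift
    { ι P c ∘ₗ S.toSubmodule.subtype.baseChange K with
      map_lie' := by
        have key : ∀ x y : K ⊗[F] S, S.toSubmodule.subtype.baseChange K ⁅x, y⁆
            = (⁅S.toSubmodule.subtype.baseChange K x,
                S.toSubmodule.subtype.baseChange K y⁆ : K ⊗[F] L) :=
          fun x y => (LieAlgebra.ExtendScalars.map (AlgHom.id F K) S.incl).map_lie x y
        intro x y
        change ι P c (S.toSubmodule.subtype.baseChange K ⁅x, y⁆) = _
        rw [key, ι_lie, LieRing.of_associative_ring_bracket]
        rfl }
    fun x => ι_pow P c (x : L)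

end ReducedEnv

/-- The tensor product `B ⊗_A M`, where `j : A → B` is a homomorphism of (not necessarily
commutative) `K`-algebras and the left `A`-module `M` is given by a representation `ρ`. It is the
quotient of `B ⊗_K M` by all `b j(a) ⊗ m - b ⊗ a m`, a left `B`-module. -/
abbrev BalancedTensor {A B M : Type*} [Ring A] [Algebra K A] [Ring B] [Algebra K B]
    [AddCommGroup M] [Module K M] (j : A →ₐ[K] B) (ρ : A →ₐ[K] Module.End K M) : Type _ :=
  (B ⊗[K] M) ⧸ Submodule.span B
    {t : B ⊗[K] M | ∃ (b : B) (a : A) (m : M), t = (b * j a) ⊗ₜ[K] m - b ⊗ₜ[K] (ρ a m)}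

variable (S : LieSubalgebra F L) (hS : ∀ s ∈ S, P.toFun s ∈ S) (c : L →ₗ[F] K)
  {M : Type*} [AddCommGroup M] [Module K M] [LieRingModule (K ⊗[F] S) M]
  [LieModule K (K ⊗[F] S) M] (h : HasCharacter (P.restrict S hS) (resChar S c) M)

/-- The `c`-induced module `u(K ⊗ L, c) ⊗_{u(K ⊗ S, c|S)} M`, for a `K ⊗ S`-module `M` with
character `c|S`. -/
def CInd : Type _ := BalancedTensor (ReducedEnv.incl S hS c) (ReducedEnv.act h)

noncomputable instance : AddCommGroup (CInd P S hS c h) :=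
  inferInstanceAs (AddCommGroup (BalancedTensor _ _))

noncomputable instance : Module (ReducedEnv P c) (CInd P S hS c h) :=
  inferInstanceAs (Module (ReducedEnv P c) (BalancedTensor _ _))

noncomputable instance : Module K (CInd P S hS c h) :=
  inferInstanceAs (Module K (BalancedTensor _ _))

instance : IsScalarTower K (ReducedEnv P c) (CInd P S hS c h) :=
  inferInstanceAs (IsScalarTower K (ReducedEnv P c) (BalancedTensor _ _))

instance : SMulCommClass (ReducedEnv P c) K (CInd P S hS c h) :=
  ⟨fun a t m => by
    rw [← algebraMap_smul (ReducedEnv P c) t, ← algebraMap_smul (ReducedEnv P c) t, smul_smul,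
      smul_smul, Algebra.commutes]⟩

noncomputable instance : LieRingModule (K ⊗[F] L) (CInd P S hS c h) where
  bracket y m := ReducedEnv.ι P c y • m
  add_lie y z m := by simp [add_smul]
  lie_add y m n := by simp [smul_add]
  leibniz_lie y z m := by
    simp only [ReducedEnv.ι_lie, smul_smul, sub_smul]
    abel

instance : LieModule K (K ⊗[F] L) (CInd P S hS c h) where
  smul_lie t y m := by
    change ReducedEnv.ι P c (t • y) • m = t • (ReducedEnv.ι P c y • m)
    rw [map_smul, smul_assoc]
  lie_smul t y m := by
    change ReducedEnv.ι P c y • (t • m) = t • (ReducedEnv.ι P c y • m)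
    rw [smul_comm]

/-- The map `m ↦ u ⊗ m`. -/
noncomputable def CInd.tmul (a : ReducedEnv P c) : M →ₗ[K] CInd P S hS c h where
  toFun m := Submodule.Quotient.mk (a ⊗ₜ[K] m)
  map_add' m n := by rw [TensorProduct.tmul_add]; rfl
  map_smul' t m := by rw [TensorProduct.tmul_smul]; rfl

end Reduced

section CInduced

variable {p : ℕ} [Fact p.Prime] {F L : Type*} [Field F] [CharP F p] [LieRing L] [LieAlgebra F L]
  (P : PMap p F L) (S : LieSubalgebra F L) (hS : ∀ s ∈ S, P.toFun s ∈ S)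
  {K : Type*} [Field K] [Algebra F K] (C : Set (L →ₗ[F] K))
  (W : Type*) [AddCommGroup W] [Module F W] [LieRingModule S W] [LieModule F S W]

/-- The component of `K ⊗ W`, where `W` is an `S`-module, for the restriction to `S` of a character
`c` of `L`. -/
noncomputable abbrev wComp (c : L →ₗ[F] K) : LieSubmodule K (K ⊗[F] S) (K ⊗[F] W) :=
  component (P.restrict S hS) (resChar S c) (K ⊗[F] W)

variable {W C} in
theorem wComp_hasCharacter (hW : IsAmenable (P.restrict S hS) K W)
    (hC : cluster (P.restrict S hS) K W = resChar S '' C) (c : C) :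
    HasCharacter (P.restrict S hS) (resChar S c.1) (wComp P S hS W c.1) :=
  hW _ (hC ▸ ⟨c.1, c.2, rfl⟩)

variable (hW : IsAmenable (P.restrict S hS) K W)
  (hC : cluster (P.restrict S hS) K W = resChar S '' C)

/-- The direct sum over `c ∈ C` of the `c`-induced modules
`u(K ⊗ L, c) ⊗_{u(K ⊗ S, c)} (K ⊗ W)_c`. -/
def CIndSum : Type _ :=
  ⨁ c : C, CInd P S hS c.1 (wComp_hasCharacter P S hS hW hC c)

noncomputable instance : AddCommGroup (CIndSum P S hS C W hW hC) :=
  inferInstanceAs (AddCommGroup (⨁ c : C, CInd P S hS c.1 (wComp_hasCharacter P S hS hW hC c)))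

noncomputable instance : Module K (CIndSum P S hS C W hW hC) :=
  inferInstanceAs (Module K (⨁ c : C, CInd P S hS c.1 (wComp_hasCharacter P S hS hW hC c)))

noncomputable instance : LieRingModule (K ⊗[F] L) (CIndSum P S hS C W hW hC) :=
  inferInstanceAs (LieRingModule (K ⊗[F] L)
    (⨁ c : C, CInd P S hS c.1 (wComp_hasCharacter P S hS hW hC c)))

instance : LieModule K (K ⊗[F] L) (CIndSum P S hS C W hW hC) :=
  inferInstanceAs (LieModule K (K ⊗[F] L)
    (⨁ c : C, CInd P S hS c.1 (wComp_hasCharacter P S hS hW hC c)))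

/-- The `F`-space structure, by restriction of scalars. -/
noncomputable instance : Module F (CIndSum P S hS C W hW hC) :=
  Module.compHom _ (algebraMap F K)

instance : IsScalarTower F K (CIndSum P S hS C W hW hC) :=
  IsScalarTower.of_algebraMap_smul fun _ _ => rfl

/-- The action of `L` through `x ↦ 1 ⊗ x`. -/
noncomputable instance : LieRingModule L (CIndSum P S hS C W hW hC) where
  bracket y m := ⁅(1 : K) ⊗ₜ[F] y, m⁆
  add_lie y z m := by simp [TensorProduct.tmul_add]
  lie_add y m n := by simp
  leibniz_lie y z m := by
    rw [leibniz_lie, LieAlgebra.ExtendScalars.bracket_tmul, mul_one]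

instance : LieModule F L (CIndSum P S hS C W hW hC) where
  smul_lie t y m := by
    change ⁅(1 : K) ⊗ₜ[F] (t • y), m⁆ = t • ⁅(1 : K) ⊗ₜ[F] y, m⁆
    rw [TensorProduct.tmul_smul, ← algebraMap_smul K t ((1 : K) ⊗ₜ[F] y), smul_lie,
      algebraMap_smul]
  lie_smul t y m := by
    change ⁅(1 : K) ⊗ₜ[F] y, t • m⁆ = t • ⁅(1 : K) ⊗ₜ[F] y, m⁆
    rw [← algebraMap_smul K t m, lie_smul, algebraMap_smul]

variable {W C} in
/-- The element `∑ c, e(r) ⊗ w_c` for a family `(w_c)` with `w_c ∈ (K ⊗ W)_c`, where `e(r)` is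
the product `e_1 ^ r_1 ⋯ e_n ^ r_n` in `u(K ⊗ L, c)`. -/
noncomputable def monomialTmulFamily {n : ℕ} (e : Fin n → L) (r : Fin n → ℕ) :
    (⨁ c : C, wComp P S hS W c.1) →ₗ[K] CIndSum P S hS C W hW hC :=
  DirectSum.lmap fun c => CInd.tmul P S hS c.1 (wComp_hasCharacter P S hS hW hC c)
    (List.ofFn fun j => ReducedEnv.ι P c.1 ((1 : K) ⊗ₜ[F] e j) ^ r j).prod

open Classical in
/-- `K ⊗ W` is the internal direct sum of its components `(K ⊗ W)_c`, `c ∈ C`. -/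
def IsComponentSum : Prop :=
  DirectSum.IsInternal fun c : C => wComp P S hS W c.1

variable {W C} in
open Classical in
/-- The element `e(r) ⊗ w = ∑ c, e(r) ⊗ w_c`, where `w = ∑ c, w_c` is the decomposition of
`w ∈ K ⊗ W` into its components. -/
noncomputable def monomialTmul (hD : IsComponentSum P S hS C W)
    {n : ℕ} (e : Fin n → L) (r : Fin n → ℕ) (t : K ⊗[F] W) : CIndSum P S hS C W hW hC :=
  monomialTmulFamily P S hS hW hC e r
    ((AddEquiv.ofBijective (DirectSum.coeAddMonoidHom fun c : C => wComp P S hS W c.1) hD).symm t)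

/-- A cobasis of `S` in `L`: a basis of a subspace complementary to `S`. -/
def IsCobasis {n : ℕ} (e : Fin n → L) : Prop :=
  LinearIndependent F e ∧ IsCompl S.toSubmodule (Submodule.span F (Set.range e))

end CInduced

/-- The semilinear action of `α` on a space with `K`-basis `B`: it fixes the elements of `B` and
acts on the coefficients. -/
noncomputable def basisConj {F K V κ : Type*} [Field F] [Field K] [Algebra F K] [AddCommGroup V]
    [Module K V] [Fintype κ] (B : Module.Basis κ K V) (α : K ≃ₐ[F] K) (v : V) : V :=
  ∑ i, α (B.repr v i) • B i

/-! Write `K` for the algebraic closure. The module V is the `F`-subspace of V̄ generated under `L`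
by the vectors 1 ⊗ w with w ∈ W (`inducedModule`), so it involves no cobasis. Two facts are needed
for each cobasis: V is the `F`-span of the e(r) ⊗ b^i, and these vectors form a `K`-basis of V̄.

Rationality. Words in the e_i and `S`, applied to 1 ⊗ W, can be straightened over `F`. Interchanging
two letters costs a shorter word, letters from `S` are absorbed by W, and p equal letters e can be
moved next to 1 ⊗ w, where e^p - e^[p] multiplies each component w_c by c(e)^p. The operator on K ⊗
W which does this for all c at once (`charOp`) commutes with the automorphisms of `K`, because α
carries the component of c to that of c^α and `C` is closed under conjugation. Since `F` is perfect,
K/F is Galois, so this operator is defined over `F` (`exists_charOp_one_tmul`). This gives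
`inducedModule_eq_monomialSpan`.

Independence. This rests on a Poincaré-Birkhoff-Witt theorem for u(L̄, c), proved by the diamond
lemma for the rules ab → ba + [a,b] (b < a) and a^p → a^[p] + c(a)^p. The overlaps resolve by the
Jacobi identity and by ad(x^[p]) = ad(x)^p, the latter through the identity ad(y)^(p-1)(x) = ∑ y^s x
y^(p-1-s) of characteristic p. Jacobson's formula extends the p-power relations from a basis to all
of `L`. Hence u(L̄, c) is a free right u(S̄, c)-module on the e(r) (`ReducedEnv.freeMap_bijective`),
and each summand of V̄ is the direct sum of the spaces e(r) ⊗ W̄_c (`CInd.sum_tmul_eq_zero`).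

Descent. The vectors fixed by the coefficientwise action for a `K`-basis are its `F`-span, here V.
So this action fixes e(r) ⊗ w for w ∈ W, and semilinearity gives its values on e(r) ⊗ K ⊗ W.

Cluster. V̄ is spanned by vectors with characters in `C`, so its subquotients have no other
characters (`mem_of_subquotient`). Conversely 1 ⊗ W̄_c is nonzero and has character c, so the
component of c in V̄ contains an irreducible submodule, whose character must be c. -/

set_option linter.unusedSectionVars false

/-! ### Commutator identities in characteristic p and Jacobson's formula -/

section CharP

/-- Pascal's rule for the binomial coefficients of p, which vanish in `R` strictly between 0 and p,
makes consecutive coefficients of p - 1 opposite. -/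
theorem choose_pred_mul_neg_one_pow (R : Type*) [Ring R] (p : ℕ) [hp : Fact p.Prime] [CharP R p]
    (m : ℕ) (hm : m < p) : ((p - 1).choose m : R) = (-1) ^ m := by
  induction m with
  | zero => simp
  | succ m ih =>
    have h1 : p.choose (m + 1) = (p - 1).choose m + (p - 1).choose (m + 1) := by
      obtain ⟨q, hq⟩ : ∃ q, p = q + 1 := ⟨p - 1, by have := hp.out.pos; omega⟩
      rw [hq]; rfl
    have h2 : ((p.choose (m + 1) : ℕ) : R) = 0 :=
      (CharP.cast_eq_zero_iff R p _).2 (hp.out.dvd_choose_self (by omega) hm)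
    rw [h1, Nat.cast_add, ih (by omega)] at h2
    rw [pow_succ, mul_neg_one]
    exact (neg_eq_of_add_eq_zero_right h2).symm

theorem neg_one_pow_prime_sub_one (R : Type*) [Ring R] (p : ℕ) [hp : Fact p.Prime] [CharP R p] :
    (-1 : R) ^ (p - 1) = 1 := by
  have := choose_pred_mul_neg_one_pow R p (p - 1) (by have := hp.out.pos; omega)
  simpa using this.symm

theorem Commute.sub_pow_prime_sub_one {R : Type*} [Ring R] (p : ℕ) [hp : Fact p.Prime] [CharP R p]
    {x y : R} (h : Commute x y) :
    (x - y) ^ (p - 1) = ∑ s ∈ Finset.range p, x ^ s * y ^ (p - 1 - s) := by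
  have h1 : p - 1 + 1 = p := Nat.succ_pred_eq_of_pos hp.out.pos
  rw [sub_eq_add_neg, (h.neg_right).add_pow, h1]
  refine Finset.sum_congr rfl fun s hs => ?_
  have hs' := Finset.mem_range.1 hs
  rw [neg_pow, mul_assoc, mul_assoc, (Nat.cast_commute _ _).symm.eq,
    choose_pred_mul_neg_one_pow R p s hs', ← mul_assoc ((-1) ^ (p - 1 - s)), ← pow_add, show p - 1 - s + s = p - 1 by omega,
    neg_one_pow_prime_sub_one, one_mul]

/-- In characteristic `p`, `ad(y)^(p-1)(x) = ∑ s, y^s x y^(p-1-s)`. -/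
theorem sum_pow_mul_pow_eq_iterate {A : Type*} [Ring A] (p : ℕ) [hp : Fact p.Prime] [CharP A p]
    (x y : A) :
    ∑ s ∈ Finset.range p, y ^ s * x * y ^ (p - 1 - s) = (fun z => y * z - z * y)^[p - 1] x := by
  -- The binomial identity is applied to left and right multiplication by `y`, which commute in
  -- `Module.End ℤ A`; that ring must therefore have characteristic p too.
  have : CharP (Module.End ℤ A) p := by
    rcases subsingleton_or_nontrivial A with hA | hA
    · exact absurd ((CharP.cast_eq_zero_iff A p 1).1 (Subsingleton.elim _ _)) hp.out.not_dvd_one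
    refine ⟨fun n => ?_⟩
    rw [← CharP.cast_eq_zero_iff A p]
    constructor
    · intro h
      have := LinearMap.congr_fun h 1
      simpa using this
    · intro h
      ext a
      simp [Module.End.natCast_apply, h]
  have h := Commute.sub_pow_prime_sub_one p (LinearMap.commute_mulLeft_right (R := ℤ) y y)
  have h2 := LinearMap.congr_fun h x
  have h3 : (fun z => y * z - z * y) = ⇑(LinearMap.mulLeft ℤ y - LinearMap.mulRight ℤ y) := by
    ext z; simp
  rw [h3, ← Module.End.coe_pow, h2, LinearMap.sum_apply]
  refine Finset.sum_congr rfl fun s _ => ?_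
  simp [LinearMap.pow_mulLeft, LinearMap.pow_mulRight, mul_assoc]

open Polynomial in
theorem derivative_pow_noncomm {A : Type*} [Ring A] (f : A[X]) (n : ℕ) :
    derivative (f ^ n) = ∑ s ∈ Finset.range n, f ^ s * derivative f * f ^ (n - 1 - s) := by
  induction n with
  | zero => simp
  | succ n ih =>
    rw [pow_succ, derivative_mul, ih, Finset.sum_range_succ, Finset.sum_mul]
    congr 1
    · refine Finset.sum_congr rfl fun s hs => ?_
      have := Finset.mem_range.1 hs
      rw [mul_assoc, ← pow_succ, show n - 1 - s + 1 = n + 1 - 1 - s by omega]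
    · simp

attribute [local instance 100] LieRing.ofAssociativeRing

-- The variable X is central in A[X], so bracketing with aX + b acts on coefficients by exactly the
-- recursion that defines `adCoeff`.
open Polynomial in
theorem coeff_iterate_eq_adCoeff {A : Type*} [Ring A] (a b : A) (n k : ℕ) :
    ((fun z : A[X] => (C a * X + C b) * z - z * (C a * X + C b))^[n] (C a)).coeff k
      = adCoeff a b n k := by
  induction n generalizing k with
  | zero => cases k <;> simp [adCoeff, coeff_C]
  | succ n ih =>
    rw [Function.iterate_succ_apply']
    set g := (fun z : A[X] => (C a * X + C b) * z - z * (C a * X + C b))^[n] (C a)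
    have hXg : ∀ q : A[X], q * (C a * X) = q * C a * X := fun q => (mul_assoc _ _ _).symm
    have hgX : C a * X * g = C a * g * X := by rw [mul_assoc, X_mul, mul_assoc]
    cases k with
    | zero =>
      simp [adCoeff, ← ih, LieRing.of_associative_ring_bracket, add_mul, mul_add, hXg, hgX]
    | succ k =>
      simp only [adCoeff, ← ih, LieRing.of_associative_ring_bracket, add_mul, mul_add, hXg, hgX,
        coeff_sub, coeff_add, coeff_mul_X, coeff_C_mul, coeff_mul_C]
      abel

-- Expand (aX + b)^p and set X = 1. The extreme coefficients are b^p and a^p. The middle ones are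
-- read off from the derivative, which is ad(aX + b)^(p-1)(a).
open Polynomial in
theorem jacobson_formula (k : Type*) [Field k] {A : Type*} [Ring A] [Algebra k A] (p : ℕ)
    [hp : Fact p.Prime] [CharP k p] (a b : A) :
    (a + b) ^ p = a ^ p + b ^ p + ∑ i ∈ Finset.Icc 1 (p - 1), jacobsonS k p i a b := by
  rcases subsingleton_or_nontrivial A with hA | hA
  · exact Subsingleton.elim _ _
  have hAp : CharP A p := charP_of_injective_algebraMap (algebraMap k A).injective p
  set f : A[X] := C a * X + C b
  have hf : derivative f = C a := by simp [f]
  have hd : derivative (f ^ p) = (fun z : A[X] => f * z - z * f)^[p - 1] (C a) := by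
    rw [derivative_pow_noncomm, hf, sum_pow_mul_pow_eq_iterate]
  have hcoeff : ∀ i ∈ Finset.Icc 1 (p - 1), (f ^ p).coeff i = jacobsonS k p i a b := by
    intro i hi
    rw [Finset.mem_Icc] at hi
    have h1 := congrArg (fun q => coeff q (i - 1)) hd
    rw [coeff_iterate_eq_adCoeff, coeff_derivative, Nat.sub_add_cancel hi.1] at h1
    -- Differentiation multiplies the coefficient of X^i by i, which can be undone because 0 < i <
    -- p.
    have h2 : ((i : k)) ≠ 0 := by
      rw [Ne, CharP.cast_eq_zero_iff k p]
      exact Nat.not_dvd_of_pos_of_lt hi.1 (by have := hp.out.pos; omega)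
    rw [jacobsonS, ← h1, eq_inv_smul_iff₀ h2, Algebra.smul_def, map_natCast, ← Nat.cast_add_one, Nat.sub_add_cancel hi.1,
      Nat.cast_comm]
  have hdeg : f.natDegree ≤ 1 := natDegree_linear_le
  -- Evaluation is multiplicative over the noncommutative `A` only at central elements; 0 is used
  -- here and 1 in `heval`.
  have h0 : (f ^ p).coeff 0 = b ^ p := by
    have h := map_pow (eval₂RingHom' (RingHom.id A) 0 fun a => Commute.zero_right _) f p
    have hev : ∀ q : A[X], eval₂RingHom' (RingHom.id A) 0 (fun a => Commute.zero_right _) q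
        = q.coeff 0 := fun q => eval₂_at_zero _
    rw [hev, hev] at h
    rw [h]
    simp [f]
  have hpp : (f ^ p).coeff p = a ^ p := by
    have := coeff_pow_of_natDegree_le (m := p) hdeg
    simpa [f] using this
  have heval : (a + b) ^ p = ∑ i ∈ Finset.range (p + 1), (f ^ p).coeff i := by
    have h := map_pow (eval₂RingHom' (RingHom.id A) 1 fun a => Commute.one_right _) f p
    have hev : ∀ q : A[X], eval₂RingHom' (RingHom.id A) 1 (fun a => Commute.one_right _) q
        = eval₂ (RingHom.id A) 1 q := fun q => rfl
    rw [hev, hev, eval₂_eq_sum_range' (RingHom.id A) (n := p + 1)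
      (Nat.lt_succ_of_le (by simpa using natDegree_pow_le_of_le p hdeg))] at h
    simp only [one_pow, mul_one, RingHom.id_apply] at h
    rw [h]
    simp [f, eval₂_add, eval₂_mul_X]
  have hrange : Finset.range (p + 1) = insert 0 (insert p (Finset.Icc 1 (p - 1))) := by
    have := hp.out.pos
    ext i
    simp only [Finset.mem_range, Finset.mem_insert, Finset.mem_Icc]
    omega
  have := hp.out.pos
  rw [heval, hrange, Finset.sum_insert (by simp; omega), Finset.sum_insert (by simp; omega), h0,
    hpp, Finset.sum_congr rfl hcoeff]
  abel

end CharP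

/-! ### p-semilinearity of x ↦ x^p - x^[p] -/

section Semilinear

variable {p : ℕ} [hp : Fact p.Prime] {F L : Type*} [Field F] [CharP F p] [LieRing L]
  [LieAlgebra F L] (P : PMap p F L) {K : Type*} [Field K] [Algebra F K]

attribute [local instance 100] LieRing.ofAssociativeRing

theorem map_adCoeff {L' A : Type*} [LieRing L'] [Ring A] (f : L' →+ A)
    (hf : ∀ x y, f ⁅x, y⁆ = f x * f y - f y * f x) (a b : L') (n k : ℕ) :
    f (adCoeff a b n k) = adCoeff (f a) (f b) n k := by
  induction n generalizing k with
  | zero => cases k <;> simp [adCoeff]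
  | succ n ih =>
    cases k <;> simp [adCoeff, ih, hf, LieRing.of_associative_ring_bracket]

/-- For an `F`-linear map `f` into an associative algebra which is a homomorphism of Lie algebras,
the map `x ↦ f(x)^p - f(x^[p])` is additive. -/
theorem PMap.pow_sub_add {A : Type*} [Ring A] [Algebra F A] (f : L →ₗ[F] A)
    (hf : ∀ x y, f ⁅x, y⁆ = f x * f y - f y * f x) (x y : L) :
    f (x + y) ^ p - f (P.toFun (x + y))
      = (f x ^ p - f (P.toFun x)) + (f y ^ p - f (P.toFun y)) := by
  have h : ∀ i, f (jacobsonS F p i x y) = jacobsonS F p i (f x) (f y) := by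
    intro i
    simp only [jacobsonS, map_smul]
    congr 1
    exact map_adCoeff f.toAddMonoidHom hf x y _ _
  rw [map_add, jacobson_formula F p, P.add]
  simp only [map_add, map_sum, h]
  abel

theorem PMap.pow_sub_smul {A : Type*} [Ring A] [Algebra F A] (f : L →ₗ[F] A) (t : F) (x : L) :
    f (t • x) ^ p - f (P.toFun (t • x)) = t ^ p • (f x ^ p - f (P.toFun x)) := by
  rw [P.smul, map_smul, map_smul, smul_pow, smul_sub]

/-- The relations `f(x)^p = f(x^[p]) + c(x)^p` hold for all `x` if they hold on a basis. -/
theorem PMap.pow_eq_of_basis {A : Type*} [Ring A] [Algebra K A] [Algebra F A] [IsScalarTower F K A]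
    (c : L →ₗ[F] K) {κ : Type*} (y : Module.Basis κ F L) (f : L →ₗ[F] A)
    (hf : ∀ x y, f ⁅x, y⁆ = f x * f y - f y * f x)
    (h : ∀ i, f (y i) ^ p = f (P.toFun (y i)) + algebraMap K A (c (y i) ^ p)) (x : L) :
    f x ^ p = f (P.toFun x) + algebraMap K A (c x ^ p) := by
  have : CharP K p := charP_of_injective_algebraMap (algebraMap F K).injective p
  suffices f x ^ p - f (P.toFun x) = algebraMap K A (c x ^ p) by rw [← this]; abel
  induction (y.mem_span x : x ∈ Submodule.span F (Set.range y)) using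
    Submodule.span_induction with
  -- The value at 0 is obtained by scaling with t = 0.
  | zero =>
    have := P.pow_sub_smul f 0 0
    rw [zero_smul, zero_pow hp.out.ne_zero, zero_smul] at this
    rw [this]; simp [hp.out.ne_zero]
  | mem _ hx => obtain ⟨i, rfl⟩ := hx; rw [h]; abel
  | add x y _ _ hx hy => rw [P.pow_sub_add f hf, hx, hy, map_add, add_pow_char, map_add]
  | smul t x _ hx =>
    rw [P.pow_sub_smul, hx, map_smul, Algebra.smul_def t (c x), mul_pow, ← map_pow (algebraMap F K) t, map_mul,
      ← IsScalarTower.algebraMap_apply, Algebra.smul_def]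

/-- The general p-semilinearity applied to the representation on `M`. It is what makes the p-th
roots of the eigenvalues of φ_x on a simple module into an `F`-linear character. -/
theorem phi_eq (M : Type*) [AddCommGroup M] [Module K M] [LieRingModule (K ⊗[F] L) M]
    [LieModule K (K ⊗[F] L) M] (x y : L) (t : F) :
    phi P K M (x + y) = phi P K M x + phi P K M y ∧
      phi P K M (t • x) = (algebraMap F K t) ^ p • phi P K M x := by
  let : Module F M := Module.compHom M (algebraMap F K)
  have : IsScalarTower F K M := IsScalarTower.of_algebraMap_smul fun _ _ => rfl
  let f : L →ₗ[F] Module.End K M :=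
    ((LieModule.toEnd K (K ⊗[F] L) M).toLinearMap.restrictScalars F) ∘ₗ
      TensorProduct.mk F K L 1
  have hf : ∀ x y, f ⁅x, y⁆ = f x * f y - f y * f x := by
    intro x y
    have : (1 : K) ⊗ₜ[F] ⁅x, y⁆ = ⁅(1 : K) ⊗ₜ[F] x, (1 : K) ⊗ₜ[F] y⁆ := by
      rw [LieAlgebra.ExtendScalars.bracket_tmul, mul_one]
    change LieModule.toEnd K (K ⊗[F] L) M ((1 : K) ⊗ₜ[F] ⁅x, y⁆) = _
    rw [this, LieHom.map_lie]
    rfl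
  refine ⟨P.pow_sub_add f hf x y, (P.pow_sub_smul f t x).trans ?_⟩
  exact (((congrArg (· • (f x ^ p - f (P.toFun x))) (map_pow (algebraMap F K) t p)).symm.trans
    (algebraMap_smul K (t ^ p) (f x ^ p - f (P.toFun x))))).symm

end Semilinear

/-! ### The diamond lemma in the free algebra -/

section Diamond

variable {k ι : Type*} [CommRing k]

/-- The element of the free algebra given by a word. -/
noncomputable def FreeAlgebra.word (k : Type*) {ι : Type*} [CommRing k] (w : List ι) :
    FreeAlgebra k ι :=
  (w.map (FreeAlgebra.ι k)).prod

open FreeAlgebra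

theorem FreeAlgebra.word_append (u v : List ι) : word k (u ++ v) = word k u * word k v := by
  simp [word]

theorem FreeAlgebra.word_nil : word k ([] : List ι) = 1 := by simp [word]

theorem FreeAlgebra.word_singleton (a : ι) : word k [a] = FreeAlgebra.ι k a := by simp [word]

theorem FreeAlgebra.word_cons (a : ι) (w : List ι) :
    word k (a :: w) = FreeAlgebra.ι k a * word k w := by simp [word]

theorem FreeAlgebra.word_replicate (n : ℕ) (a : ι) :
    word k (List.replicate n a) = FreeAlgebra.ι k a ^ n := by simp [word]

/-- The words form a basis of the free algebra. -/
noncomputable def FreeAlgebra.wordBasis (k ι : Type*) [CommRing k] :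
    Module.Basis (List ι) k (FreeAlgebra k ι) :=
  (FreeAlgebra.basisFreeMonoid k ι).reindex FreeMonoid.toList

theorem FreeAlgebra.wordBasis_apply (w : List ι) : wordBasis k ι w = word k w := by
  have h : ∀ v : FreeMonoid ι, basisFreeMonoid k ι v = FreeMonoid.lift (FreeAlgebra.ι k) v := by
    intro v
    simp [basisFreeMonoid, equivMonoidAlgebraFreeMonoid]
  rw [wordBasis, Module.Basis.reindex_apply, h, FreeMonoid.lift_apply]
  rfl

/-- A linear map is determined by its values on words. -/
noncomputable def FreeAlgebra.wordLift {X : Type*} [AddCommGroup X] [Module k X] (g : List ι → X) :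
    FreeAlgebra k ι →ₗ[k] X :=
  (wordBasis k ι).constr k g

theorem FreeAlgebra.wordLift_word {X : Type*} [AddCommGroup X] [Module k X] (g : List ι → X)
    (w : List ι) : wordLift g (word k w) = g w := by
  rw [wordLift, ← wordBasis_apply, Module.Basis.constr_basis]

theorem FreeAlgebra.span_word : Submodule.span k (Set.range (word k (ι := ι))) = ⊤ := by
  rw [← (wordBasis k ι).span_eq]
  congr 2
  ext w : 1
  exact (wordBasis_apply w).symm

/-- The span of the words below `w`. -/
def FreeAlgebra.lowerSpan (k : Type*) {ι : Type*} [CommRing k] (lt : List ι → List ι → Prop)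
    (w : List ι) : Submodule k (FreeAlgebra k ι) :=
  Submodule.span k (word k '' {v | lt v w})

/-- The span of the relations, multiplied by words, with leading word below `w`. -/
def FreeAlgebra.lowerIdeal (lt : List ι → List ι → Prop)
    (Rule : List ι → FreeAlgebra k ι → Prop) (w : List ι) : Submodule k (FreeAlgebra k ι) :=
  Submodule.span k {x | ∃ u r v f, Rule r f ∧ lt (u ++ r ++ v) w ∧
    x = word k u * (word k r - f) * word k v}

variable {lt : List ι → List ι → Prop} {Rule : List ι → FreeAlgebra k ι → Prop}

theorem FreeAlgebra.mul_mem_lowerSpan (hcompat : ∀ u v w w', lt w w' → lt (u ++ w ++ v) (u ++ w' ++ v))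
    {r : List ι} {f : FreeAlgebra k ι} (hf : f ∈ lowerSpan k lt r) (u v : List ι) :
    word k u * f * word k v ∈ lowerSpan k lt (u ++ r ++ v) := by
  induction hf using Submodule.span_induction with
  | mem x hx =>
    obtain ⟨w, hw, rfl⟩ := hx
    rw [← word_append, ← word_append]
    exact Submodule.subset_span ⟨_, hcompat _ _ _ _ hw, rfl⟩
  | zero => simp
  | add x y _ _ hx hy => rw [mul_add, add_mul]; exact add_mem hx hy
  | smul t x _ hx => rw [mul_smul_comm, smul_mul_assoc]; exact Submodule.smul_mem _ _ hx

theorem FreeAlgebra.mul_mem_lowerIdeal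
    (hcompat : ∀ u v w w', lt w w' → lt (u ++ w ++ v) (u ++ w' ++ v))
    {r : List ι} {f : FreeAlgebra k ι} (hf : f ∈ lowerIdeal lt Rule r) (u v : List ι) :
    word k u * f * word k v ∈ lowerIdeal lt Rule (u ++ r ++ v) := by
  induction hf using Submodule.span_induction with
  | mem x hx =>
    obtain ⟨u', r', v', f', hR, hl, rfl⟩ := hx
    refine Submodule.subset_span ⟨u ++ u', r', v' ++ v, f', hR, ?_, ?_⟩
    · simpa using hcompat u v _ _ hl
    · simp only [word_append, mul_assoc]
  | zero => simp
  | add x y _ _ hx hy => rw [mul_add, add_mul]; exact add_mem hx hy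
  | smul t x _ hx => rw [mul_smul_comm, smul_mul_assoc]; exact Submodule.smul_mem _ _ hx

/-- Bergman's diamond lemma. -/
theorem FreeAlgebra.diamond (hwf : WellFounded lt)
    (hcompat : ∀ u v w w', lt w w' → lt (u ++ w ++ v) (u ++ w' ++ v))
    (hbelow : ∀ r f, Rule r f → f ∈ lowerSpan k lt r)
    (hoverlap : ∀ A B C f g, B ≠ [] → Rule (A ++ B) f → Rule (B ++ C) g →
      f * word k C - word k A * g ∈ lowerIdeal lt Rule (A ++ B ++ C))
    (hincl : ∀ A B C f g, Rule (A ++ B ++ C) f → Rule B g →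
      f - word k A * g * word k C ∈ lowerIdeal lt Rule (A ++ B ++ C)) :
    ∃ N : FreeAlgebra k ι →ₗ[k] FreeAlgebra k ι,
      (∀ w, (∀ u r v f, Rule r f → w ≠ u ++ r ++ v) → N (word k w) = word k w) ∧
      ∀ u r v f, Rule r f → N (word k u * (word k r - f) * word k v) = 0 := by
  classical
  let Red (w : List ι) (q : List ι × List ι × List ι × FreeAlgebra k ι) : Prop :=
    Rule q.2.1 q.2.2.2 ∧ w = q.1 ++ q.2.1 ++ q.2.2.1
  let val (q : List ι × List ι × List ι × FreeAlgebra k ι) : FreeAlgebra k ι :=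
    word k q.1 * q.2.2.2 * word k q.2.2.1
  -- Normal forms by well-founded recursion: choose any one reduction of `w` and normalise the
  -- result. The value 0 on words not below `w` is never seen, since the reduced element lies in
  -- `lowerSpan`.
  let step : (w : List ι) → ((v : List ι) → lt v w → FreeAlgebra k ι) → FreeAlgebra k ι :=
    fun w rec => if h : ∃ q, Red w q then
      wordLift (k := k) (fun v => if hv : lt v w then rec v hv else 0) (val h.choose)
    else word k w
  let N₀ : List ι → FreeAlgebra k ι := hwf.fix step
  let N : FreeAlgebra k ι →ₗ[k] FreeAlgebra k ι := wordLift N₀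
  have hN₀ : ∀ w, N₀ w = step w fun v _ => N₀ v := fun w => hwf.fix_eq step w
  have hNw : ∀ w, N (word k w) = N₀ w := fun w => wordLift_word _ _
  have hirr : ∀ w, (∀ u r v f, Rule r f → w ≠ u ++ r ++ v) → N (word k w) = word k w := by
    intro w hw
    rw [hNw, hN₀]
    exact dif_neg fun ⟨q, hq⟩ => hw _ _ _ _ hq.1 hq.2
  have hlow : ∀ w, ∀ x ∈ lowerSpan k lt w,
      wordLift (k := k) (fun v => if lt v w then N₀ v else 0) x = N x := by
    intro w x hx
    induction hx using Submodule.span_induction with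
    | mem x hx =>
      obtain ⟨v, hv, rfl⟩ := hx
      rw [wordLift_word, hNw]; exact if_pos hv
    | zero => simp
    | add x y _ _ hx hy => rw [map_add, hx, hy, map_add]
    | smul t x _ hx => rw [map_smul, hx, map_smul]
  have hred : ∀ w, (∃ q, Red w q) → ∃ q, Red w q ∧ N (word k w) = N (val q) := by
    intro w h
    refine ⟨h.choose, h.choose_spec, ?_⟩
    rw [hNw, hN₀]
    refine (dif_pos h).trans ?_
    refine (hlow w _ ?_)
    have h2 := h.choose_spec.2
    refine (congrArg (lowerSpan k lt) h2.symm).le ?_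
    exact mul_mem_lowerSpan hcompat (hbelow _ _ h.choose_spec.1) _ _
  -- Independence of the choice: every single reduction of `w` leads to the same normal form, by
  -- induction on `w`.
  have main : ∀ w u r v f, Rule r f → w = u ++ r ++ v →
      N (word k w) = N (word k u * f * word k v) := by
    intro w
    induction w using hwf.induction with
    | _ w ih =>
    -- The induction hypothesis in usable form: relations with leading word below `w` may be
    -- discarded.
    have hI : ∀ x ∈ lowerIdeal lt Rule w, N x = 0 := by
      intro x hx
      induction hx using Submodule.span_induction with
      | mem x hx =>
        obtain ⟨u, r, v, f, hR, hl, rfl⟩ := hx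
        rw [mul_sub, sub_mul, map_sub, sub_eq_zero, ← ih _ hl u r v f hR rfl, word_append,
          word_append]
      | zero => simp
      | add x y _ _ hx hy => rw [map_add, hx, hy, add_zero]
      | smul t x _ hx => rw [map_smul, hx, smul_zero]
    have hIN : ∀ x y, x - y ∈ lowerIdeal lt Rule w → N x = N y := by
      intro x y h
      rw [← sub_eq_zero, ← map_sub, hI _ h]
    -- Reductions at disjoint places: both results agree, modulo relations below `w`, with the
    -- element in which both replacements have been made.
    have hdisj : ∀ (a g : FreeAlgebra k ι) (A t B r' : List ι) (r : List ι), Rule r a →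
        Rule r' g → w = A ++ r ++ t ++ r' ++ B →
        N (word k A * a * word k (t ++ r' ++ B)) = N (word k (A ++ r ++ t) * g * word k B) := by
      intro a g A t B r' r ha hg hw
      have h1 : word k A * a * (word k t * (word k r' - g) * word k B) ∈ lowerIdeal lt Rule w := by
        have hb := hbelow _ _ ha
        clear ha
        have : w = A ++ r ++ (t ++ r' ++ B) := by simp [hw]
        rw [this]
        induction hb using Submodule.span_induction with
        | mem x hx =>
          obtain ⟨s, hs, rfl⟩ := hx
          refine Submodule.subset_span ⟨A ++ s ++ t, r', B, g, hg, ?_, ?_⟩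
          · simpa using hcompat A (t ++ r' ++ B) _ _ hs
          · simp only [word_append, mul_assoc]
        | zero => simp
        | add x y _ _ hx hy => rw [mul_add, add_mul]; exact add_mem hx hy
        | smul t x _ hx => rw [mul_smul_comm, smul_mul_assoc]; exact Submodule.smul_mem _ _ hx
      have h2 : word k A * (word k r - a) * word k t * g * word k B ∈ lowerIdeal lt Rule w := by
        have hb := hbelow _ _ hg
        clear hg h1
        have : w = (A ++ r ++ t) ++ r' ++ B := by simp [hw]
        rw [this]
        induction hb using Submodule.span_induction with
        | mem x hx =>
          obtain ⟨s, hs, rfl⟩ := hx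
          refine Submodule.subset_span ⟨A, r, t ++ s ++ B, a, ha, ?_, ?_⟩
          · simpa using hcompat (A ++ r ++ t) B _ _ hs
          · simp only [word_append, mul_assoc]
        | zero => simp
        | add x y _ _ hx hy => rw [mul_add, add_mul]; exact add_mem hx hy
        | smul t x _ hx => rw [mul_smul_comm, smul_mul_assoc]; exact Submodule.smul_mem _ _ hx
      apply hIN
      have h3 := sub_mem h1 h2
      convert h3 using 1
      simp only [word_append]
      noncomm_ring
    have hpair : ∀ u r v f u' r' v' f', Rule r f → Rule r' f' → w = u ++ r ++ v →
        w = u' ++ r' ++ v' → u.length ≤ u'.length →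
        N (word k u * f * word k v) = N (word k u' * f' * word k v') := by
      intro u r v f u' r' v' f' hR hR' hw hw' hlen
      have hI2 : ∀ x ∈ lowerIdeal lt Rule r, word k u * x * word k v ∈ lowerIdeal lt Rule w := by
        intro x hx
        rw [hw]; exact mul_mem_lowerIdeal hcompat hx u v
      have h1 : u ++ (r ++ v) = u' ++ (r' ++ v') := by
        rw [← List.append_assoc, ← List.append_assoc, ← hw, ← hw']
      obtain ⟨t, rfl⟩ : ∃ t, u' = u ++ t := by
        rcases List.append_eq_append_iff.1 h1 with ⟨t, ht, _⟩ | ⟨t, ht, _⟩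
        · exact ⟨t, ht⟩
        · have : t = [] := by
            apply List.eq_nil_of_length_eq_zero
            have := congrArg List.length ht
            simp at this; omega
          exact ⟨[], by simp [ht, this]⟩
      rw [List.append_assoc, List.append_right_inj] at h1
      -- Relative position of the two redexes: disjoint (possibly adjacent, `B = []`), the second
      -- inside the first, or a proper overlap in `B`.
      rcases List.append_eq_append_iff.1 h1 with ⟨t', rfl, ht'⟩ | ⟨B, hrB, hB⟩
      · rw [ht']
        have := hdisj f f' u t' v' r' r hR hR' (by rw [hw']; simp)
        simpa using this
      · rcases eq_or_ne B [] with rfl | hBne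
        · simp only [List.append_nil, List.nil_append] at hrB hB
          have := hdisj f f' u [] v' r' r hR hR' (by rw [hw', hrB]; simp)
          rw [← hB, ← hrB]
          simpa using this
        rcases List.append_eq_append_iff.1 hB with ⟨C, h2, h3⟩ | ⟨C, h2, h3⟩
        · apply hIN
          subst hrB h2 h3
          have := hI2 _ (List.append_assoc t r' C ▸ hincl t r' C f f'
            ((List.append_assoc t r' C).symm ▸ hR) hR')
          convert this using 1
          simp only [word_append]
          noncomm_ring
        · apply hIN
          subst hrB h2 h3
          have := mul_mem_lowerIdeal hcompat (hoverlap t B C f f' hBne hR hR') u v'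
          rw [show u ++ (t ++ B ++ C) ++ v' = w by rw [hw']; simp] at this
          convert this using 1
          simp only [word_append]
          noncomm_ring
    intro u r v f hR hw
    obtain ⟨⟨u', r', v', f'⟩, ⟨hR', hw'⟩, hq⟩ := hred w ⟨(u, r, v, f), hR, hw⟩
    rw [hq]
    rcases le_total u.length u'.length with h | h
    · exact (hpair u r v f u' r' v' f' hR hR' hw hw' h).symm
    · exact hpair u' r' v' f' u r v f hR' hR hw' hw h
  refine ⟨N, hirr, fun u r v f hR => ?_⟩
  rw [mul_sub, sub_mul, map_sub, sub_eq_zero, ← main _ u r v f hR rfl, word_append, word_append]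

end Diamond

/-! ### Confluence of the rules of a reduced enveloping algebra -/

section PBW

open FreeAlgebra

theorem List.Lex.append_of_length_eq {α : Type*} {r : α → α → Prop} {s t : List α}
    (h : List.Lex r s t) (hl : s.length = t.length) (v : List α) :
    List.Lex r (s ++ v) (t ++ v) := by
  induction h with
  | nil => simp at hl
  | cons _ ih => exact List.Lex.cons (ih (by simpa using hl))
  | rel h => exact List.Lex.rel h

/-- Shortlex serves as the monomial order: it is well-founded and respects concatenation. Reordering
two letters lowers it lexicographically, while brackets and p-th powers are replaced by shorter
words. -/
theorem List.Shortlex.append_append {α : Type*} {r : α → α → Prop} {s t : List α}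
    (h : List.Shortlex r s t) (u v : List α) : List.Shortlex r (u ++ s ++ v) (u ++ t ++ v) := by
  rcases List.shortlex_def.1 h with h | ⟨h1, h2⟩
  · exact .of_length_lt (by simpa using h)
  · refine .of_lex (by simpa using h1) ?_
    rw [List.append_assoc, List.append_assoc]
    exact List.Lex.append_left r (h2.append_of_length_eq h1 v) u

variable {p : ℕ} [hp : Fact p.Prime] {k g ι : Type*} [Field k] [CharP k p] [LieRing g]
  [LieAlgebra k g] [LinearOrder ι] (y : Module.Basis ι k g) (z : ι → g) (γ : ι → k)

/-- The linear map from a Lie algebra into the free algebra on a basis. -/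
noncomputable def freeEmb : g →ₗ[k] FreeAlgebra k ι := y.constr k (FreeAlgebra.ι k)

theorem freeEmb_basis (a : ι) : freeEmb y (y a) = FreeAlgebra.ι k a := by
  simp [freeEmb]

/-- The rewriting rules of a reduced enveloping algebra, with respect to an ordered basis `y`. -/
inductive PBWRule (p : ℕ) (y : Module.Basis ι k g) (z : ι → g) (γ : ι → k) :
    List ι → FreeAlgebra k ι → Prop
  | comm (a b : ι) (h : b < a) : PBWRule p y z γ [a, b]
      (FreeAlgebra.ι k b * FreeAlgebra.ι k a + freeEmb y ⁅y a, y b⁆)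
  | pow (a : ι) : PBWRule p y z γ (List.replicate p a)
      (freeEmb y (z a) + algebraMap k _ (γ a))

/-- The span of the multiples of relations by words of total length at most `n`. -/
def degIdeal (p : ℕ) (y : Module.Basis ι k g) (z : ι → g) (γ : ι → k) (n : ℕ) :
    Submodule k (FreeAlgebra k ι) :=
  Submodule.span k {x | ∃ u r v f, PBWRule p y z γ r f ∧ (u ++ r ++ v).length ≤ n ∧
    x = word k u * (word k r - f) * word k v}

/-- The ideal of relations below `w`. -/
abbrev pbwIdeal (p : ℕ) (y : Module.Basis ι k g) (z : ι → g) (γ : ι → k) (w : List ι) :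
    Submodule k (FreeAlgebra k ι) :=
  lowerIdeal (List.Shortlex (· < ·)) (PBWRule p y z γ) w

variable {y z γ}

/-- Shorter words are below `w` whatever their letters, so correction terms can be handled by
counting degrees alone. -/
theorem degIdeal_le {n : ℕ} {w : List ι} (h : n < w.length) :
    degIdeal p y z γ n ≤ pbwIdeal p y z γ w := by
  refine Submodule.span_mono ?_
  rintro x ⟨u, r, v, f, hR, hl, rfl⟩
  exact ⟨u, r, v, f, hR, .of_length_lt (by omega), rfl⟩

theorem degIdeal_mono {m n : ℕ} (h : m ≤ n) : degIdeal p y z γ m ≤ degIdeal p y z γ n := by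
  refine Submodule.span_mono ?_
  rintro x ⟨u, r, v, f, hR, hl, rfl⟩
  exact ⟨u, r, v, f, hR, by omega, rfl⟩

theorem word_mul_mem_degIdeal {n : ℕ} {x : FreeAlgebra k ι} (hx : x ∈ degIdeal p y z γ n)
    (s t : List ι) : word k s * x * word k t ∈ degIdeal p y z γ (n + s.length + t.length) := by
  induction hx using Submodule.span_induction with
  | mem x hx =>
    obtain ⟨u, r, v, f, hR, hl, rfl⟩ := hx
    refine Submodule.subset_span ⟨s ++ u, r, v ++ t, f, hR, ?_, ?_⟩
    · simp at hl ⊢; omega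
    · simp only [word_append, mul_assoc]
  | zero => simp
  | add x y _ _ hx hy => rw [mul_add, add_mul]; exact add_mem hx hy
  | smul t x _ hx => rw [mul_smul_comm, smul_mul_assoc]; exact Submodule.smul_mem _ _ hx

-- Which of the two words leads depends on the order of `a` and `b`; requiring both to be below `w`
-- makes the commutator relation available without knowing that order.
variable (p y z γ) in
theorem word_mul_rel_mem (u v w : List ι) (a b : ι)
    (h1 : List.Shortlex (· < ·) (u ++ [a, b] ++ v) w)
    (h2 : List.Shortlex (· < ·) (u ++ [b, a] ++ v) w) :
    word k u * (FreeAlgebra.ι k a * FreeAlgebra.ι k b - FreeAlgebra.ι k b * FreeAlgebra.ι k a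
      - freeEmb y ⁅y a, y b⁆) * word k v ∈ pbwIdeal p y z γ w := by
  rcases lt_trichotomy a b with h | rfl | h
  · rw [← neg_mem_iff]
    refine Submodule.subset_span ⟨u, [b, a], v, _, .comm b a h, h2, ?_⟩
    rw [← neg_mul, ← mul_neg, ← lie_skew (y a), map_neg]
    simp only [word_cons, word_nil, mul_one]
    congr 2
    abel
  · simp
  · refine Submodule.subset_span ⟨u, [a, b], v, _, .comm a b h, h1, ?_⟩
    simp only [word_cons, word_nil, mul_one]
    congr 2
    abel

-- Bilinearity extends the commutator relation from basis elements to all of `g`. It is needed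
-- because brackets and the elements `z a` are not basis elements.
variable (p y z γ) in
theorem comm_mem_degIdeal (x x' : g) :
    freeEmb y x * freeEmb y x' - freeEmb y x' * freeEmb y x - freeEmb y ⁅x, x'⁆
      ∈ degIdeal p y z γ 2 := by
  have key : ∀ a b, b < a → freeEmb y (y a) * freeEmb y (y b) - freeEmb y (y b) * freeEmb y (y a)
      - freeEmb y ⁅y a, y b⁆ ∈ degIdeal p y z γ 2 := by
    intro a b h
    refine Submodule.subset_span ⟨[], [a, b], [], _, .comm a b h, by simp, ?_⟩
    simp only [word_cons, word_nil, mul_one, one_mul, freeEmb_basis]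
    abel
  induction (y.mem_span x : x ∈ Submodule.span k (Set.range y)) using
    Submodule.span_induction with
  | zero => simp
  | add a b _ _ ha hb =>
    convert add_mem ha hb using 1
    simp only [map_add, add_lie]; noncomm_ring
  | smul t a _ ha =>
    convert Submodule.smul_mem _ t ha using 1
    simp only [map_smul, smul_lie, smul_sub, smul_mul_assoc, mul_smul_comm]
  | mem _ hx =>
    obtain ⟨a, rfl⟩ := hx
    induction (y.mem_span x' : x' ∈ Submodule.span k (Set.range y)) using
      Submodule.span_induction with
    | zero => simp
    | add c b _ _ ha hb =>
      convert add_mem ha hb using 1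
      simp only [map_add, lie_add]; noncomm_ring
    | smul t b _ ha =>
      convert Submodule.smul_mem _ t ha using 1
      simp only [map_smul, lie_smul, smul_sub, smul_mul_assoc, mul_smul_comm]
    | mem _ hx =>
      obtain ⟨b, rfl⟩ := hx
      rcases lt_trichotomy a b with h | rfl | h
      · rw [← neg_mem_iff]
        convert key b a h using 1
        rw [← lie_skew (y a), map_neg]
        abel
      · simp
      · exact key a b h

-- The classical overlap abc: the two ways of sorting it to cba differ by brackets of brackets,
-- whose sum vanishes by the Jacobi identity `hJ`.
variable (p y z γ) in
theorem pbw_overlap_comm_comm (a b c : ι) (hab : b < a) (hbc : c < b) :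
    (FreeAlgebra.ι k b * FreeAlgebra.ι k a + freeEmb y ⁅y a, y b⁆) * FreeAlgebra.ι k c
      - FreeAlgebra.ι k a * (FreeAlgebra.ι k c * FreeAlgebra.ι k b + freeEmb y ⁅y b, y c⁆)
      ∈ pbwIdeal p y z γ [a, b, c] := by
  have hac := hbc.trans hab
  have lex : ∀ {d e f : ι}, d < a → List.Shortlex (· < ·) [d, e, f] [a, b, c] := fun h =>
    .of_lex rfl (.rel h)
  have lex2 : ∀ {e f : ι}, e < b → List.Shortlex (· < ·) [a, e, f] [a, b, c] := fun h =>
    .of_lex rfl (.cons (.rel h))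
  have h1 := word_mul_rel_mem p y z γ [b] [] [a, b, c] a c (lex hab) (lex hab)
  have h2 := word_mul_rel_mem p y z γ [] [a] [a, b, c] b c (lex hab) (lex hac)
  have h3 := word_mul_rel_mem p y z γ [] [b] [a, b, c] a c (lex2 hbc) (lex hac)
  have h4 := word_mul_rel_mem p y z γ [c] [] [a, b, c] a b (lex hac) (lex hac)
  have hD : degIdeal p y z γ 2 ≤ pbwIdeal p y z γ [a, b, c] := degIdeal_le (by simp)
  have d1 := hD (comm_mem_degIdeal p y z γ (y b) ⁅y a, y c⁆)
  have d2 := hD (comm_mem_degIdeal p y z γ ⁅y b, y c⁆ (y a))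
  have d3 := hD (comm_mem_degIdeal p y z γ ⁅y a, y b⁆ (y c))
  have hJ : freeEmb y ⁅y b, ⁅y a, y c⁆⁆ + freeEmb y ⁅⁅y b, y c⁆, y a⁆
      + freeEmb y ⁅⁅y a, y b⁆, y c⁆ = 0 := by
    rw [← map_add, ← map_add]
    convert map_zero (freeEmb y)
    rw [← lie_skew ⁅y b, y c⁆ (y a), leibniz_lie (y a) (y b) (y c)]
    abel
  have := add_mem (sub_mem (sub_mem (add_mem h1 h2) h3) h4) (add_mem (add_mem d1 d2) d3)
  convert this using 1
  simp only [word_singleton, word_nil, one_mul, mul_one, freeEmb_basis]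
  have e : freeEmb y ⁅⁅y a, y b⁆, y c⁆
    = - freeEmb y ⁅y b, ⁅y a, y c⁆⁆ - freeEmb y ⁅⁅y b, y c⁆, y a⁆ := by
    rw [eq_sub_iff_add_eq, eq_neg_iff_add_eq_zero, ← hJ]; abel
  rw [e]
  noncomm_ring

/-- Commutation in the free algebra follows ad in `g` modulo relations, each application raising the
degree bound by one. -/
theorem iterate_sub_mem_degIdeal (b : ι) (x : g) (n : ℕ) :
    (fun w => FreeAlgebra.ι k b * w - w * FreeAlgebra.ι k b)^[n] (freeEmb y x)
      - freeEmb y ((LieAlgebra.ad k g (y b) ^ n) x) ∈ degIdeal p y z γ (n + 1) := by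
  induction n with
  | zero => simp
  | succ n ih =>
    rw [Function.iterate_succ_apply', pow_succ', Module.End.mul_apply, LieAlgebra.ad_apply]
    set q := (fun w => FreeAlgebra.ι k b * w - w * FreeAlgebra.ι k b)^[n] (freeEmb y x)
    set x' := (LieAlgebra.ad k g (y b) ^ n) x
    have h1 := word_mul_mem_degIdeal ih [b] []
    have h2 := word_mul_mem_degIdeal ih [] [b]
    have h3 := degIdeal_mono (by omega : 2 ≤ n + 1 + 1) (comm_mem_degIdeal p y z γ (y b) x')
    simp only [List.length_nil, List.length_singleton, add_zero] at h1 h2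
    convert add_mem (sub_mem h1 h2) h3 using 1
    simp only [word_singleton, word_nil, one_mul, mul_one, freeEmb_basis]
    noncomm_ring

/-- In characteristic p the sum is the (p-1)-fold commutator. The bound p is just small enough to
lie below the overlap words of length p + 1. -/
theorem sum_sub_mem_degIdeal (b : ι) (x : g) :
    ∑ s ∈ Finset.range p, FreeAlgebra.ι k b ^ s * freeEmb y x * FreeAlgebra.ι k b ^ (p - 1 - s)
      - freeEmb y ((LieAlgebra.ad k g (y b) ^ (p - 1)) x) ∈ degIdeal p y z γ p := by
  have : CharP (FreeAlgebra k ι) p :=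
    charP_of_injective_algebraMap (algebraMap_leftInverse (R := k) (X := ι)).injective p
  rw [sum_pow_mul_pow_eq_iterate]
  have := iterate_sub_mem_degIdeal (p := p) (y := y) (z := z) (γ := γ) b x (p - 1)
  rwa [Nat.sub_add_cancel hp.out.pos] at this

/-- A telescoping sum: carry `x` through `y ^ n` one factor at a time. -/
theorem sum_pow_mul_comm_mul_pow {A : Type*} [Ring A] (x y e : A) (n : ℕ) :
    ∑ s ∈ Finset.range n, y ^ s * (x * y - y * x - e) * y ^ (n - 1 - s)
      = x * y ^ n - y ^ n * x - ∑ s ∈ Finset.range n, y ^ s * e * y ^ (n - 1 - s) := by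
  induction n with
  | zero => simp
  | succ n ih =>
    have h : ∀ t : A, ∑ s ∈ Finset.range n, y ^ s * t * y ^ (n + 1 - 1 - s)
        = (∑ s ∈ Finset.range n, y ^ s * t * y ^ (n - 1 - s)) * y := by
      intro t
      rw [Finset.sum_mul]
      refine Finset.sum_congr rfl fun s hs => ?_
      have := Finset.mem_range.1 hs
      rw [mul_assoc _ _ y, ← pow_succ, show n - 1 - s + 1 = n + 1 - 1 - s by omega]
    rw [Finset.sum_range_succ, Finset.sum_range_succ, h, h, ih]
    simp only [Nat.add_sub_cancel, Nat.sub_self, pow_zero, mul_one, pow_succ]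
    noncomm_ring

theorem ad_pow_pred (hz : ∀ i x, ⁅z i, x⁆ = (LieAlgebra.ad k g (y i) ^ p) x) (b : ι) (x : g) :
    (LieAlgebra.ad k g (y b) ^ (p - 1)) ⁅x, y b⁆ = - ⁅z b, x⁆ := by
  have h : p = p - 1 + 1 := (Nat.sub_add_cancel hp.out.pos).symm
  rw [hz]
  nth_rw 2 [h]
  rw [pow_succ, Module.End.mul_apply, LieAlgebra.ad_apply, ← map_neg, lie_skew]

/-- Moving a through b^p produces ∑ b^s [a,b] b^(p-1-s), which modulo relations is ad(b)^(p-1)[a,b]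
= -[z_b, a]. This is precisely the commutator met when b^p is replaced by z_b first. The constant
γ_b is central and drops out. -/
theorem pbw_overlap_comm_pow (hz : ∀ i x, ⁅z i, x⁆ = (LieAlgebra.ad k g (y i) ^ p) x)
    (a b : ι) (hab : b < a) :
    (FreeAlgebra.ι k b * FreeAlgebra.ι k a + freeEmb y ⁅y a, y b⁆) * FreeAlgebra.ι k b ^ (p - 1)
      - FreeAlgebra.ι k a * (freeEmb y (z b) + algebraMap k _ (γ b))
      ∈ pbwIdeal p y z γ (a :: List.replicate p b) := by
  have hpp : p - 1 + 1 = p := Nat.sub_add_cancel hp.out.pos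
  set I := pbwIdeal p y z γ (a :: List.replicate p b)
  have hD : degIdeal p y z γ p ≤ I := degIdeal_le (by simp)
  set X := FreeAlgebra.ι k a
  set Y := FreeAlgebra.ι k b
  set E := freeEmb y ⁅y a, y b⁆
  -- The term with exponent 0 on the left is left out: its leading word is the overlap word itself,
  -- so it is not below it. It reappears in the expression to be resolved.
  have h1 : ∑ s ∈ Finset.range (p - 1), Y ^ (s + 1) * (X * Y - Y * X - E) * Y ^ (p - 1 - (s + 1))
      ∈ I := by
    refine sum_mem fun s hs => ?_
    have hs := Finset.mem_range.1 hs
    have := word_mul_rel_mem p y z γ (List.replicate (s + 1) b) (List.replicate (p - 1 - (s + 1)) b)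
      (a :: List.replicate p b) a b
      (.of_lex (by simp; omega) (.rel hab)) (.of_lex (by simp; omega) (.rel hab))
    simpa only [word_replicate] using this
  have h2 : (Y ^ p - (freeEmb y (z b) + algebraMap k _ (γ b))) * X ∈ I := by
    refine Submodule.subset_span ⟨[], List.replicate p b, [a], _, .pow b, ?_, ?_⟩
    · refine .of_lex (by simp) ?_
      rw [← hpp]
      exact .rel hab
    · simp [word_nil, word_replicate, word_singleton, X, Y]
  have h3 := hD (sum_sub_mem_degIdeal (p := p) (y := y) (z := z) (γ := γ) b ⁅y a, y b⁆)
  have h4 := hD (degIdeal_mono hp.out.two_le (comm_mem_degIdeal p y z γ (z b) (y a)))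
  rw [ad_pow_pred hz, map_neg] at h3
  have h5 := sum_pow_mul_comm_mul_pow X Y E p
  have h6 : ∑ s ∈ Finset.range p, Y ^ s * (X * Y - Y * X - E) * Y ^ (p - 1 - s)
      = ∑ s ∈ Finset.range (p - 1), Y ^ (s + 1) * (X * Y - Y * X - E) * Y ^ (p - 1 - (s + 1))
        + (X * Y - Y * X - E) * Y ^ (p - 1) := by
    conv_lhs => rw [← hpp, Finset.sum_range_succ']
    simp
  have h7 : X * Y ^ p = X * Y * Y ^ (p - 1) := by rw [mul_assoc, ← pow_succ', hpp]
  have h8 := Algebra.commutes (γ b) X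
  convert add_mem (add_mem (add_mem h1 h2) h3) h4 using 1
  rw [h6, ← eq_sub_iff_add_eq] at h5
  rw [h5, h7, freeEmb_basis]
  have h9 : (Y ^ p - (freeEmb y (z b) + algebraMap k _ (γ b))) * X
      = Y ^ p * X - freeEmb y (z b) * X - X * algebraMap k _ (γ b) := by
    rw [← h8]; noncomm_ring
  rw [h9]
  noncomm_ring

/-- The mirror image of `pbw_overlap_comm_pow`; the omitted term of the telescoping sum is now the
last one, s = p - 1. -/
theorem pbw_overlap_pow_comm (hz : ∀ i x, ⁅z i, x⁆ = (LieAlgebra.ad k g (y i) ^ p) x)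
    (a b : ι) (hab : b < a) :
    (freeEmb y (z a) + algebraMap k _ (γ a)) * FreeAlgebra.ι k b
      - FreeAlgebra.ι k a ^ (p - 1) *
        (FreeAlgebra.ι k b * FreeAlgebra.ι k a + freeEmb y ⁅y a, y b⁆)
      ∈ pbwIdeal p y z γ (List.replicate p a ++ [b]) := by
  have hpp : p - 1 + 1 = p := Nat.sub_add_cancel hp.out.pos
  set I := pbwIdeal p y z γ (List.replicate p a ++ [b])
  have hD : degIdeal p y z γ p ≤ I := degIdeal_le (by simp)
  set X := FreeAlgebra.ι k b
  set Y := FreeAlgebra.ι k a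
  set E := freeEmb y ⁅y b, y a⁆
  have hE : freeEmb y ⁅y a, y b⁆ = -E := by rw [← lie_skew, map_neg]
  have h1 : ∑ s ∈ Finset.range (p - 1), Y ^ s * (X * Y - Y * X - E) * Y ^ (p - 1 - s)
      ∈ I := by
    refine sum_mem fun s hs => ?_
    have hs := Finset.mem_range.1 hs
    have e : List.replicate p a ++ [b]
        = List.replicate s a ++ (a :: a :: List.replicate (p - 2 - s) a ++ [b]) := by
      have : p = s + (1 + (1 + (p - 2 - s))) := by omega
      conv_lhs => rw [this]
      simp [List.replicate_add]
    have e2 : List.replicate (p - 1 - s) a = a :: List.replicate (p - 2 - s) a := by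
      rw [show p - 1 - s = p - 2 - s + 1 by omega, List.replicate_succ]
    have := word_mul_rel_mem p y z γ (List.replicate s a) (List.replicate (p - 1 - s) a)
      (List.replicate p a ++ [b]) b a
      (.of_lex (by simp; omega) (by
        rw [e, List.append_assoc]; exact List.Lex.append_left _ (.rel hab) _))
      (.of_lex (by simp; omega) (by
        rw [e, List.append_assoc]; exact List.Lex.append_left _ (.cons (.rel hab)) _))
    simpa only [word_replicate] using this
  have h2 : X * (Y ^ p - (freeEmb y (z a) + algebraMap k _ (γ a))) ∈ I := by
    refine Submodule.subset_span ⟨[b], List.replicate p a, [], _, .pow a, ?_, ?_⟩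
    · refine .of_lex (by simp) ?_
      rw [← hpp]
      exact .rel hab
    · simp [word_nil, word_replicate, word_singleton, X, Y]
  have h3 := hD (sum_sub_mem_degIdeal (p := p) (y := y) (z := z) (γ := γ) a ⁅y b, y a⁆)
  have h4 := hD (degIdeal_mono hp.out.two_le (comm_mem_degIdeal p y z γ (z a) (y b)))
  rw [ad_pow_pred hz, map_neg] at h3
  have h5 := sum_pow_mul_comm_mul_pow X Y E p
  have h6 : ∑ s ∈ Finset.range p, Y ^ s * (X * Y - Y * X - E) * Y ^ (p - 1 - s)
      = ∑ s ∈ Finset.range (p - 1), Y ^ s * (X * Y - Y * X - E) * Y ^ (p - 1 - s)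
        + Y ^ (p - 1) * (X * Y - Y * X - E) := by
    conv_lhs => rw [← hpp, Finset.sum_range_succ]
    simp
  have h7 : Y ^ p * X = Y ^ (p - 1) * Y * X := by rw [← pow_succ, hpp]
  have h8 := Algebra.commutes (γ a) X
  convert add_mem (sub_mem h1 h2) (add_mem h3 h4) using 1
  rw [h6, ← eq_sub_iff_add_eq] at h5
  rw [h5, h7, freeEmb_basis, hE]
  have h9 : X * (Y ^ p - (freeEmb y (z a) + algebraMap k _ (γ a)))
      = X * Y ^ p - X * freeEmb y (z a) - algebraMap k _ (γ a) * X := by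
    rw [h8]; noncomm_ring
  rw [h9]
  noncomm_ring

/-- Self-overlaps of a^p resolve because z_a commutes with a: [z_a, y_a] = ad(y_a)^p(y_a) = 0. -/
theorem pbw_overlap_pow_pow (hz : ∀ i x, ⁅z i, x⁆ = (LieAlgebra.ad k g (y i) ^ p) x)
    (a : ι) (s : ℕ) (hs : s < p) (w : List ι) (hw : p < w.length) :
    (freeEmb y (z a) + algebraMap k _ (γ a)) * FreeAlgebra.ι k a ^ s
      - FreeAlgebra.ι k a ^ s * (freeEmb y (z a) + algebraMap k _ (γ a))
      ∈ pbwIdeal p y z γ w := by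
  have h0 : ⁅z a, y a⁆ = 0 := by
    rw [hz, ← Nat.sub_add_cancel hp.out.pos, pow_succ, Module.End.mul_apply, LieAlgebra.ad_apply,
      lie_self, map_zero]
  have key : ∀ n, freeEmb y (z a) * FreeAlgebra.ι k a ^ n - FreeAlgebra.ι k a ^ n * freeEmb y (z a)
      ∈ degIdeal p y z γ (n + 1) := by
    intro n
    induction n with
    | zero => simp
    | succ n ih =>
      have h1 := word_mul_mem_degIdeal ih [] [a]
      have h2 := word_mul_mem_degIdeal (comm_mem_degIdeal p y z γ (z a) (y a))
        (List.replicate n a) []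
      rw [h0] at h2
      simp only [List.length_nil, List.length_singleton, add_zero, List.length_replicate] at h1 h2
      rw [show 2 + n = n + 1 + 1 by omega] at h2
      convert add_mem h1 h2 using 1
      simp only [word_singleton, word_nil, one_mul, mul_one, freeEmb_basis, word_replicate, map_zero,
        pow_succ]
      noncomm_ring
  have := degIdeal_le (by omega) (key s) (w := w)
  convert this using 1
  rw [add_mul, mul_add, Algebra.commutes]
  abel

/-- The normal form map for the rewriting rules of a reduced enveloping algebra. -/
theorem exists_pbw_normalForm [WellFoundedLT ι]
    (hz : ∀ i x, ⁅z i, x⁆ = (LieAlgebra.ad k g (y i) ^ p) x) :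
    ∃ N : FreeAlgebra k ι →ₗ[k] FreeAlgebra k ι,
      (∀ w, (∀ u r v f, PBWRule p y z γ r f → w ≠ u ++ r ++ v) → N (word k w) = word k w) ∧
      ∀ u r v f, PBWRule p y z γ r f → N (word k u * (word k r - f) * word k v) = 0 := by
  have h2 := hp.out.two_le
  have emb_mem : ∀ (x : g) (w : List ι), 1 < w.length →
      freeEmb y x ∈ lowerSpan k (List.Shortlex (· < ·)) w := by
    intro x w hw
    induction (y.mem_span x : x ∈ Submodule.span k (Set.range y)) using
      Submodule.span_induction with
    | mem _ hx =>
      obtain ⟨a, rfl⟩ := hx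
      rw [freeEmb_basis, ← word_singleton]
      exact Submodule.subset_span ⟨[a], List.Shortlex.of_length_lt hw, rfl⟩
    | zero => simp
    | add x y _ _ hx hy => rw [map_add]; exact add_mem hx hy
    | smul t x _ hx => rw [map_smul]; exact Submodule.smul_mem _ _ hx
  refine diamond (lt := List.Shortlex (· < ·)) (List.Shortlex.wf wellFounded_lt)
    (fun u v w w' h => h.append_append u v) ?_ ?_ ?_
  · rintro _ _ (⟨a, b, h⟩ | ⟨a⟩)
    · refine add_mem ?_ (emb_mem _ _ (by simp))
      rw [← word_singleton, ← word_singleton, ← word_append]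
      exact Submodule.subset_span ⟨[b, a], .of_lex rfl (.rel h), rfl⟩
    · refine add_mem (emb_mem _ _ (by simp; omega)) ?_
      rw [Algebra.algebraMap_eq_smul_one, ← word_nil]
      exact Submodule.smul_mem _ _
        (Submodule.subset_span ⟨_, .of_length_lt (by simp; omega), rfl⟩)
  · intro A B C f f' hB h1 h2'
    generalize hAB : A ++ B = r at h1
    generalize hBC : B ++ C = r' at h2'
    rcases h1 with ⟨a, b, hab⟩ | ⟨a⟩
    · obtain ⟨rfl, rfl⟩ | ⟨rfl, rfl⟩ : A = [] ∧ B = [a, b] ∨ A = [a] ∧ B = [b] := by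
        rcases A with _ | ⟨x, _ | ⟨x', A⟩⟩ <;> simp_all
      · rcases h2' with ⟨c, d, hcd⟩ | ⟨c⟩
        · obtain ⟨rfl, rfl, rfl⟩ : a = c ∧ b = d ∧ C = [] := by simp_all
          simp [word_nil]
        · have ha := List.eq_of_mem_replicate (hBC ▸ (by simp : a ∈ [a, b] ++ C))
          have hb := List.eq_of_mem_replicate (hBC ▸ (by simp : b ∈ [a, b] ++ C))
          exact absurd hab (by rw [ha, hb]; exact lt_irrefl _)
      · rcases h2' with ⟨c, d, hcd⟩ | ⟨c⟩
        · obtain ⟨rfl, rfl⟩ : b = c ∧ C = [d] := by simp_all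
          exact (word_singleton (k := k) a).symm ▸ (word_singleton (k := k) d).symm ▸
            pbw_overlap_comm_comm p y z γ a b d hab hcd
        · obtain rfl := List.eq_of_mem_replicate (hBC ▸ (by simp : b ∈ [b] ++ C))
          obtain rfl : C = List.replicate (p - 1) b := by
            rw [List.eq_replicate_iff] at hBC ⊢
            simp at hBC ⊢
            exact ⟨by omega, hBC.2⟩
          have := pbw_overlap_comm_pow (γ := γ) hz a b hab
          rw [← hBC] at this
          simpa [word_singleton, word_replicate] using this
    · rw [List.append_eq_replicate_iff] at hAB
      obtain ⟨hl, hA, hB'⟩ := hAB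
      have hBl := List.length_pos_iff.2 hB
      rcases h2' with ⟨c, d, hcd⟩ | ⟨c⟩
      · obtain ⟨rfl, rfl⟩ | ⟨rfl, rfl⟩ : B = [c, d] ∧ C = [] ∨ B = [c] ∧ C = [d] := by
          clear hA hB' hl hBl
          rcases B with _ | ⟨x, _ | ⟨x', B⟩⟩ <;> simp_all
        · simp at hB'
          exact absurd hcd (by rw [hB'.1, hB'.2]; exact lt_irrefl _)
        · obtain rfl : c = a := by simpa using hB'
          have hA' : A = List.replicate (p - 1) c := by
            rw [hA]; congr 1; simp at hl; omega
          have := pbw_overlap_pow_comm (γ := γ) hz c d hcd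
          rw [hA', word_singleton, word_replicate]
          exact this
      · rw [List.append_eq_replicate_iff] at hBC
        obtain ⟨hl', hB'', hC⟩ := hBC
        obtain rfl : c = a := by
          rcases B with _ | ⟨x, B⟩
          · simp at hB
          · simp [List.replicate_succ] at hB' hB''
            rw [← hB'.1, hB''.1]
        rcases A with _ | ⟨x, A⟩
        · obtain rfl : C = [] := by
            apply List.eq_nil_of_length_eq_zero
            simp at hl; omega
          simp [word_nil]
        have hAC : (x :: A).length = C.length := by omega
        have := pbw_overlap_pow_pow (γ := γ) hz c C.length (by omega) (x :: A ++ B ++ C)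
          (by simp at hl hAC ⊢; omega)
        rw [← word_replicate, ← hC] at this
        have hAC' : x :: A = C := hA.trans (hAC ▸ hC.symm)
        rw [List.append_eq_replicate_iff.2 ⟨hl, hA, hB'⟩] at this
        rw [hAC']
        exact this
  -- No leading word lies properly inside another. For `p = 2`, a square aa is never a word ab with
  -- b < a, so only equal words with equal replacements remain.
  · intro A B C f f' h1 h2'
    generalize hABC : A ++ B ++ C = r at h1
    rcases h1 with ⟨a, b, hab⟩ | ⟨a⟩ <;> rcases h2' with ⟨c, d, hcd⟩ | ⟨c⟩
    · obtain ⟨rfl, rfl, rfl, rfl⟩ : A = [] ∧ C = [] ∧ c = a ∧ d = b := by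
        rcases A with _ | ⟨x, _ | ⟨x', A⟩⟩ <;> simp_all
      simp [word_nil]
    · have hl := congrArg List.length hABC
      simp at hl
      have hp2 : p = 2 := by omega
      obtain ⟨rfl, rfl⟩ : A = [] ∧ C = [] := by
        constructor <;> apply List.eq_nil_of_length_eq_zero <;> omega
      subst hp2
      simp [List.replicate_succ] at hABC
      exact absurd hab (by rw [← hABC.1, ← hABC.2]; exact lt_irrefl _)
    · have hc := List.eq_of_mem_replicate (hABC ▸ (by simp : c ∈ A ++ [c, d] ++ C))
      have hd := List.eq_of_mem_replicate (hABC ▸ (by simp : d ∈ A ++ [c, d] ++ C))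
      exact absurd hcd (by rw [hc, hd]; exact lt_irrefl _)
    · have hl := congrArg List.length hABC
      simp at hl
      obtain ⟨rfl, rfl⟩ : A = [] ∧ C = [] := by
        constructor <;> apply List.eq_nil_of_length_eq_zero <;> omega
      have hc : c ∈ List.replicate p a := by
        rw [← hABC]; simp; omega
      obtain rfl := List.eq_of_mem_replicate hc
      simp [word_nil]

end PBW

/-! ### Sorted words and the ideal of relations -/

section MonomialIndependence

open FreeAlgebra

/-- The nondecreasing word in which `j` occurs `r j` times. -/
def exponentWord {d : ℕ} (r : Fin d → ℕ) : List (Fin d) :=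
  (List.ofFn fun j => List.replicate (r j) j).flatten

theorem pairwise_exponentWord {d : ℕ} (r : Fin d → ℕ) :
    (exponentWord r).Pairwise (· ≤ ·) := by
  rw [exponentWord, List.pairwise_flatten]
  constructor
  · intro l hl
    rw [List.mem_ofFn] at hl
    obtain ⟨j, rfl⟩ := hl
    exact List.pairwise_replicate.2 (Or.inr le_rfl)
  · rw [List.pairwise_ofFn]
    intro i j hij a ha b hb
    rw [List.eq_of_mem_replicate ha, List.eq_of_mem_replicate hb]
    exact hij.le

theorem count_exponentWord {d : ℕ} (r : Fin d → ℕ) (j : Fin d) :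
    (exponentWord r).count j = r j := by
  rw [exponentWord, List.count_flatten, List.map_ofFn, List.sum_ofFn, Finset.sum_eq_single j]
  · simp
  · intro i _ hij
    simp [List.count_replicate, hij]
  · simp

theorem word_exponentWord {k : Type*} [CommRing k] {d : ℕ} (r : Fin d → ℕ) :
    word k (exponentWord r) = (List.ofFn fun j => FreeAlgebra.ι k j ^ r j).prod := by
  rw [exponentWord, word, List.map_flatten, List.prod_flatten, List.map_map, List.map_ofFn]
  congr 2
  ext j
  simp

variable {p : ℕ} [hp : Fact p.Prime]

/-- These words are irreducible: being sorted they have no descent, and no letter occurs p times. -/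
theorem exponentWord_ne {k g : Type*} [Field k] [CharP k p] [LieRing g] [LieAlgebra k g] {d : ℕ}
    {y : Module.Basis (Fin d) k g} {z : Fin d → g} {γ : Fin d → k} (r : Fin d → Fin p)
    (u s v : List (Fin d)) (f : FreeAlgebra k (Fin d)) (h : PBWRule p y z γ s f) :
    exponentWord (fun j => (r j : ℕ)) ≠ u ++ s ++ v := by
  intro h2
  rcases h with ⟨a, b, hab⟩ | ⟨a⟩
  · have := pairwise_exponentWord (fun j => (r j : ℕ))
    rw [h2, List.pairwise_append, List.pairwise_append] at this
    have := this.1.2.1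
    simp at this
    exact absurd hab (not_lt.2 this)
  · have := count_exponentWord (fun j => (r j : ℕ)) a
    rw [h2, List.count_append, List.count_append, List.count_replicate_self] at this
    have := (r a).2
    omega

/-- The two-sided ideal of the relations of a reduced enveloping algebra, as a left ideal of the
free algebra. -/
def relIdeal {k g ι : Type*} [Field k] [LieRing g] [LieAlgebra k g] [LinearOrder ι] (p : ℕ)
    (y : Module.Basis ι k g) (z : ι → g) (γ : ι → k) :
    Submodule (FreeAlgebra k ι) (FreeAlgebra k ι) where
  __ := lowerIdeal (fun _ _ => True) (PBWRule p y z γ) []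
  smul_mem' := by
    intro a x hx
    change a * x ∈ lowerIdeal (fun _ _ => True) (PBWRule p y z γ) []
    induction (span_word (k := k) (ι := ι) ▸ Submodule.mem_top : a ∈ Submodule.span k _) using
      Submodule.span_induction with
    | mem _ h =>
      obtain ⟨w, rfl⟩ := h
      have := mul_mem_lowerIdeal (fun _ _ _ _ h => h) hx w []
      rw [word_nil, mul_one] at this
      refine Submodule.span_mono ?_ this
      rintro _ ⟨u, r, v, f, hR, _, rfl⟩
      exact ⟨u, r, v, f, hR, trivial, rfl⟩
    | zero => simp
    | add a b _ _ ha hb => rw [add_mul]; exact add_mem ha hb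
    | smul t a _ ha => rw [smul_mul_assoc]; exact Submodule.smul_mem _ _ ha

theorem mem_relIdeal {k g ι : Type*} [Field k] [LieRing g] [LieAlgebra k g] [LinearOrder ι] {p : ℕ}
    {y : Module.Basis ι k g} {z : ι → g} {γ : ι → k} {x : FreeAlgebra k ι} :
    x ∈ relIdeal p y z γ ↔ x ∈ lowerIdeal (fun _ _ => True) (PBWRule p y z γ) [] := Iff.rfl

theorem mul_mem_relIdeal {k g ι : Type*} [Field k] [LieRing g] [LieAlgebra k g] [LinearOrder ι]
    {p : ℕ} {y : Module.Basis ι k g} {z : ι → g} {γ : ι → k} {x : FreeAlgebra k ι}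
    (hx : x ∈ relIdeal p y z γ) (a : FreeAlgebra k ι) : x * a ∈ relIdeal p y z γ := by
  rw [mem_relIdeal] at hx ⊢
  induction (span_word (k := k) (ι := ι) ▸ Submodule.mem_top : a ∈ Submodule.span k _) using
    Submodule.span_induction with
  | mem _ h =>
    obtain ⟨w, rfl⟩ := h
    have := mul_mem_lowerIdeal (fun _ _ _ _ h => h) hx [] w
    rw [word_nil, one_mul] at this
    refine Submodule.span_mono ?_ this
    rintro _ ⟨u, r, v, f, hR, _, rfl⟩
    exact ⟨u, r, v, f, hR, trivial, rfl⟩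
  | zero => simp
  | add a b _ _ ha hb => rw [mul_add]; exact add_mem ha hb
  | smul t a _ ha => rw [mul_smul_comm]; exact Submodule.smul_mem _ _ ha

end MonomialIndependence

/-! ### Linear independence of the ordered monomials in u(L̄, c) -/

namespace ReducedEnv

variable {p : ℕ} {F L : Type*} [Field F] [LieRing L] [LieAlgebra F L] {P : PMap p F L}
variable {K : Type*} [Field K] [Algebra F K] {c : L →ₗ[F] K}

attribute [local instance 100] LieRing.ofAssociativeRing

theorem lift_ι {A : Type*} [Ring A] [Algebra K A] (f : (K ⊗[F] L) →ₗ⁅K⁆ A)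
    (hf : ∀ x : L, f ((1 : K) ⊗ₜ[F] x) ^ p
      = f ((1 : K) ⊗ₜ[F] P.toFun x) + algebraMap K A (c x ^ p)) (x : K ⊗[F] L) :
    lift f hf (ι P c x) = f x := by
  have := RingQuot.liftAlgHom_mkAlgHom_apply K (s := ReducedRel P c)
    (UniversalEnvelopingAlgebra.lift K f) (by rintro _ _ ⟨x⟩; simpa using hf x)
    (UniversalEnvelopingAlgebra.ι K x)
  exact this.trans (UniversalEnvelopingAlgebra.lift_ι_apply K f x)

theorem mk_surjective : Function.Surjective (mk P c) := RingQuot.mkAlgHom_surjective K _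

theorem adjoin_range_ι : Algebra.adjoin K (Set.range (ι P c)) = ⊤ := by
  have h1 : Function.Surjective ((mk P c).comp (UniversalEnvelopingAlgebra.mkAlgHom K _)) :=
    mk_surjective.comp (RingCon.mkₐ_surjective (α := K) _)
  rw [← AlgHom.range_eq_top] at h1
  rw [← h1, ← Algebra.map_top, ← TensorAlgebra.adjoin_range_ι, AlgHom.map_adjoin,
    ← Set.range_comp]
  rfl

/-- A subspace which contains `1` and is stable under left multiplication by `L` is everything. -/
theorem eq_top_of_mul_mem (T : Submodule K (ReducedEnv P c)) (h1 : (1 : ReducedEnv P c) ∈ T)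
    (hT : ∀ (x : L), ∀ a ∈ T, ι P c ((1 : K) ⊗ₜ[F] x) * a ∈ T) : T = ⊤ := by
  have hT' : ∀ (x : K ⊗[F] L), ∀ a ∈ T, ι P c x * a ∈ T := by
    intro x a ha
    induction x with
    | zero => simp
    | add x y hx hy => rw [map_add, add_mul]; exact add_mem hx hy
    | tmul t x =>
      have : t ⊗ₜ[F] x = t • ((1 : K) ⊗ₜ[F] x) := by
        rw [TensorProduct.smul_tmul', smul_eq_mul, mul_one]
      rw [this, map_smul, smul_mul_assoc]
      exact T.smul_mem _ (hT x a ha)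
  have key : ∀ b ∈ Algebra.adjoin K (Set.range (ι P c)), ∀ a ∈ T, b * a ∈ T := by
    intro b hb
    induction hb using Algebra.adjoin_induction with
    | mem _ h => obtain ⟨x, rfl⟩ := h; exact hT' x
    | algebraMap t =>
      intro a ha
      rw [← Algebra.smul_def]; exact T.smul_mem _ ha
    | add b b' _ _ hb hb' =>
      intro a ha
      rw [add_mul]; exact add_mem (hb a ha) (hb' a ha)
    | mul b b' _ _ hb hb' =>
      intro a ha
      rw [mul_assoc]; exact hb _ (hb' a ha)
  refine eq_top_iff.2 fun b _ => ?_
  simpa using key b (by rw [adjoin_range_ι]; exact Algebra.mem_top) 1 h1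

open FreeAlgebra in
/-- The ordered monomials with exponents less than `p` in a basis of `L` are linearly independent in
the reduced enveloping algebra. -/
theorem linearIndependent_monomials [hp : Fact p.Prime] [CharP F p] (c : L →ₗ[F] K) {d : ℕ}
    (x : Module.Basis (Fin d) F L) :
    LinearIndependent K fun r : Fin d → Fin p =>
      (List.ofFn fun j => ι P c ((1 : K) ⊗ₜ[F] x j) ^ (r j : ℕ)).prod := by
  have hK : CharP K p := charP_of_injective_algebraMap (algebraMap F K).injective p
  let y : Module.Basis (Fin d) K (K ⊗[F] L) := x.baseChange K
  have hy : ∀ i, y i = (1 : K) ⊗ₜ[F] x i := fun i => Module.Basis.baseChange_apply K x i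
  let z : Fin d → K ⊗[F] L := fun i => (1 : K) ⊗ₜ[F] P.toFun (x i)
  let γ : Fin d → K := fun i => c (x i) ^ p
  -- The axiom ad(x^[p]) = ad(x)^p after extension of scalars; this is all that confluence requires
  -- of the p-operation.
  have hz : ∀ i w, ⁅z i, w⁆ = (LieAlgebra.ad K (K ⊗[F] L) (y i) ^ p) w := by
    intro i w
    have h3 : ∀ (n : ℕ) (t : K) (w : L), (LieAlgebra.ad K (K ⊗[F] L) (y i) ^ n) (t ⊗ₜ w)
        = t ⊗ₜ ((LieAlgebra.ad F L (x i) ^ n) w) := by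
      intro n
      induction n with
      | zero => intro t w; simp
      | succ n ih =>
        intro t w
        have := ih t ⁅x i, w⁆
        rw [hy] at this
        simp [pow_succ, hy, this]
    induction w with
    | zero => simp
    | add a b ha hb => simp [ha, hb]
    | tmul t w => rw [h3, ← P.ad_toFun]; simp [z]
  obtain ⟨N, hN, hN0⟩ := exists_pbw_normalForm (p := p) (y := y) (z := z) (γ := γ) hz
  let J := relIdeal p y z γ
  -- Only a map out of u(L̄, c) is needed. The quotient of the free algebra by the relations is made
  -- into a u(L̄, c)-module, and the normal form map separates the images of the monomials.
  let Q := FreeAlgebra K (Fin d) ⧸ J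
  let op : FreeAlgebra K (Fin d) →ₐ[K] Module.End K Q := Algebra.lsmul K K Q
  have hop : ∀ a ∈ J, op a = 0 := by
    intro a ha
    refine LinearMap.ext fun q => ?_
    obtain ⟨b, rfl⟩ := Submodule.Quotient.mk_surjective J q
    change a • (Submodule.Quotient.mk b : Q) = 0
    rw [← Submodule.Quotient.mk_smul, Submodule.Quotient.mk_eq_zero]
    exact mul_mem_relIdeal ha b
  let f : (K ⊗[F] L) →ₗ⁅K⁆ Module.End K Q :=
    { op.toLinearMap ∘ₗ freeEmb y with
      map_lie' := by
        intro a b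
        have h := comm_mem_degIdeal p y z γ a b
        have h2 : op (freeEmb y a * freeEmb y b - freeEmb y b * freeEmb y a - freeEmb y ⁅a, b⁆)
            = 0 := by
          refine hop _ (mem_relIdeal.2 (Submodule.span_mono ?_ h))
          rintro _ ⟨u, r, v, f, hR, _, rfl⟩
          exact ⟨u, r, v, f, hR, trivial, rfl⟩
        rw [map_sub, map_sub, map_mul, map_mul, sub_eq_zero] at h2
        exact h2.symm }
  have hf' : ∀ a, f a = op (freeEmb y a) := fun _ => rfl
  -- The rewriting rules contain the p-power relation only for basis elements, whereas u(L̄, c)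
  -- imposes it for every element of `L`.
  have hf : ∀ w : L, f ((1 : K) ⊗ₜ[F] w) ^ p
      = f ((1 : K) ⊗ₜ[F] P.toFun w) + algebraMap K _ (c w ^ p) := by
    let f' : L →ₗ[F] Module.End K Q :=
      ((f : (K ⊗[F] L) →ₗ[K] Module.End K Q).restrictScalars F) ∘ₗ TensorProduct.mk F K L 1
    refine P.pow_eq_of_basis (A := Module.End K Q) c x f' ?_ ?_
    · intro a b
      have : (1 : K) ⊗ₜ[F] ⁅a, b⁆ = ⁅(1 : K) ⊗ₜ[F] a, (1 : K) ⊗ₜ[F] b⁆ := by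
        rw [LieAlgebra.ExtendScalars.bracket_tmul, mul_one]
      change f ((1 : K) ⊗ₜ[F] ⁅a, b⁆) = _
      rw [this, LieHom.map_lie]
      rfl
    · intro i
      change f (1 ⊗ₜ x i) ^ p = f (z i) + algebraMap K _ (γ i)
      rw [← hy, hf', hf', ← map_pow, ← AlgHom.commutes op, ← map_add, ← sub_eq_zero, ← map_sub]
      refine hop _ (mem_relIdeal.2 (Submodule.subset_span
        ⟨[], List.replicate p i, [], _, .pow i, trivial, ?_⟩))
      rw [word_nil, one_mul, mul_one, word_replicate, freeEmb_basis]
  let ev : ReducedEnv P c →ₗ[K] Q :=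
    (LinearMap.applyₗ (Submodule.Quotient.mk 1 : Q)) ∘ₗ (lift f hf).toLinearMap
  have hJN : J.restrictScalars K ≤ LinearMap.ker N := by
    refine Submodule.span_le.2 ?_
    rintro _ ⟨u, r, v, f, hR, _, rfl⟩
    exact hN0 u r v f hR
  let N' : Q →ₗ[K] FreeAlgebra K (Fin d) := (J.restrictScalars K).liftQ N hJN
  have hmon : ∀ r : Fin d → Fin p, (N' ∘ₗ ev)
      (List.ofFn fun j => ι P c ((1 : K) ⊗ₜ[F] x j) ^ (r j : ℕ)).prod
      = wordBasis K (Fin d) (exponentWord fun j => (r j : ℕ)) := by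
    intro r
    have h1 : lift f hf (List.ofFn fun j => ι P c ((1 : K) ⊗ₜ[F] x j) ^ (r j : ℕ)).prod
        = op (word K (exponentWord fun j => (r j : ℕ))) := by
      rw [word_exponentWord, map_list_prod, map_list_prod, List.map_ofFn, List.map_ofFn]
      congr 2
      ext j : 1
      simp only [Function.comp_apply, map_pow, lift_ι]
      rw [← hy, hf', freeEmb_basis]
    have h2 : ev (List.ofFn fun j => ι P c ((1 : K) ⊗ₜ[F] x j) ^ (r j : ℕ)).prod
        = Submodule.Quotient.mk (word K (exponentWord fun j => (r j : ℕ))) := by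
      change lift f hf _ (Submodule.Quotient.mk 1 : Q) = _
      rw [h1]
      change word K (exponentWord fun j => (r j : ℕ)) • (Submodule.Quotient.mk 1 : Q) = _
      rw [← Submodule.Quotient.mk_smul, smul_eq_mul, mul_one]
    rw [LinearMap.comp_apply, h2, wordBasis_apply]
    exact hN _ fun u s v f h => exponentWord_ne r u s v f h
  refine LinearIndependent.of_comp (N' ∘ₗ ev) ?_
  have : (N' ∘ₗ ev) ∘ (fun r : Fin d → Fin p =>
      (List.ofFn fun j => ι P c ((1 : K) ⊗ₜ[F] x j) ^ (r j : ℕ)).prod)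
      = wordBasis K (Fin d) ∘ fun r : Fin d → Fin p => exponentWord fun j => (r j : ℕ) :=
    funext hmon
  rw [this]
  refine (wordBasis K (Fin d)).linearIndependent.comp _ fun r s h => ?_
  ext j
  rw [← count_exponentWord (fun j => (r j : ℕ)) j, ← count_exponentWord (fun j => (s j : ℕ)) j]
  exact congrArg _ h

end ReducedEnv

/-! ### Straightening words of operators -/

section Straightening

variable {k X : Type*} [CommRing k] [AddCommGroup X] [Module k X] {n : ℕ}

/-- The span of all products of at most `m` operators among the `y j` and the members of `H`,
applied to `W₀`. -/
def wordSpan (y : Fin n → Module.End k X) (H : Submodule k (Module.End k X)) (W₀ : Submodule k X)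
    (m : ℕ) : Submodule k X :=
  Submodule.span k {x | ∃ l : List (Module.End k X), l.length ≤ m ∧
    (∀ a ∈ l, a ∈ Set.range y ∨ a ∈ H) ∧ ∃ w ∈ W₀, x = l.prod w}

/-- The span of all ordered monomials with exponents less than `p`, applied to `W₀`. -/
def monomialSpan (p : ℕ) (y : Fin n → Module.End k X) (W₀ : Submodule k X) : Submodule k X :=
  Submodule.span k {x | ∃ r : Fin n → Fin p, ∃ w ∈ W₀,
    x = (List.ofFn fun j => y j ^ (r j : ℕ)).prod w}

variable {p : ℕ} {y : Fin n → Module.End k X} {H : Submodule k (Module.End k X)}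
  {W₀ : Submodule k X}

theorem wordSpan_mono {m m' : ℕ} (h : m ≤ m') : wordSpan y H W₀ m ≤ wordSpan y H W₀ m' :=
  Submodule.span_mono fun _ ⟨l, hl, hm, w, hw, e⟩ => ⟨l, hl.trans h, hm, w, hw, e⟩

theorem apply_mem_wordSpan {m : ℕ} {a : Module.End k X}
    (ha : a ∈ Submodule.span k (Set.range y) ⊔ H) {x : X} (hx : x ∈ wordSpan y H W₀ m) :
    a x ∈ wordSpan y H W₀ (m + 1) := by
  have key : ∀ b : Module.End k X, b ∈ Set.range y ∨ b ∈ H → b x ∈ wordSpan y H W₀ (m + 1) := by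
    intro b hb
    induction hx using Submodule.span_induction with
    | mem _ h =>
      obtain ⟨l, hl, hm, w, hw, rfl⟩ := h
      refine Submodule.subset_span ⟨b :: l, by simpa using hl, ?_, w, hw, by simp⟩
      intro c hc
      rcases List.mem_cons.1 hc with rfl | hc
      exacts [hb, hm c hc]
    | zero => simp
    | add x y _ _ hx hy => rw [map_add]; exact add_mem hx hy
    | smul t x _ hx => rw [map_smul]; exact Submodule.smul_mem _ _ hx
  obtain ⟨b, hb, h, hh, rfl⟩ := Submodule.mem_sup.1 ha
  refine add_mem ?_ (key h (Or.inr hh))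
  clear ha
  induction hb using Submodule.span_induction with
  | mem b hb => exact key b (Or.inl hb)
  | zero => simp
  | add b c _ _ hb hc => exact add_mem hb hc
  | smul t b _ hb => exact Submodule.smul_mem _ _ hb

theorem prod_apply_mem_wordSpan {m : ℕ} (l : List (Module.End k X))
    (hl : ∀ a ∈ l, a ∈ Set.range y ∨ a ∈ H) {x : X} (hx : x ∈ wordSpan y H W₀ m) :
    l.prod x ∈ wordSpan y H W₀ (m + l.length) := by
  induction l with
  | nil => simpa using hx
  | cons a l ih =>
    rw [List.prod_cons, Module.End.mul_apply, List.length_cons, ← add_assoc]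
    refine apply_mem_wordSpan ?_ (ih fun b hb => hl b (List.mem_cons_of_mem _ hb))
    rcases hl a List.mem_cons_self with h | h
    exacts [Submodule.mem_sup_left (Submodule.subset_span h), Submodule.mem_sup_right h]

/-- Each interchange of neighbours costs a commutator, which is a combination of single letters and
thus gives shorter words. -/
theorem prod_sub_prod_mem_wordSpan
    (hcomm : ∀ a b, a ∈ Set.range y ∨ a ∈ H → b ∈ Set.range y ∨ b ∈ H →
      a * b - b * a ∈ Submodule.span k (Set.range y) ⊔ H)
    {l l' : List (Module.End k X)} (h : l.Perm l') (hl : ∀ a ∈ l, a ∈ Set.range y ∨ a ∈ H)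
    {w : X} (hw : w ∈ W₀) (m : ℕ) (hm : l.length = m + 1) :
    l.prod w - l'.prod w ∈ wordSpan y H W₀ m := by
  induction h generalizing m with
  | nil => simp at hm
  | @cons a l l' h ih =>
    rw [List.length_cons] at hm
    cases m with
    | zero =>
      obtain rfl : l = [] := List.eq_nil_of_length_eq_zero (by omega)
      obtain rfl : l' = [] := h.nil_eq.symm
      simp
    | succ m =>
      rw [List.prod_cons, List.prod_cons, Module.End.mul_apply, Module.End.mul_apply, ← map_sub]
      refine apply_mem_wordSpan ?_
        (ih (fun b hb => hl b (List.mem_cons_of_mem _ hb)) m (by omega))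
      rcases hl a List.mem_cons_self with h | h
      exacts [Submodule.mem_sup_left (Submodule.subset_span h), Submodule.mem_sup_right h]
  | swap a b l =>
    obtain ⟨m, rfl⟩ : ∃ m', m = m' + 1 := ⟨m - 1, by simp at hm; omega⟩
    have := hcomm b a (hl b (by simp)) (hl a (by simp))
    have h2 : (b :: a :: l).prod w - (a :: b :: l).prod w = (b * a - a * b) (l.prod w) := by
      simp
    rw [h2]
    refine apply_mem_wordSpan this (Submodule.subset_span ⟨l, ?_, ?_, w, hw, rfl⟩)
    · simp at hm; omega
    · exact fun c hc => hl c (by simp [hc])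
  | @trans l₁ l₂ l₃ h1 h2 ih1 ih2 =>
    rw [← sub_add_sub_cancel _ (l₂.prod w)]
    exact add_mem (ih1 hl m hm)
      (ih2 (fun a ha => hl a (h1.mem_iff.2 ha)) m (h1.length_eq ▸ hm))

/-- Induction on length: modulo shorter words the letters may be permuted at will. A letter from `H`
is moved to the right end and absorbed by `W₀`; p equal letters are moved there and replaced by
words of length at most 1; otherwise the word can be sorted into an admissible monomial. The p-power
condition is thus needed on `W₀` only. -/
theorem wordSpan_le_monomialSpan [hp : Fact p.Prime]
    (hcomm : ∀ a b, a ∈ Set.range y ∨ a ∈ H → b ∈ Set.range y ∨ b ∈ H →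
      a * b - b * a ∈ Submodule.span k (Set.range y) ⊔ H)
    (hH : ∀ h ∈ H, ∀ w ∈ W₀, h w ∈ W₀)
    (hpow : ∀ i, ∀ w ∈ W₀, (y i ^ p) w ∈ wordSpan y H W₀ 1) (m : ℕ) :
    wordSpan y H W₀ m ≤ monomialSpan p y W₀ := by
  have h2 := hp.out.two_le
  induction m with
  | zero =>
    refine Submodule.span_le.2 ?_
    rintro _ ⟨l, hl, -, w, hw, rfl⟩
    obtain rfl : l = [] := List.eq_nil_of_length_eq_zero (by omega)
    refine Submodule.subset_span ⟨fun _ => ⟨0, by omega⟩, w, hw, ?_⟩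
    simp
  | succ m ih =>
    refine Submodule.span_le.2 ?_
    rintro _ ⟨l, hl, hmem, w, hw, rfl⟩
    rcases Nat.lt_or_ge l.length (m + 1) with hlt | hge
    · exact ih (Submodule.subset_span ⟨l, by omega, hmem, w, hw, rfl⟩)
    have hlm : l.length = m + 1 := by omega
    have hperm : ∀ l' : List (Module.End k X), l.Perm l' → l'.prod w ∈ monomialSpan p y W₀ →
        l.prod w ∈ monomialSpan p y W₀ := by
      intro l' h hl'
      rw [← sub_add_cancel (l.prod w) (l'.prod w)]
      exact add_mem (ih (prod_sub_prod_mem_wordSpan hcomm h hmem hw m hlm)) hl'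
    by_cases hall : ∀ a ∈ l, a ∈ Set.range y
    · obtain ⟨s, rfl⟩ : l ∈ Set.range (List.map y) := by rw [Set.range_list_map]; exact hall
      have hs : s.Perm (exponentWord fun j => s.count j) := by
        rw [List.perm_iff_count]
        intro j
        rw [count_exponentWord]
      by_cases hr : ∀ j, s.count j < p
      · refine hperm _ (hs.map y) (Submodule.subset_span ⟨fun j => ⟨s.count j, hr j⟩, w, hw, ?_⟩)
        rw [exponentWord, List.map_flatten, List.prod_flatten, List.map_map, List.map_ofFn]
        congr 3
        ext j : 1
        simp
      · push Not at hr
        obtain ⟨j, hj⟩ := hr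
        obtain ⟨t, ht⟩ : ∃ t, s.Perm (t ++ List.replicate p j) := by
          obtain ⟨t, ht⟩ := (List.replicate_sublist_iff.2 hj).exists_perm_append
          exact ⟨t, ht.trans List.perm_append_comm⟩
        refine hperm _ (ht.map y) ?_
        have hlen := ht.length_eq
        simp at hlen hlm
        rw [List.map_append, List.prod_append, Module.End.mul_apply, List.map_replicate,
          List.prod_replicate]
        refine ih (wordSpan_mono ?_ (prod_apply_mem_wordSpan (t.map y) ?_ (hpow j w hw)))
        · simp; omega
        · intro a ha
          obtain ⟨i, _, rfl⟩ := List.mem_map.1 ha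
          exact Or.inl ⟨i, rfl⟩
    · push Not at hall
      obtain ⟨a, hal, hay⟩ := hall
      have haH : a ∈ H := (hmem a hal).resolve_left hay
      obtain ⟨s, t, rfl⟩ := List.append_of_mem hal
      refine hperm (s ++ t ++ [a]) ?_ (ih (Submodule.subset_span
        ⟨s ++ t, ?_, ?_, a w, hH a haH w hw, by simp⟩))
      · rw [List.append_assoc]
        exact (List.perm_append_comm (l₁ := [a])).append_left s
      · simp at hlm ⊢; omega
      · exact fun b hb => hmem b (by simp at hb ⊢; tauto)

/-- The span of the ordered monomials with exponents less than `p`, applied to `W₀`, is stable under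
the Lie algebra of operators. -/
theorem apply_mem_monomialSpan [hp : Fact p.Prime]
    (hcomm : ∀ a b, a ∈ Set.range y ∨ a ∈ H → b ∈ Set.range y ∨ b ∈ H →
      a * b - b * a ∈ Submodule.span k (Set.range y) ⊔ H)
    (hH : ∀ h ∈ H, ∀ w ∈ W₀, h w ∈ W₀)
    (hpow : ∀ i, ∀ w ∈ W₀, (y i ^ p) w ∈ wordSpan y H W₀ 1) {a : Module.End k X}
    (ha : a ∈ Submodule.span k (Set.range y) ⊔ H) {x : X} (hx : x ∈ monomialSpan p y W₀) :
    a x ∈ monomialSpan p y W₀ := by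
  induction hx using Submodule.span_induction with
  | mem _ h =>
    obtain ⟨r, w, hw, rfl⟩ := h
    have h0 : w ∈ wordSpan y H W₀ 0 := Submodule.subset_span ⟨[], by simp, by simp, w, hw, by simp⟩
    have h1 := prod_apply_mem_wordSpan ((exponentWord fun j => (r j : ℕ)).map y) (by
      intro a ha
      obtain ⟨i, _, rfl⟩ := List.mem_map.1 ha
      exact Or.inl ⟨i, rfl⟩) h0
    have h2 := wordSpan_le_monomialSpan hcomm hH hpow _ (apply_mem_wordSpan ha h1)
    convert h2 using 3
    rw [exponentWord, List.map_flatten, List.prod_flatten, List.map_map, List.map_ofFn]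
    congr 2
    ext j : 1
    simp
  | zero => simp
  | add x y _ _ hx hy => rw [map_add]; exact add_mem hx hy
  | smul t x _ hx => rw [map_smul]; exact Submodule.smul_mem _ _ hx

end Straightening

/-! ### Straightening for the action of a Lie algebra -/

section LieStraightening

/-- The scalars are left free because this serves twice: over `K` for u(L̄, c) acting on itself, and
over `F` for the induced module. -/
theorem lie_apply_mem_monomialSpan {k g X : Type*} [CommRing k] [LieRing g] [LieAlgebra k g]
    [AddCommGroup X] [Module k X] {p : ℕ} [hp : Fact p.Prime] {n : ℕ} {W₀ : Submodule k X}
    (Λ : g →ₗ[k] Module.End k X) (hΛ : ∀ a b, Λ ⁅a, b⁆ = Λ a * Λ b - Λ b * Λ a)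
    (e : Fin n → g) (h : Submodule k g) (htop : Submodule.span k (Set.range e) ⊔ h = ⊤)
    (hH : ∀ a ∈ h, ∀ w ∈ W₀, Λ a w ∈ W₀)
    (hpow : ∀ i, ∀ w ∈ W₀, ∃ b : g, (Λ (e i) ^ p) w - Λ b w ∈ W₀) (a : g) {x : X}
    (hx : x ∈ monomialSpan p (fun i => Λ (e i)) W₀) :
    Λ a x ∈ monomialSpan p (fun i => Λ (e i)) W₀ := by
  have hmem : ∀ a, Λ a ∈ Submodule.span k (Set.range fun i => Λ (e i)) ⊔ h.map Λ := by
    intro a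
    have : Set.range (fun i => Λ (e i)) = Λ '' Set.range e := by
      rw [← Set.range_comp]; rfl
    rw [this, ← Submodule.map_span, ← Submodule.map_sup, htop]
    exact Submodule.mem_map_of_mem trivial
  have hran : ∀ a, a ∈ Set.range (fun i => Λ (e i)) ∨ a ∈ h.map Λ → ∃ b, Λ b = a := by
    rintro _ (⟨i, rfl⟩ | ⟨b, _, rfl⟩)
    exacts [⟨_, rfl⟩, ⟨_, rfl⟩]
  refine apply_mem_monomialSpan (H := h.map Λ) ?_ ?_ ?_ (hmem a) hx
  · intro a b ha hb
    obtain ⟨a, rfl⟩ := hran a ha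
    obtain ⟨b, rfl⟩ := hran b hb
    rw [← hΛ]
    exact hmem _
  · rintro _ ⟨b, hb, rfl⟩ w hw
    exact hH b hb w hw
  · intro i w hw
    obtain ⟨b, hb⟩ := hpow i w hw
    have h0 : ∀ w ∈ W₀, w ∈ wordSpan (fun i => Λ (e i)) (h.map Λ) W₀ 0 := fun w hw =>
      Submodule.subset_span ⟨[], by simp, by simp, w, hw, by simp⟩
    rw [← sub_add_cancel ((Λ (e i) ^ p) w) (Λ b w)]
    exact add_mem (wordSpan_mono zero_le_one (h0 _ hb)) (apply_mem_wordSpan (hmem b) (h0 w hw))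

end LieStraightening

/-! ### Cobases -/

section Cobasis

variable {F L : Type*} [Field F] [LieRing L] [LieAlgebra F L] {S : LieSubalgebra F L}

/-- The basis of `L` which consists of a cobasis of `S` and a basis of `S`. -/
noncomputable def IsCobasis.basis {n q : ℕ} {e : Fin n → L} (he : IsCobasis S e)
    (s : Module.Basis (Fin q) F S) : Module.Basis (Fin (n + q)) F L :=
  (((Module.Basis.span he.1).prod s).map
    (Submodule.prodEquivOfIsCompl _ _ he.2.symm)).reindex finSumFinEquiv

theorem IsCobasis.basis_apply {n q : ℕ} {e : Fin n → L} (he : IsCobasis S e)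
    (s : Module.Basis (Fin q) F S) :
    ⇑(he.basis s) = Fin.append e (fun j => (s j : L)) := by
  ext i
  refine Fin.addCases (fun i => ?_) (fun i => ?_) i
  · simp only [IsCobasis.basis, Module.Basis.reindex_apply, finSumFinEquiv_symm_apply_castAdd,
      Module.Basis.map_apply, Module.Basis.prod_apply, Fin.append_left]
    rw [Submodule.coe_prodEquivOfIsCompl']
    simp [Module.Basis.span_apply]
  · simp only [IsCobasis.basis, Module.Basis.reindex_apply, finSumFinEquiv_symm_apply_natAdd,
      Module.Basis.map_apply, Module.Basis.prod_apply, Fin.append_right]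
    rw [Submodule.coe_prodEquivOfIsCompl']
    simp

theorem exists_isCobasis [FiniteDimensional F L] (S : LieSubalgebra F L) :
    ∃ (n : ℕ) (e : Fin n → L), IsCobasis S e := by
  obtain ⟨T, hT⟩ := Submodule.exists_isCompl S.toSubmodule
  let b := Module.finBasis F T
  refine ⟨_, fun i => (b i : L), ?_, ?_⟩
  · exact b.linearIndependent.map' T.subtype T.ker_subtype
  · have : Submodule.span F (Set.range fun i => (b i : L)) = T := by
      have h := congrArg (Submodule.map T.subtype) b.span_eq
      rw [Submodule.map_span, ← Set.range_comp, Submodule.map_top, Submodule.range_subtype] at h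
      exact h
    rw [this]
    exact hT

end Cobasis

/-! ### Monomial bases, and freeness over the algebra of a p-subalgebra -/

namespace ReducedEnv

variable {p : ℕ} [hp : Fact p.Prime] {F L : Type*} [Field F] [CharP F p] [LieRing L]
  [LieAlgebra F L] {P : PMap p F L}
variable {K : Type*} [Field K] [Algebra F K] {c : L →ₗ[F] K}

attribute [local instance 100] LieRing.ofAssociativeRing

/-- The product `e_1 ^ r_1 ⋯ e_n ^ r_n` in the reduced enveloping algebra. -/
noncomputable def monomial (P : PMap p F L) (c : L →ₗ[F] K) {n : ℕ} (e : Fin n → L)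
    (r : Fin n → ℕ) : ReducedEnv P c :=
  (List.ofFn fun j => ι P c ((1 : K) ⊗ₜ[F] e j) ^ r j).prod

/-- The operators of left multiplication by the elements of `K ⊗ L`. -/
noncomputable def leftMul (P : PMap p F L) (c : L →ₗ[F] K) :
    (K ⊗[F] L) →ₗ[K] Module.End K (ReducedEnv P c) :=
  LinearMap.mul K (ReducedEnv P c) ∘ₗ ι P c

theorem leftMul_apply (x : K ⊗[F] L) (a : ReducedEnv P c) : leftMul P c x a = ι P c x * a := rfl

theorem leftMul_pow_apply (x : K ⊗[F] L) (m : ℕ) (a : ReducedEnv P c) :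
    (leftMul P c x ^ m) a = ι P c x ^ m * a := by
  induction m with
  | zero => simp
  | succ m ih => rw [pow_succ', Module.End.mul_apply, ih, leftMul_apply, ← mul_assoc, ← pow_succ']

theorem leftMul_lie (x y : K ⊗[F] L) : leftMul P c ⁅x, y⁆
    = leftMul P c x * leftMul P c y - leftMul P c y * leftMul P c x := by
  ext a
  simp only [leftMul_apply, ι_lie, LinearMap.sub_apply, Module.End.mul_apply]
  noncomm_ring

theorem prod_leftMul_apply {n : ℕ} (e : Fin n → L) (r : Fin n → ℕ) (a : ReducedEnv P c) :
    (List.ofFn fun j => leftMul P c ((1 : K) ⊗ₜ[F] e j) ^ r j).prod a = monomial P c e r * a := by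
  have : ∀ l : List (Fin n), (l.map fun j => leftMul P c ((1 : K) ⊗ₜ[F] e j) ^ r j).prod a
      = (l.map fun j => ι P c ((1 : K) ⊗ₜ[F] e j) ^ r j).prod * a := by
    intro l
    induction l with
    | nil => simp
    | cons j l ih =>
      rw [List.map_cons, List.map_cons, List.prod_cons, List.prod_cons, Module.End.mul_apply, ih,
        leftMul_pow_apply, mul_assoc]
  rw [monomial, List.ofFn_eq_map, List.ofFn_eq_map]
  exact this _

/-- If `e` spans `L` modulo `h`, a subspace `W₀` stable under `h` which contains `1` generates the
reduced enveloping algebra by multiplication by ordered monomials in `e`. -/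
theorem monomialSpan_eq_top {n : ℕ} (e : Fin n → L) (h : Submodule K (K ⊗[F] L))
    (htop : Submodule.span K (Set.range fun i => (1 : K) ⊗ₜ[F] e i) ⊔ h = ⊤)
    (W₀ : Submodule K (ReducedEnv P c)) (hH : ∀ a ∈ h, ∀ w ∈ W₀, ι P c a * w ∈ W₀)
    (h1 : (1 : ReducedEnv P c) ∈ W₀) :
    monomialSpan p (fun i => leftMul P c ((1 : K) ⊗ₜ[F] e i)) W₀ = ⊤ := by
  refine eq_top_of_mul_mem _ ?_ fun x a ha => ?_
  · exact Submodule.subset_span ⟨fun _ => ⟨0, hp.out.pos⟩, 1, h1, by simp⟩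
  · refine lie_apply_mem_monomialSpan (leftMul P c) leftMul_lie (fun i => (1 : K) ⊗ₜ[F] e i) h htop
      hH ?_ _ ha
    intro i w hw
    refine ⟨(1 : K) ⊗ₜ[F] P.toFun (e i), ?_⟩
    rw [leftMul_pow_apply, ι_pow, add_mul, leftMul_apply, add_sub_cancel_left, ← Algebra.smul_def]
    exact W₀.smul_mem _ hw

theorem span_one_tmul {κ : Type*} (x : Module.Basis κ F L) :
    Submodule.span K (Set.range fun i => (1 : K) ⊗ₜ[F] x i) = ⊤ := by
  rw [← (x.baseChange K).span_eq]
  congr 2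
  ext i
  simp

/-- The basis of the reduced enveloping algebra which consists of the ordered monomials. -/
noncomputable def monomialBasis (P : PMap p F L) (c : L →ₗ[F] K) {d : ℕ}
    (x : Module.Basis (Fin d) F L) : Module.Basis (Fin d → Fin p) K (ReducedEnv P c) :=
  Module.Basis.mk (linearIndependent_monomials (P := P) c x) (by
    -- Spanning is the case of the zero subalgebra, with `W₀` the line through 1.
    rw [← monomialSpan_eq_top (P := P) (c := c) x ⊥ (by rw [span_one_tmul, top_sup_eq])
      (Submodule.span K {1}) (by
        intro a ha w hw
        rw [(Submodule.mem_bot K).1 ha, map_zero, zero_mul]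
        exact zero_mem _) (Submodule.mem_span_singleton_self 1)]
    refine Submodule.span_le.2 ?_
    rintro _ ⟨r, w, hw, rfl⟩
    obtain ⟨t, rfl⟩ := Submodule.mem_span_singleton.1 hw
    rw [prod_leftMul_apply, mul_smul_comm, mul_one]
    exact Submodule.smul_mem _ _ (Submodule.subset_span ⟨r, rfl⟩))

theorem monomialBasis_apply {d : ℕ} (x : Module.Basis (Fin d) F L) (r : Fin d → Fin p) :
    monomialBasis P c x r = monomial P c x fun j => (r j : ℕ) := by
  rw [monomialBasis, Module.Basis.mk_apply]
  rfl

theorem incl_ι (S : LieSubalgebra F L) (hS : ∀ s ∈ S, P.toFun s ∈ S) (c : L →ₗ[F] K)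
    (x : K ⊗[F] S) : incl S hS c (ι (P.restrict S hS) (resChar S c) x)
      = ι P c (S.toSubmodule.subtype.baseChange K x) := by
  exact lift_ι _ _ x

theorem incl_monomial (S : LieSubalgebra F L) (hS : ∀ s ∈ S, P.toFun s ∈ S) (c : L →ₗ[F] K)
    {q : ℕ} (s : Fin q → S) (r : Fin q → ℕ) :
    incl S hS c (monomial (P.restrict S hS) (resChar S c) s r)
      = monomial P c (fun j => (s j : L)) r := by
  rw [monomial, monomial, map_list_prod, List.map_ofFn]
  congr 2
  ext j : 1
  simp only [Function.comp_apply, map_pow]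
  rw [incl_ι]
  rfl

theorem monomial_append {n q : ℕ} (e : Fin n → L) (s : Fin q → L) (r : Fin n → ℕ)
    (r' : Fin q → ℕ) : monomial P c (Fin.append e s) (Fin.append r r')
      = monomial P c e r * monomial P c s r' := by
  rw [monomial, monomial, monomial, ← List.prod_append, ← List.ofFn_fin_append]
  congr 2
  ext i : 1
  refine Fin.addCases (fun i => ?_) (fun i => ?_) i <;> simp

/-- The map `(a_r) ↦ ∑ r, e(r) a_r`. -/
noncomputable def freeMap (S : LieSubalgebra F L) (hS : ∀ s ∈ S, P.toFun s ∈ S) (c : L →ₗ[F] K)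
    {n : ℕ} (e : Fin n → L) :
    ((Fin n → Fin p) → ReducedEnv (P.restrict S hS) (resChar S c)) →ₗ[K] ReducedEnv P c :=
  ∑ r : Fin n → Fin p, LinearMap.mulLeft K (monomial P c e fun j => (r j : ℕ)) ∘ₗ
    (incl S hS c).toLinearMap ∘ₗ LinearMap.proj r

theorem freeMap_apply (S : LieSubalgebra F L) (hS : ∀ s ∈ S, P.toFun s ∈ S) (c : L →ₗ[F] K)
    {n : ℕ} (e : Fin n → L)
    (a : (Fin n → Fin p) → ReducedEnv (P.restrict S hS) (resChar S c)) :
    freeMap S hS c e a = ∑ r, monomial P c e (fun j => (r j : ℕ)) * incl S hS c (a r) := by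
  simp [freeMap]

theorem freeMap_single (S : LieSubalgebra F L) (hS : ∀ s ∈ S, P.toFun s ∈ S) (c : L →ₗ[F] K)
    {n : ℕ} (e : Fin n → L) (r : Fin n → Fin p)
    (a : ReducedEnv (P.restrict S hS) (resChar S c)) :
    freeMap S hS c e (Pi.single r a) = monomial P c e (fun j => (r j : ℕ)) * incl S hS c a := by
  rw [freeMap_apply, Finset.sum_eq_single r]
  · simp
  · intro r' _ h
    simp [h]
  · simp

/-- The reduced enveloping algebra is a free right module over that of a `p`-subalgebra. -/
theorem freeMap_bijective [FiniteDimensional F L] (S : LieSubalgebra F L)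
    (hS : ∀ s ∈ S, P.toFun s ∈ S) (c : L →ₗ[F] K) {n : ℕ} {e : Fin n → L} (he : IsCobasis S e) :
    Function.Bijective (freeMap S hS c e) := by
  constructor
  · let s := Module.finBasis F S
    let b := Pi.basis fun _ : Fin n → Fin p =>
      monomialBasis (P.restrict S hS) (resChar S c) s
    -- Products of monomials in the cobasis with monomials in a basis of `S` are ordered monomials
    -- in the combined basis of `L`.
    have hli : LinearIndependent K (freeMap S hS c e ∘ b) := by
      have h := (linearIndependent_monomials (P := P) c (he.basis s)).comp
        (fun i : (Σ _ : Fin n → Fin p, Fin (Module.finrank F S) → Fin p) => Fin.append i.1 i.2) (by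
          rintro ⟨r, r'⟩ ⟨t, t'⟩ h
          have h1 : r = t := funext fun i => by simpa using congrFun h (Fin.castAdd _ i)
          have h2 : r' = t' := funext fun i => by simpa using congrFun h (Fin.natAdd _ i)
          rw [h1, h2])
      convert h using 1
      ext ⟨r, r'⟩ : 1
      simp only [Function.comp_apply, b, Pi.basis_apply]
      rw [freeMap_single, monomialBasis_apply, incl_monomial, ← monomial_append, monomial,
        he.basis_apply]
      congr 2
      ext j : 1
      congr 1
      refine Fin.addCases (fun i => ?_) (fun i => ?_) j <;> simp
    rw [← LinearMap.ker_eq_bot, LinearMap.ker_eq_bot']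
    intro a ha
    have h1 : Finsupp.linearCombination K (freeMap S hS c e ∘ b) (b.repr a) = 0 := by
      rw [← ha, ← Finsupp.apply_linearCombination, b.linearCombination_repr]
    have h2 := (linearIndependent_iff.1 hli) _ h1
    simpa using h2
  -- Surjectivity is straightening with the image of u(S̄, c) as `W₀`, which is stable under left
  -- multiplication by `S`.
  · rw [← LinearMap.range_eq_top, eq_top_iff,
      ← monomialSpan_eq_top (P := P) (c := c) e
        (LinearMap.range (S.toSubmodule.subtype.baseChange K)) ?_
        (LinearMap.range (incl S hS c).toLinearMap) ?_ ⟨1, by simp⟩]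
    · refine Submodule.span_le.2 ?_
      rintro _ ⟨r, _, ⟨a, rfl⟩, rfl⟩
      refine ⟨Pi.single r a, ?_⟩
      rw [freeMap_single, prod_leftMul_apply]
      rfl
    · rw [eq_top_iff]
      intro w _
      induction w with
      | zero => exact zero_mem _
      | add a b ha hb => exact add_mem (ha trivial) (hb trivial)
      | tmul t x =>
        have : t ⊗ₜ[F] x = t • ((1 : K) ⊗ₜ[F] x) := by
          rw [TensorProduct.smul_tmul', smul_eq_mul, mul_one]
        rw [this]
        refine Submodule.smul_mem _ _ ?_
        obtain ⟨s, hs, v, hv, rfl⟩ := Submodule.mem_sup.1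
          (he.2.sup_eq_top ▸ Submodule.mem_top : x ∈ S.toSubmodule ⊔ _)
        rw [TensorProduct.tmul_add]
        refine add_mem (Submodule.mem_sup_right ⟨(1 : K) ⊗ₜ[F] (⟨s, hs⟩ : S), rfl⟩)
          (Submodule.mem_sup_left ?_)
        clear this ‹_ ∈ (⊤ : Submodule K (K ⊗[F] L))›
        induction hv using Submodule.span_induction with
        | mem _ h => obtain ⟨i, rfl⟩ := h; exact Submodule.subset_span ⟨i, rfl⟩
        | zero => simp
        | add a b _ _ ha hb => rw [TensorProduct.tmul_add]; exact add_mem ha hb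
        | smul t a _ ha =>
          rw [TensorProduct.tmul_smul, ← algebraMap_smul K t ((1 : K) ⊗ₜ[F] a)]
          exact Submodule.smul_mem _ _ ha
    · rintro _ ⟨a, rfl⟩ _ ⟨w, rfl⟩
      refine ⟨ι (P.restrict S hS) (resChar S c) a * w, ?_⟩
      simp only [AlgHom.toLinearMap_apply, map_mul, incl_ι]

end ReducedEnv

/-! ### The c-induced module as a sum of copies of M -/

section CIndFree

variable {p : ℕ} [hp : Fact p.Prime] {F L : Type*} [Field F] [CharP F p] [LieRing L]
  [LieAlgebra F L] [FiniteDimensional F L] (P : PMap p F L)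
variable {K : Type*} [Field K] [Algebra F K] (S : LieSubalgebra F L)
  (hS : ∀ s ∈ S, P.toFun s ∈ S) (c : L →ₗ[F] K)
  {M : Type*} [AddCommGroup M] [Module K M] [LieRingModule (K ⊗[F] S) M]
  [LieModule K (K ⊗[F] S) M] (h : HasCharacter (P.restrict S hS) (resChar S c) M)

open ReducedEnv

/-- Freeness of u(L̄, c) as a right module gives each b coordinates b_r in u(S̄, c), and b ⊗ m ↦
(b_r m)_r respects the balancing relations; it sends e(r) ⊗ m to m in position r. -/
theorem CInd.sum_tmul_eq_zero {n : ℕ} {e : Fin n → L} (he : IsCobasis S e)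
    (f : (Fin n → Fin p) → M)
    (hf : ∑ r, CInd.tmul P S hS c h (monomial P c e fun j => (r j : ℕ)) (f r) = 0) : f = 0 := by
  let ψ := LinearEquiv.ofBijective (freeMap S hS c e) (freeMap_bijective S hS c he)
  have hψ : ∀ b a, ψ.symm (b * incl S hS c a) = fun r => ψ.symm b r * a := by
    intro b a
    rw [LinearEquiv.symm_apply_eq]
    obtain ⟨x, rfl⟩ := ψ.surjective b
    rw [ψ.symm_apply_apply]
    change freeMap S hS c e x * _ = freeMap S hS c e _
    rw [freeMap_apply, freeMap_apply, Finset.sum_mul]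
    simp [mul_assoc]
  let Ξ₀ : ReducedEnv P c ⊗[K] M →ₗ[K] ((Fin n → Fin p) → M) :=
    TensorProduct.lift (LinearMap.mk₂ K (fun b m => fun r => act h (ψ.symm b r) m)
      (by intros; ext r; simp) (by intros; ext r; simp) (by intros; ext r; simp)
      (by intros; ext r; simp))
  have hΞ₀ : ∀ b m, Ξ₀ (b ⊗ₜ m) = fun r => act h (ψ.symm b r) m := fun b m => rfl
  -- The relations are spanned over u(L̄, c), but the coordinate map is not linear over it. Hence
  -- the claim is proved for all left multiples at once.
  have hker : ∀ t ∈ Submodule.span (ReducedEnv P c) {t : ReducedEnv P c ⊗[K] M |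
      ∃ (b : ReducedEnv P c) (a : ReducedEnv (P.restrict S hS) (resChar S c)) (m : M),
        t = (b * incl S hS c a) ⊗ₜ[K] m - b ⊗ₜ[K] (act h a m)}, ∀ b' : ReducedEnv P c,
      Ξ₀ (b' • t) = 0 := by
    intro t ht
    induction ht using Submodule.span_induction with
    | mem _ h =>
      obtain ⟨b, a, m, rfl⟩ := h
      intro b'
      rw [smul_sub, TensorProduct.smul_tmul', TensorProduct.smul_tmul', smul_eq_mul, smul_eq_mul,
        map_sub, hΞ₀, hΞ₀, ← mul_assoc, hψ]
      ext r
      simp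
    | zero => simp
    | add x y _ _ hx hy => intro b'; rw [smul_add, map_add, hx, hy, add_zero]
    | smul b x _ hx => intro b'; rw [smul_smul]; exact hx _
  let R := Submodule.span (ReducedEnv P c) {t : ReducedEnv P c ⊗[K] M |
      ∃ (b : ReducedEnv P c) (a : ReducedEnv (P.restrict S hS) (resChar S c)) (m : M),
        t = (b * incl S hS c a) ⊗ₜ[K] m - b ⊗ₜ[K] (act h a m)}
  have hmem : ∑ r, (monomial P c e fun j => (r j : ℕ)) ⊗ₜ[K] f r ∈ R := by
    rw [← Submodule.Quotient.mk_eq_zero, ← Submodule.mkQ_apply, map_sum]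
    exact hf
  have h0 := hker _ hmem 1
  rw [one_smul, map_sum] at h0
  have h1 : ∀ r : Fin n → Fin p, ψ.symm (monomial P c e fun j => (r j : ℕ)) = Pi.single r 1 := by
    intro r
    rw [LinearEquiv.symm_apply_eq]
    change _ = freeMap S hS c e _
    rw [freeMap_single, map_one, mul_one]
  ext r
  have h2 := congrFun h0 r
  rw [Finset.sum_apply, Finset.sum_eq_single r] at h2
  · rw [hΞ₀, h1] at h2
    simpa using h2
  · intro r' _ hr
    rw [hΞ₀, h1]
    simp [hr.symm]
  · simp

end CIndFree

/-! ### Characters of subquotients and the component decomposition -/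

section Characters

variable {p : ℕ} [hp : Fact p.Prime] {F L : Type*} [Field F] [CharP F p] [LieRing L]
  [LieAlgebra F L] (P : PMap p F L) {K : Type*} [Field K] [Algebra F K]
variable {M : Type*} [AddCommGroup M] [Module K M] [LieRingModule (K ⊗[F] L) M]
  [LieModule K (K ⊗[F] L) M]
variable {N : Type*} [AddCommGroup N] [Module K N] [LieRingModule (K ⊗[F] L) N]
  [LieModule K (K ⊗[F] L) N]

theorem phi_apply (x : L) (m : M) : phi P K M x m
    = (LieModule.toEnd K (K ⊗[F] L) M ((1 : K) ⊗ₜ[F] x) ^ p) m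
      - ⁅(1 : K) ⊗ₜ[F] P.toFun x, m⁆ := rfl

theorem phi_map (f : M →ₗ⁅K, K ⊗[F] L⁆ N) (x : L) (m : M) :
    phi P K N x (f m) = f (phi P K M x m) := by
  have h : ∀ n : ℕ, (LieModule.toEnd K (K ⊗[F] L) N ((1 : K) ⊗ₜ[F] x) ^ n) (f m)
      = f ((LieModule.toEnd K (K ⊗[F] L) M ((1 : K) ⊗ₜ[F] x) ^ n) m) := by
    intro n
    induction n with
    | zero => simp
    | succ n ih => rw [pow_succ', pow_succ', Module.End.mul_apply, Module.End.mul_apply, ih]; simp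
  rw [phi_apply, phi_apply, h, map_sub, LieModuleHom.map_lie]

theorem commute_phi (x y : L) : Commute (phi P K M x) (phi P K M y) := by
  have h : ∀ z : K ⊗[F] L, Commute (phi P K M x) (LieModule.toEnd K (K ⊗[F] L) M z) := by
    intro z
    ext m
    exact phi_lie P K x z m
  exact ((h _).pow_right p).sub_right (h _)

/-- The vectors on which all `φ_x` act by `c(x)^p`. -/
noncomputable def charSpace (c : L →ₗ[F] K) (M : Type*) [AddCommGroup M] [Module K M]
    [LieRingModule (K ⊗[F] L) M] [LieModule K (K ⊗[F] L) M] : Submodule K M :=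
  ⨅ x : L, LinearMap.ker (phi P K M x - algebraMap K _ (c x ^ p))

variable {P} in
theorem mem_charSpace {c : L →ₗ[F] K} {m : M} :
    m ∈ charSpace P c M ↔ ∀ x, phi P K M x m = c x ^ p • m := by
  simp only [charSpace, Submodule.mem_iInf, LinearMap.mem_ker, LinearMap.sub_apply,
    Module.algebraMap_end_apply, sub_eq_zero]

/-- If a module is spanned by vectors with characters in `D`, then the characters of its subquotients
are in `D`. -/
theorem mem_of_subquotient (D : Set (L →ₗ[F] K)) (hD : ∀ m : M, m ∈ ⨆ c ∈ D, charSpace P c M)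
    (A B : LieSubmodule K (K ⊗[F] L) M)
    [hQ : Nontrivial (B ⧸ A.comap B.incl)] (c : L →ₗ[F] K)
    (hc : HasCharacter P c (B ⧸ A.comap B.incl)) : c ∈ D := by
  have : CharP K p := charP_of_injective_algebraMap (algebraMap F K).injective p
  by_contra hcD
  let op : L × K → Module.End K M := fun q => phi P K M q.1 - algebraMap K _ q.2
  have hop : ∀ q q', Commute (op q) (op q') := fun q q' =>
    ((commute_phi P q.1 q'.1).sub_right (Algebra.commute_algebraMap_right _ _)).sub_left
      (Algebra.commute_algebraMap_left _ _)
  have hprod : ∀ l l' : List (L × K), Commute (l.map op).prod (l'.map op).prod := by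
    intro l l'
    refine Commute.list_prod_left _ _ fun a ha => Commute.list_prod_right _ _ fun b hb => ?_
    obtain ⟨q, _, rfl⟩ := List.mem_map.1 ha
    obtain ⟨q', _, rfl⟩ := List.mem_map.1 hb
    exact hop q q'
  -- If c ∉ `D`, every vector is killed by a product of operators φ_x - d(x)^p with c(x) ≠ d(x). On
  -- a subquotient with character c that product is a nonzero scalar.
  have hkill : ∀ m : M, ∃ l : List (L × K), (∀ q ∈ l, c q.1 ^ p ≠ q.2) ∧ (l.map op).prod m = 0 := by
    intro m
    have hm := hD m
    rw [iSup_subtype'] at hm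
    induction hm using Submodule.iSup_induction' with
    | mem d m hm =>
      obtain ⟨d, hd⟩ := d
      obtain ⟨x, hx⟩ : ∃ x, c x ≠ d x := by
        by_contra! h
        exact hcD (LinearMap.ext h ▸ hd)
      refine ⟨[(x, d x ^ p)], ?_, ?_⟩
      · simp only [List.mem_singleton, forall_eq]
        exact fun h => hx (frobenius_inj K p h)
      · simp only [op, List.map_cons, List.map_nil, List.prod_singleton, LinearMap.sub_apply,
          Module.algebraMap_end_apply, mem_charSpace.1 hm x, sub_self]
    | zero => exact ⟨[], by simp, by simp⟩
    | add a b _ _ ha hb =>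
      obtain ⟨l, hl, hl'⟩ := ha
      obtain ⟨s, hs, hs'⟩ := hb
      refine ⟨l ++ s, ?_, ?_⟩
      · intro q hq
        rcases List.mem_append.1 hq with h | h
        exacts [hl q h, hs q h]
      · rw [List.map_append, List.prod_append, map_add, (hprod l s).eq, Module.End.mul_apply, hl',
          ← (hprod l s).eq, Module.End.mul_apply, hs']
        simp
  obtain ⟨qb, hqb⟩ := exists_ne (0 : B ⧸ A.comap B.incl)
  obtain ⟨b, rfl⟩ := LieSubmodule.Quotient.surjective_mk' _ qb
  obtain ⟨l, hl, hl'⟩ := hkill b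
  have key : ∀ (l : List (L × K)), ∃ b' : B, (b' : M) = (l.map op).prod b ∧
      LieSubmodule.Quotient.mk' (A.comap B.incl) b'
        = (l.map fun q => c q.1 ^ p - q.2).prod • LieSubmodule.Quotient.mk' (A.comap B.incl) b := by
    intro l
    induction l with
    | nil => exact ⟨b, by simp, by simp⟩
    | cons q l ih =>
      obtain ⟨b', h1, h2⟩ := ih
      refine ⟨phi P K B q.1 b' - q.2 • b', ?_, ?_⟩
      · rw [List.map_cons, List.prod_cons, Module.End.mul_apply, ← h1]
        have := phi_map P B.incl q.1 b'
        simp only [LieSubmodule.incl_apply] at this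
        simp [op, this]
      · rw [map_sub, ← phi_map, hc, map_smul, h2, List.map_cons, List.prod_cons,
          smul_smul, smul_smul, sub_mul, sub_smul]
  obtain ⟨b', h1, h2⟩ := key l
  rw [hl', ZeroMemClass.coe_eq_zero] at h1
  rw [h1, map_zero, eq_comm, smul_eq_zero] at h2
  refine h2.elim (fun h => ?_) hqb
  rw [List.prod_eq_zero_iff, List.mem_map] at h
  obtain ⟨q, hq, h⟩ := h
  exact hl q hq (sub_eq_zero.1 h)

theorem exists_mem_ne_zero_of_ne_bot (T : LieSubmodule K (K ⊗[F] L) M) (hT : T ≠ ⊥) :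
    ∃ m ∈ T, m ≠ 0 := by
  by_contra! h
  exact hT ((LieSubmodule.eq_bot_iff T).2 h)

/-- Presents a minimal submodule as the subquotient `B / ⊥`, the shape in which `cluster` meets
composition factors. -/
theorem isIrreducible_quotient_of_isAtom {B : LieSubmodule K (K ⊗[F] L) M} (hB : IsAtom B) :
    LieModule.IsIrreducible K (K ⊗[F] L)
      (B ⧸ (⊥ : LieSubmodule K (K ⊗[F] L) M).comap B.incl) := by
  have hnt : Nontrivial (B ⧸ (⊥ : LieSubmodule K (K ⊗[F] L) M).comap B.incl) := by
    obtain ⟨b, hb, hb0⟩ := exists_mem_ne_zero_of_ne_bot B hB.1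
    refine ⟨⟨LieSubmodule.Quotient.mk' _ ⟨b, hb⟩, 0, ?_⟩⟩
    rw [Ne, LieSubmodule.Quotient.mk_eq_zero]
    simpa using hb0
  refine LieModule.IsIrreducible.mk fun T hT => ?_
  obtain ⟨t, ht, ht0⟩ := exists_mem_ne_zero_of_ne_bot T hT
  obtain ⟨b, rfl⟩ := LieSubmodule.Quotient.surjective_mk' _ t
  let T' : LieSubmodule K (K ⊗[F] L) M := (T.comap (LieSubmodule.Quotient.mk' _)).map B.incl
  have hT'B : T' ≤ B := by
    rintro _ hx
    obtain ⟨y, _, rfl⟩ := (LieSubmodule.mem_map _).1 hx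
    exact y.2
  have hbT : (b : M) ∈ T' := (LieSubmodule.mem_map _).2 ⟨b, ht, rfl⟩
  have hT' : T' = B := by
    refine (hB.le_iff.1 hT'B).resolve_left fun h => ht0 ?_
    rw [h, LieSubmodule.mem_bot, ZeroMemClass.coe_eq_zero] at hbT
    rw [hbT, map_zero]
  rw [eq_top_iff]
  intro q _
  obtain ⟨b', rfl⟩ := LieSubmodule.Quotient.surjective_mk' _ q
  have : (b' : M) ∈ T' := by rw [hT']; exact b'.2
  obtain ⟨y, hy, hyb⟩ := (LieSubmodule.mem_map _).1 this
  have h : y = b' := Subtype.ext hyb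
  exact h ▸ hy

/-- A nonzero submodule has an irreducible submodule, and this has a character. -/
theorem exists_irreducible_hasCharacter [IsAlgClosed K] [FiniteDimensional K M]
    (T : LieSubmodule K (K ⊗[F] L) M) (hT : T ≠ ⊥) :
    ∃ (c : L →ₗ[F] K) (B : LieSubmodule K (K ⊗[F] L) M), B ≠ ⊥ ∧ B ≤ T ∧
      (∀ b ∈ B, b ∈ charSpace P c M) ∧
      LieModule.IsIrreducible K (K ⊗[F] L)
        (B ⧸ (⊥ : LieSubmodule K (K ⊗[F] L) M).comap B.incl) ∧
      HasCharacter P c (B ⧸ (⊥ : LieSubmodule K (K ⊗[F] L) M).comap B.incl) := by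
  have : CharP K p := charP_of_injective_algebraMap (algebraMap F K).injective p
  obtain ⟨B, hB, hBT⟩ := (IsAtomic.eq_bot_or_exists_atom_le T).resolve_left hT
  obtain ⟨b₀, hb₀, hb₀0⟩ := exists_mem_ne_zero_of_ne_bot B hB.1
  have : Nontrivial B := ⟨⟨⟨b₀, hb₀⟩, 0, fun h => hb₀0 (congrArg Subtype.val h)⟩⟩
  -- Schur's argument: φ_x commutes with the action, so its eigenspace in the minimal submodule is a
  -- nonzero submodule, hence everything.
  have hscal : ∀ x : L, ∃ t : K, ∀ b ∈ B, phi P K M x b = t • b := by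
    intro x
    obtain ⟨t, ht⟩ := Module.End.exists_eigenvalue (phi P K B x)
    obtain ⟨v, hv⟩ := ht.exists_hasEigenvector
    let E : LieSubmodule K (K ⊗[F] L) M :=
      { LinearMap.ker (phi P K M x - algebraMap K _ t) ⊓ B.toSubmodule with
        lie_mem := by
          rintro y m ⟨hm, hmB⟩
          refine ⟨?_, B.lie_mem hmB⟩
          change m ∈ LinearMap.ker _ at hm
          change ⁅y, m⁆ ∈ LinearMap.ker _
          rw [LinearMap.mem_ker, LinearMap.sub_apply, Module.algebraMap_end_apply, sub_eq_zero]
            at hm ⊢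
          rw [phi_lie, hm, lie_smul] }
    have hEB : E ≤ B := fun m hm => hm.2
    have hvE : (v : M) ∈ E := by
      refine ⟨?_, v.2⟩
      change (v : M) ∈ LinearMap.ker _
      rw [LinearMap.mem_ker, LinearMap.sub_apply, Module.algebraMap_end_apply, sub_eq_zero]
      have := phi_map P B.incl x v
      rw [hv.apply_eq_smul] at this
      exact this
    have hE : E = B := by
      refine (hB.le_iff.1 hEB).resolve_left fun h => hv.2 ?_
      rw [h, LieSubmodule.mem_bot, ZeroMemClass.coe_eq_zero] at hvE
      exact hvE
    refine ⟨t, fun b hb => ?_⟩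
    have hb' : b ∈ LinearMap.ker (phi P K M x - algebraMap K _ t) := (hE ▸ hb : b ∈ E).1
    rwa [LinearMap.mem_ker, LinearMap.sub_apply, Module.algebraMap_end_apply, sub_eq_zero] at hb'
  choose χ hχ using hscal
  have hχ0 : ∀ {x : L} {t : K}, phi P K M x b₀ = t • b₀ → χ x = t := by
    intro x t h
    rw [hχ x b₀ hb₀, ← sub_eq_zero, ← sub_smul, smul_eq_zero] at h
    exact sub_eq_zero.1 (h.resolve_right hb₀0)
  have hadd : ∀ x y, χ (x + y) = χ x + χ y := by
    intro x y
    refine hχ0 ?_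
    rw [(phi_eq P M x y 0).1, LinearMap.add_apply, hχ x b₀ hb₀, hχ y b₀ hb₀, add_smul]
  have hsmul : ∀ (t : F) x, χ (t • x) = algebraMap F K t ^ p * χ x := by
    intro t x
    refine hχ0 ?_
    rw [(phi_eq P M x x t).2, LinearMap.smul_apply, hχ x b₀ hb₀, smul_smul]
  -- The eigenvalues depend p-semilinearly on x, so their p-th roots, which exist in the perfect
  -- field `K`, depend linearly on x.
  let c : L →ₗ[F] K :=
    { toFun := fun x => (frobeniusEquiv K p).symm (χ x)
      map_add' := fun x y => by rw [hadd, map_add]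
      map_smul' := fun t x => by
        rw [RingEquiv.symm_apply_eq, hsmul, RingHom.id_apply, Algebra.smul_def, map_mul,
          RingEquiv.apply_symm_apply]
        rfl }
  have hc : ∀ x, c x ^ p = χ x := fun x => frobeniusEquiv_symm_pow_p K p (χ x)
  have hcB : ∀ b ∈ B, ∀ x, phi P K M x b = c x ^ p • b := fun b hb x => by rw [hc, hχ x b hb]
  refine ⟨c, B, hB.1, hBT, fun b hb => mem_charSpace.2 (hcB b hb),
    isIrreducible_quotient_of_isAtom hB, fun x q => ?_⟩
  obtain ⟨b, rfl⟩ := LieSubmodule.Quotient.surjective_mk' _ q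
  have h1 : phi P K B x b = c x ^ p • b := by
    refine Subtype.ext ?_
    have := phi_map P B.incl x b
    exact this.symm.trans (hcB b b.2 x)
  rw [phi_map, h1, map_smul]

/-- A component asks for one exponent r valid for all x; in finite dimension r = dim M always
suffices. -/
theorem component_toSubmodule [FiniteDimensional K M] (c : L →ₗ[F] K) :
    (component P c M).toSubmodule
      = ⨅ x : L, (phi P K M x).maxGenEigenspace (c x ^ p) := by
  ext m
  rw [LieSubmodule.mem_toSubmodule, Module.End.mem_iInf_maxGenEigenspace_iff]
  simp only [← Algebra.algebraMap_eq_smul_one]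
  constructor
  · rintro ⟨r, hr⟩ x
    exact ⟨r, hr x⟩
  · intro h
    refine ⟨Module.finrank K M, fun x => ?_⟩
    have h2 : m ∈ (phi P K M x).maxGenEigenspace (c x ^ p) := by
      rw [Module.End.mem_maxGenEigenspace]
      simpa only [← Algebra.algebraMap_eq_smul_one] using h x
    rw [Module.End.maxGenEigenspace_eq_genEigenspace_finrank, Module.End.mem_genEigenspace_nat] at h2
    simpa only [← Algebra.algebraMap_eq_smul_one, LinearMap.mem_ker] using h2

/-- A finite-dimensional module is the direct sum of its components, for the characters of its
irreducible submodules. -/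
theorem iSup_component_eq_top [IsAlgClosed K] [FiniteDimensional K M] (D : Set (L →ₗ[F] K))
    (hD : ∀ (c : L →ₗ[F] K) (B : LieSubmodule K (K ⊗[F] L) M),
      LieModule.IsIrreducible K (K ⊗[F] L)
        (B ⧸ (⊥ : LieSubmodule K (K ⊗[F] L) M).comap B.incl) →
      HasCharacter P c (B ⧸ (⊥ : LieSubmodule K (K ⊗[F] L) M).comap B.incl) → c ∈ D) :
    ⨆ c : D, (component P c.1 M).toSubmodule = ⊤ := by
  -- The commuting operators φ_x decompose `M` into joint generalised eigenspaces, indexed by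
  -- arbitrary functions χ : L → K. A nonzero one is a submodule and contains an irreducible
  -- submodule with some character c, which forces χ(x) = c(x)^p.
  rw [eq_top_iff, ← Module.End.iSup_iInf_maxGenEigenspace_eq_top_of_forall_mapsTo
    (fun x : L => phi P K M x)
    (fun i j φ => Module.End.mapsTo_maxGenEigenspace_of_comm (commute_phi P j i) φ)
    (fun i => Module.End.iSup_maxGenEigenspace_eq_top _)]
  refine iSup_le fun χ => ?_
  let T : LieSubmodule K (K ⊗[F] L) M :=
    { ⨅ x : L, (phi P K M x).maxGenEigenspace (χ x) with
      lie_mem := by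
        intro z m hm
        change m ∈ ⨅ x : L, (phi P K M x).maxGenEigenspace (χ x) at hm
        change ⁅z, m⁆ ∈ ⨅ x : L, (phi P K M x).maxGenEigenspace (χ x)
        rw [Submodule.mem_iInf] at hm ⊢
        intro x
        refine Module.End.mapsTo_maxGenEigenspace_of_comm (f := phi P K M x)
          (g := LieModule.toEnd K (K ⊗[F] L) M z) ?_ (χ x) (hm x)
        ext m
        exact phi_lie P K x z m }
  rcases eq_or_ne T ⊥ with hT | hT
  · have : ⨅ x : L, (phi P K M x).maxGenEigenspace (χ x) = T.toSubmodule := rfl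
    rw [this, hT]
    simp
  obtain ⟨c, B, hB0, hBT, hBc, hirr, hchar⟩ := exists_irreducible_hasCharacter P T hT
  obtain ⟨b, hb, hb0⟩ := exists_mem_ne_zero_of_ne_bot B hB0
  have hχ : χ = fun x => c x ^ p := by
    by_contra hne
    have h1 : b ∈ ⨅ x : L, (phi P K M x).maxGenEigenspace (χ x) := hBT hb
    have h2 : b ∈ ⨅ x : L, (phi P K M x).maxGenEigenspace (c x ^ p) := by
      rw [Submodule.mem_iInf]
      intro x
      rw [Module.End.mem_maxGenEigenspace]
      refine ⟨1, ?_⟩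
      have := mem_charSpace.1 (hBc b hb) x
      simp [this]
    exact hb0 (Submodule.disjoint_def.1
      (Module.End.disjoint_iInf_maxGenEigenspace (fun x : L => phi P K M x) hne) b h1 h2)
  refine le_trans (le_of_eq ?_) (le_iSup _ ⟨c, hD c B hirr hchar⟩)
  rw [component_toSubmodule, hχ]

theorem iSupIndep_component [FiniteDimensional K M] {κ : Type*} (d : κ → (L →ₗ[F] K))
    (hd : Function.Injective d) : iSupIndep fun i => (component P (d i) M).toSubmodule := by
  have : CharP K p := charP_of_injective_algebraMap (algebraMap F K).injective p
  have h := Module.End.independent_iInf_maxGenEigenspace_of_forall_mapsTo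
    (fun x : L => phi P K M x)
    (fun i j φ => Module.End.mapsTo_maxGenEigenspace_of_comm (commute_phi P j i) φ)
  have h2 := h.comp (f := fun i : κ => fun x => d i x ^ p) (by
    intro i j hij
    exact hd (LinearMap.ext fun x => frobenius_inj K p (congrFun hij x)))
  convert h2 using 2 with i
  exact component_toSubmodule P (d i)

end Characters

/-! ### Galois descent for vector spaces -/

section Descent

variable {F K W : Type*} [Field F] [Field K] [Algebra F K] [AddCommGroup W] [Module F W]

theorem rTensor_smul (α : K ≃ₐ[F] K) (t : K) (w : K ⊗[F] W) :
    LinearMap.rTensor W α.toLinearMap (t • w) = α t • LinearMap.rTensor W α.toLinearMap w := by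
  induction w with
  | zero => simp
  | add a b ha hb => rw [smul_add, map_add, ha, hb, map_add, smul_add]
  | tmul s w => simp [TensorProduct.smul_tmul']

/-- Perfectness of `F` enters here: it makes the algebraic closure a Galois extension, whose fixed
field is `F`. -/
theorem mem_range_algebraMap_of_fixed [PerfectField F] [IsAlgClosure F K] (t : K)
    (ht : ∀ α : K ≃ₐ[F] K, α t = t) : t ∈ Set.range (algebraMap F K) := by
  have : Algebra.IsAlgebraic F K := IsAlgClosure.isAlgebraic
  have : IsGalois F K := {}
  exact (InfiniteGalois.mem_range_algebraMap_iff_fixed t).2 ht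

/-- The vectors of `K ⊗ W` fixed by the automorphisms of `K` are those of `W`. -/
theorem exists_eq_one_tmul_of_fixed [PerfectField F] [IsAlgClosure F K] (t : K ⊗[F] W)
    (ht : ∀ α : K ≃ₐ[F] K, LinearMap.rTensor W α.toLinearMap t = t) :
    ∃ w : W, t = (1 : K) ⊗ₜ[F] w := by
  let b := Module.Basis.ofVectorSpace F W
  let B := b.baseChange K
  have hB : ∀ i, B i = (1 : K) ⊗ₜ[F] b i := fun i => by simp [B]
  have hrepr : ∀ (α : K ≃ₐ[F] K) (t : K ⊗[F] W) i,
      B.repr (LinearMap.rTensor W α.toLinearMap t) i = α (B.repr t i) := by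
    intro α t i
    induction t with
    | zero => simp
    | add a b ha hb => rw [map_add, map_add, Finsupp.add_apply, ha, hb, map_add, Finsupp.add_apply,
        map_add]
    | tmul s w => simp [B, Module.Basis.baseChange_repr_tmul, Algebra.smul_def]
  have hfix : ∀ i, B.repr t i ∈ Set.range (algebraMap F K) := fun i =>
    mem_range_algebraMap_of_fixed _ fun α => by rw [← hrepr, ht]
  choose a ha using hfix
  refine ⟨∑ i ∈ (B.repr t).support, a i • b i, ?_⟩
  rw [TensorProduct.tmul_sum]
  conv_lhs => rw [← B.linearCombination_repr t, Finsupp.linearCombination_apply, Finsupp.sum]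
  refine Finset.sum_congr rfl fun i _ => ?_
  rw [← ha, hB, algebraMap_smul, TensorProduct.tmul_smul]

end Descent

/-! ### Additivity of the action after extension of scalars -/

section ExtendScalars

variable {F K L W : Type*} [Field F] [Field K] [Algebra F K] [LieRing L] [LieAlgebra F L]
  [AddCommGroup W] [Module F W] [LieRingModule L W] [LieModule F L W]

theorem tensor_lie_zero (y : K ⊗[F] L) : ⁅y, (0 : K ⊗[F] W)⁆ = 0 := lie_zero y

theorem tensor_lie_add (y : K ⊗[F] L) (a b : K ⊗[F] W) : ⁅y, a + b⁆ = ⁅y, a⁆ + ⁅y, b⁆ :=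
  lie_add y a b

theorem tensor_zero_lie (m : K ⊗[F] W) : ⁅(0 : K ⊗[F] L), m⁆ = 0 := zero_lie m

theorem tensor_add_lie (y z : K ⊗[F] L) (m : K ⊗[F] W) : ⁅y + z, m⁆ = ⁅y, m⁆ + ⁅z, m⁆ :=
  add_lie y z m

end ExtendScalars

/-! ### Components of K ⊗ W and their Galois conjugates -/

section Components

variable {p : ℕ} [hp : Fact p.Prime] {F L : Type*} [Field F] [CharP F p] [LieRing L]
  [LieAlgebra F L] {P : PMap p F L} {S : LieSubalgebra F L} {hS : ∀ s ∈ S, P.toFun s ∈ S}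
  {K : Type*} [Field K] [Algebra F K] {C : Set (L →ₗ[F] K)}
  {W : Type*} [AddCommGroup W] [Module F W] [LieRingModule S W] [LieModule F S W]

/-- Irreducible submodules contribute their characters to the cluster, so the components for C|_S
exhaust K ⊗ W. Simple restriction keeps two members of `C` from naming the same component. -/
theorem isComponentSum [IsAlgClosed K] [FiniteDimensional F W] (hCS : RestrictsSimply S C)
    (hC : cluster (P.restrict S hS) K W = resChar S '' C) : IsComponentSum P S hS C W := by
  classical
  have h1 : iSupIndep fun c : C => (wComp P S hS W c.1).toSubmodule :=
    iSupIndep_component (P.restrict S hS) (M := K ⊗[F] W) (fun c : C => resChar S c.1)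
      fun c d h => Subtype.ext (hCS c.2 d.2 h)
  have h2 : ⨆ c : C, (wComp P S hS W c.1).toSubmodule = ⊤ := by
    have h := iSup_component_eq_top (P.restrict S hS) (M := K ⊗[F] W) (resChar S '' C)
      fun c B hirr hc => hC ▸ ⟨⊥, B, bot_le, hirr, hc⟩
    rw [eq_top_iff, ← h]
    refine iSup_le ?_
    rintro ⟨_, c, hc, rfl⟩
    exact le_iSup (fun c : C => (wComp P S hS W c.1).toSubmodule) ⟨c, hc⟩
  have h3 := DirectSum.isInternal_submodule_of_iSupIndep_of_iSup_eq_top h1 h2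
  exact h3

variable (P S hS C W) in
open Classical in
/-- The sum of a family of components. -/
noncomputable def componentSum : (⨁ c : C, wComp P S hS W c.1) →ₗ[K] K ⊗[F] W :=
  DirectSum.toModule K C _ fun c => (wComp P S hS W c.1).toSubmodule.subtype

open Classical in
theorem componentSum_eq (x : ⨁ c : C, wComp P S hS W c.1) :
    componentSum P S hS C W x = DirectSum.coeAddMonoidHom (fun c : C => wComp P S hS W c.1) x := by
  induction x using DirectSum.induction_on with
  | zero => simp
  | of c x =>
    rw [DirectSum.coeAddMonoidHom_of]
    exact DirectSum.toModule_lof K (φ := fun c : C => (wComp P S hS W c.1).toSubmodule.subtype) c x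
  | add x y hx hy => rw [map_add, hx, hy, map_add]

/-- The decomposition of `K ⊗ W` into its components. -/
noncomputable def componentEquiv (hD : IsComponentSum P S hS C W) :
    (K ⊗[F] W) ≃ₗ[K] ⨁ c : C, wComp P S hS W c.1 :=
  (LinearEquiv.ofBijective (componentSum P S hS C W) (by
    have h : ⇑(componentSum P S hS C W) = _ := funext componentSum_eq
    rw [h]
    exact hD)).symm

variable (hD : IsComponentSum P S hS C W)

theorem componentSum_componentEquiv (t : K ⊗[F] W) :
    componentSum P S hS C W (componentEquiv hD t) = t :=
  (componentEquiv hD).symm_apply_apply t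

open Classical in
theorem componentEquiv_of (c : C) (w : wComp P S hS W c.1) :
    componentEquiv hD (w : K ⊗[F] W) = DirectSum.lof K C (fun c : C => wComp P S hS W c.1) c w := by
  rw [← LinearEquiv.eq_symm_apply]
  exact (DirectSum.toModule_lof K
    (φ := fun c : C => (wComp P S hS W c.1).toSubmodule.subtype) c w).symm

/-- A property of the vectors of `K ⊗ W` holds if it holds on the components. -/
theorem component_induction (hD : IsComponentSum P S hS C W) {motive : K ⊗[F] W → Prop}
    (mem : ∀ (c : C) (w : wComp P S hS W c.1), motive w)
    (zero : motive 0) (add : ∀ a b, motive a → motive b → motive (a + b)) (t : K ⊗[F] W) :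
    motive t := by
  classical
  rw [← componentSum_componentEquiv hD t]
  generalize componentEquiv hD t = x
  induction x using DirectSum.induction_on with
  | zero => simpa using zero
  | of c x => rw [componentSum_eq, DirectSum.coeAddMonoidHom_of]; exact mem c x
  | add x y hx hy => rw [map_add]; exact add _ _ hx hy

theorem componentEquiv_lie (y : K ⊗[F] S) (t : K ⊗[F] W) :
    componentEquiv hD ⁅y, t⁆ = ⁅y, componentEquiv hD t⁆ := by
  classical
  induction t using component_induction hD with
  | mem c w =>
    have h1 : ⁅y, (w : K ⊗[F] W)⁆ = ((⁅y, w⁆ : wComp P S hS W c.1) : K ⊗[F] W) := rfl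
    rw [h1, componentEquiv_of, componentEquiv_of]
    exact LieModuleHom.map_lie (DirectSum.lieModuleOf K C (K ⊗[F] S)
      (fun c : C => wComp P S hS W c.1) c) y w
  | zero => rw [tensor_lie_zero, map_zero, lie_zero]
  | add a b ha hb => rw [tensor_lie_add, map_add, ha, hb, map_add, lie_add]

/-- The operator which acts on the component of `c` by `c(x)^p`. -/
noncomputable def charOp (hD : IsComponentSum P S hS C W) (x : L) :
    K ⊗[F] W →ₗ[K] K ⊗[F] W :=
  componentSum P S hS C W ∘ₗ
    (DirectSum.lmap fun c : C => (c.1 x ^ p) • LinearMap.id) ∘ₗ (componentEquiv hD).toLinearMap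

theorem componentEquiv_charOp (x : L) (t : K ⊗[F] W) (c : C) :
    componentEquiv hD (charOp hD x t) c = c.1 x ^ p • componentEquiv hD t c := by
  have : componentEquiv hD (charOp hD x t)
      = (DirectSum.lmap fun c : C => (c.1 x ^ p) • LinearMap.id) (componentEquiv hD t) :=
    (componentEquiv hD).apply_symm_apply _
  rw [this, DirectSum.lmap_apply]
  rfl

theorem charOp_mem (x : L) (c : C) (w : K ⊗[F] W) (hw : w ∈ wComp P S hS W c.1) :
    charOp hD x w = c.1 x ^ p • w := by
  classical
  apply (componentEquiv hD).injective
  refine DFinsupp.ext fun d => ?_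
  rw [map_smul]
  refine (componentEquiv_charOp hD x w d).trans ?_
  have h1 : componentEquiv hD w = _ := componentEquiv_of hD c ⟨w, hw⟩
  have h3 : (c.1 x ^ p • componentEquiv hD w) d = c.1 x ^ p • componentEquiv hD w d := rfl
  rw [h3]
  rcases eq_or_ne c d with rfl | h
  · rfl
  · have h2 : componentEquiv hD w d = 0 := by
      rw [h1]
      exact DirectSum.of_eq_of_ne _ _ _ h.symm
    rw [h2, smul_zero, smul_zero]

theorem IsSimpleCluster.conj_mem (h : IsSimpleCluster C) (α : K ≃ₐ[F] K) (c : L →ₗ[F] K)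
    (hc : c ∈ C) : conjChar α c ∈ C := by
  obtain ⟨c₀, rfl⟩ := h
  obtain ⟨β, rfl⟩ := hc
  exact ⟨β.trans α, rfl⟩

theorem rTensor_lie (α : K ≃ₐ[F] K) (s : S) (t : K ⊗[F] W) :
    LinearMap.rTensor W α.toLinearMap ⁅(1 : K) ⊗ₜ[F] s, t⁆
      = ⁅(1 : K) ⊗ₜ[F] s, LinearMap.rTensor W α.toLinearMap t⁆ := by
  induction t with
  | zero => rw [tensor_lie_zero, map_zero, tensor_lie_zero]
  | add a b ha hb => rw [tensor_lie_add, map_add, ha, hb, map_add, tensor_lie_add]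
  | tmul t w => simp

theorem rTensor_phi (α : K ≃ₐ[F] K) (s : S) (t : K ⊗[F] W) :
    LinearMap.rTensor W α.toLinearMap (phi (P.restrict S hS) K (K ⊗[F] W) s t)
      = phi (P.restrict S hS) K (K ⊗[F] W) s (LinearMap.rTensor W α.toLinearMap t) := by
  have h : ∀ n : ℕ, LinearMap.rTensor W α.toLinearMap
      ((LieModule.toEnd K (K ⊗[F] S) (K ⊗[F] W) ((1 : K) ⊗ₜ[F] s) ^ n) t)
      = (LieModule.toEnd K (K ⊗[F] S) (K ⊗[F] W) ((1 : K) ⊗ₜ[F] s) ^ n)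
        (LinearMap.rTensor W α.toLinearMap t) := by
    intro n
    induction n with
    | zero => simp
    | succ n ih =>
      rw [pow_succ', Module.End.mul_apply, Module.End.mul_apply, LieModule.toEnd_apply_apply,
        rTensor_lie, ih]
      rfl
  rw [phi_apply, phi_apply, map_sub, h, rTensor_lie]

/-- α commutes with φ_s, which is defined over `F`, and applies α to scalars, turning c(s)^p into
c^α(s)^p. -/
theorem rTensor_mem_wComp (α : K ≃ₐ[F] K) (c : L →ₗ[F] K) (w : K ⊗[F] W)
    (hw : w ∈ wComp P S hS W c) :
    LinearMap.rTensor W α.toLinearMap w ∈ wComp P S hS W (conjChar α c) := by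
  obtain ⟨r, hr⟩ := hw
  refine ⟨r, fun s => ?_⟩
  have key : ∀ (n : ℕ) (t : K ⊗[F] W), ((phi (P.restrict S hS) K (K ⊗[F] W) s
      - algebraMap K _ (resChar S (conjChar α c) s ^ p)) ^ n) (LinearMap.rTensor W α.toLinearMap t)
      = LinearMap.rTensor W α.toLinearMap (((phi (P.restrict S hS) K (K ⊗[F] W) s
      - algebraMap K _ (resChar S c s ^ p)) ^ n) t) := by
    intro n
    induction n with
    | zero => simp
    | succ n ih =>
      intro t
      rw [pow_succ, Module.End.mul_apply, pow_succ, Module.End.mul_apply, ← ih]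
      congr 1
      rw [LinearMap.sub_apply, LinearMap.sub_apply, Module.algebraMap_end_apply,
        Module.algebraMap_end_apply, map_sub, rTensor_phi, rTensor_smul, map_pow]
      rfl
  rw [key, hr s, map_zero]

/-- α permutes the components as it permutes the characters, and the scalars follow. Of the simple
cluster only its stability under conjugation is needed. -/
theorem rTensor_charOp (h : IsSimpleCluster C) (α : K ≃ₐ[F] K) (x : L) (t : K ⊗[F] W) :
    LinearMap.rTensor W α.toLinearMap (charOp hD x t)
      = charOp hD x (LinearMap.rTensor W α.toLinearMap t) := by
  induction t using component_induction hD with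
  | mem c w =>
    rw [charOp_mem hD x c w w.2, rTensor_smul,
      charOp_mem hD x ⟨_, h.conj_mem α c.1 c.2⟩ _ (rTensor_mem_wComp α c.1 w w.2), map_pow]
    rfl
  | zero => simp
  | add a b ha hb => simp only [map_add, ha, hb]

/-- The operators `charOp` are defined over `F`. -/
theorem exists_charOp_one_tmul [PerfectField F] [IsAlgClosure F K] (h : IsSimpleCluster C) (x : L)
    (w : W) : ∃ w' : W, charOp hD x ((1 : K) ⊗ₜ[F] w) = (1 : K) ⊗ₜ[F] w' := by
  refine exists_eq_one_tmul_of_fixed _ fun α => ?_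
  rw [rTensor_charOp hD h]
  simp

end Components

/-! ### The c-induced module: generators and character -/

section CInd

variable {p : ℕ} [hp : Fact p.Prime] {F L : Type*} [Field F] [CharP F p] [LieRing L]
  [LieAlgebra F L] {P : PMap p F L} {K : Type*} [Field K] [Algebra F K]
  {S : LieSubalgebra F L} {hS : ∀ s ∈ S, P.toFun s ∈ S} {c : L →ₗ[F] K}
  {M : Type*} [AddCommGroup M] [Module K M] [LieRingModule (K ⊗[F] S) M]
  [LieModule K (K ⊗[F] S) M] {h : HasCharacter (P.restrict S hS) (resChar S c) M}

namespace CInd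

theorem smul_tmul (a b : ReducedEnv P c) (m : M) :
    a • tmul P S hS c h b m = tmul P S hS c h (a * b) m := rfl

theorem lie_eq_smul (y : K ⊗[F] L) (v : CInd P S hS c h) : ⁅y, v⁆ = ReducedEnv.ι P c y • v := rfl

theorem toEnd_pow_apply (y : K ⊗[F] L) (n : ℕ) (v : CInd P S hS c h) :
    (LieModule.toEnd K (K ⊗[F] L) (CInd P S hS c h) y ^ n) v = ReducedEnv.ι P c y ^ n • v := by
  induction n with
  | zero => simp
  | succ n ih => rw [pow_succ', Module.End.mul_apply, ih, LieModule.toEnd_apply_apply, lie_eq_smul,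
      smul_smul, pow_succ']

theorem tmul_mul_incl (b : ReducedEnv P c) (a : ReducedEnv (P.restrict S hS) (resChar S c))
    (m : M) : tmul P S hS c h (b * ReducedEnv.incl S hS c a) m
      = tmul P S hS c h b (ReducedEnv.act h a m) :=
  (Submodule.Quotient.eq _).2 (Submodule.subset_span ⟨b, a, m, rfl⟩)

/-- The module `CInd` is generated by the elements `a ⊗ m`. -/
theorem induction {motive : CInd P S hS c h → Prop}
    (tmul : ∀ a m, motive (tmul P S hS c h a m)) (add : ∀ v w, motive v → motive w → motive (v + w))
    (v : CInd P S hS c h) : motive v := by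
  obtain ⟨t, rfl⟩ := Submodule.Quotient.mk_surjective _ v
  induction t with
  | zero =>
    have := tmul 0 0
    rwa [map_zero] at this
  | add a b ha hb => exact add _ _ ha hb
  | tmul a m => exact tmul a m

theorem one_tmul_lie (s : S) (m : M) :
    tmul P S hS c h 1 ⁅(1 : K) ⊗ₜ[F] s, m⁆ = ⁅(1 : K) ⊗ₜ[F] (s : L), tmul P S hS c h 1 m⁆ := by
  have h1 : ReducedEnv.act h (ReducedEnv.ι _ _ ((1 : K) ⊗ₜ[F] s)) m = ⁅(1 : K) ⊗ₜ[F] s, m⁆ := by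
    rw [ReducedEnv.act, ReducedEnv.lift_ι]
    rfl
  rw [← h1, ← tmul_mul_incl, one_mul, ReducedEnv.incl_ι, lie_eq_smul, smul_tmul, mul_one]
  rfl

theorem hasCharacter : HasCharacter P c (CInd P S hS c h) := by
  intro x v
  rw [phi_apply, toEnd_pow_apply, lie_eq_smul, ReducedEnv.ι_pow, add_smul, add_sub_cancel_left,
    algebraMap_smul]

end CInd

end CInd

/-! ### The direct sum of the c-induced modules -/

section CIndSum

variable {p : ℕ} [hp : Fact p.Prime] {F L : Type*} [Field F] [CharP F p] [LieRing L]
  [LieAlgebra F L] {P : PMap p F L} {S : LieSubalgebra F L} {hS : ∀ s ∈ S, P.toFun s ∈ S}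
  {K : Type*} [Field K] [Algebra F K] {C : Set (L →ₗ[F] K)}
  {W : Type*} [AddCommGroup W] [Module F W] [LieRingModule S W] [LieModule F S W]
  {hW : IsAmenable (P.restrict S hS) K W} {hC : cluster (P.restrict S hS) K W = resChar S '' C}

namespace CIndSum

variable (P S hS C W hW hC) in
/-- The projection onto a summand. -/
noncomputable def proj (c : C) :
    CIndSum P S hS C W hW hC →ₗ⁅K, K ⊗[F] L⁆ CInd P S hS c.1 (wComp_hasCharacter P S hS hW hC c) :=
  DirectSum.lieModuleComponent K C (K ⊗[F] L)
    (fun c : C => CInd P S hS c.1 (wComp_hasCharacter P S hS hW hC c)) c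

variable (P S hS C W hW hC) in
open Classical in
/-- The inclusion of a summand. -/
noncomputable def lof (c : C) :
    CInd P S hS c.1 (wComp_hasCharacter P S hS hW hC c) →ₗ⁅K, K ⊗[F] L⁆ CIndSum P S hS C W hW hC :=
  DirectSum.lieModuleOf K C (K ⊗[F] L)
    (fun c : C => CInd P S hS c.1 (wComp_hasCharacter P S hS hW hC c)) c

theorem ext {v w : CIndSum P S hS C W hW hC}
    (h : ∀ c, proj P S hS C W hW hC c v = proj P S hS C W hW hC c w) : v = w :=
  DFinsupp.ext h

theorem induction {motive : CIndSum P S hS C W hW hC → Prop}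
    (zero : motive 0) (lof : ∀ c v, motive (lof P S hS C W hW hC c v))
    (add : ∀ v w, motive v → motive w → motive (v + w)) (v : CIndSum P S hS C W hW hC) :
    motive v := by
  classical
  exact DirectSum.induction_on (motive := motive) v zero lof add

theorem mem_iSup_charSpace (v : CIndSum P S hS C W hW hC) :
    v ∈ ⨆ c ∈ C, charSpace P c (CIndSum P S hS C W hW hC) := by
  induction v using induction with
  | zero => exact zero_mem _
  | add v w hv hw => exact add_mem hv hw
  | lof c v =>
    refine Submodule.mem_iSup_of_mem c.1 (Submodule.mem_iSup_of_mem c.2 (mem_charSpace.2 fun x => ?_))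
    rw [phi_map, CInd.hasCharacter, ← LieModuleHom.coe_toLinearMap, map_smul]

end CIndSum

variable (P S hS C W hW hC) in
/-- The map `t ↦ e(r) ⊗ t`. -/
noncomputable def monomialLin (hD : IsComponentSum P S hS C W) {n : ℕ} (e : Fin n → L)
    (r : Fin n → ℕ) : K ⊗[F] W →ₗ[K] CIndSum P S hS C W hW hC :=
  monomialTmulFamily P S hS hW hC e r ∘ₗ (componentEquiv hD).toLinearMap

variable (hD : IsComponentSum P S hS C W)

theorem monomialTmul_eq {n : ℕ} (e : Fin n → L) (r : Fin n → ℕ) (t : K ⊗[F] W) :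
    monomialTmul P S hS hW hC hD e r t = monomialLin P S hS C W hW hC hD e r t := by
  classical
  refine congrArg (monomialTmulFamily P S hS hW hC e r) ?_
  rw [AddEquiv.symm_apply_eq]
  exact ((componentSum_eq _).symm.trans (componentSum_componentEquiv hD t)).symm

theorem proj_monomialLin {n : ℕ} (e : Fin n → L) (r : Fin n → ℕ) (t : K ⊗[F] W) (c : C) :
    CIndSum.proj P S hS C W hW hC c (monomialLin P S hS C W hW hC hD e r t)
      = CInd.tmul P S hS c.1 (wComp_hasCharacter P S hS hW hC c) (ReducedEnv.monomial P c.1 e r)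
        (componentEquiv hD t c) :=
  DirectSum.lmap_apply (fun c : C => CInd.tmul P S hS c.1 (wComp_hasCharacter P S hS hW hC c)
    (List.ofFn fun j => ReducedEnv.ι P c.1 ((1 : K) ⊗ₜ[F] e j) ^ r j).prod) _ c

variable (P S hS C W hW hC) in
/-- The map `t ↦ 1 ⊗ t`. -/
noncomputable def oneLin (hD : IsComponentSum P S hS C W) :
    K ⊗[F] W →ₗ[K] CIndSum P S hS C W hW hC :=
  monomialLin P S hS C W hW hC hD (fun i : Fin 0 => i.elim0) fun i => i.elim0

theorem proj_oneLin (t : K ⊗[F] W) (c : C) :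
    CIndSum.proj P S hS C W hW hC c (oneLin P S hS C W hW hC hD t)
      = CInd.tmul P S hS c.1 (wComp_hasCharacter P S hS hW hC c) 1 (componentEquiv hD t c) := by
  rw [oneLin, proj_monomialLin, ReducedEnv.monomial, List.ofFn_zero, List.prod_nil]

/-- Expresses e(r) ⊗ t through the action of `L` alone, without separate products for each c, and so
places it in the `L`-module generated by 1 ⊗ t. -/
theorem monomialLin_eq_prod {n : ℕ} (e : Fin n → L) (r : Fin n → ℕ) (t : K ⊗[F] W) :
    monomialLin P S hS C W hW hC hD e r t
      = (List.ofFn fun j => LieModule.toEnd F L (CIndSum P S hS C W hW hC) (e j) ^ r j).prod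
        (oneLin P S hS C W hW hC hD t) := by
  refine CIndSum.ext fun c => ?_
  have h1 : ∀ (x : L) (m : ℕ) v, CIndSum.proj P S hS C W hW hC c
      ((LieModule.toEnd F L (CIndSum P S hS C W hW hC) x ^ m) v)
      = ReducedEnv.ι P c.1 ((1 : K) ⊗ₜ[F] x) ^ m • CIndSum.proj P S hS C W hW hC c v := by
    intro x m v
    induction m with
    | zero => simp
    | succ m ih =>
      rw [pow_succ', Module.End.mul_apply, pow_succ', mul_smul, ← ih]
      exact LieModuleHom.map_lie _ _ _
  have h2 : ∀ (l : List (Fin n)) v, CIndSum.proj P S hS C W hW hC c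
      ((l.map fun j => LieModule.toEnd F L (CIndSum P S hS C W hW hC) (e j) ^ r j).prod v)
      = (l.map fun j => ReducedEnv.ι P c.1 ((1 : K) ⊗ₜ[F] e j) ^ r j).prod
        • CIndSum.proj P S hS C W hW hC c v := by
    intro l v
    induction l with
    | nil => simp
    | cons j l ih =>
      rw [List.map_cons, List.prod_cons, Module.End.mul_apply, h1, ih, smul_smul, List.map_cons,
        List.prod_cons]
  rw [proj_monomialLin, List.ofFn_eq_map, h2, proj_oneLin, CInd.smul_tmul, mul_one,
    ReducedEnv.monomial, List.ofFn_eq_map]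

theorem lie_oneLin (s : S) (t : K ⊗[F] W) : ⁅(s : L), oneLin P S hS C W hW hC hD t⁆
    = oneLin P S hS C W hW hC hD ⁅(1 : K) ⊗ₜ[F] s, t⁆ := by
  refine CIndSum.ext fun c => ?_
  have h1 : CIndSum.proj P S hS C W hW hC c ⁅(s : L), oneLin P S hS C W hW hC hD t⁆
      = ⁅(1 : K) ⊗ₜ[F] (s : L), CIndSum.proj P S hS C W hW hC c (oneLin P S hS C W hW hC hD t)⁆ :=
    LieModuleHom.map_lie _ _ _
  rw [h1, proj_oneLin, proj_oneLin, componentEquiv_lie, ← CInd.one_tmul_lie]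
  rfl

/-- On the summand of c, x^p - x^[p] is the scalar c(x)^p; over all c these scalars assemble to an
operator on K ⊗ W itself. -/
theorem toEnd_pow_sub_oneLin (x : L) (t : K ⊗[F] W) :
    (LieModule.toEnd F L (CIndSum P S hS C W hW hC) x ^ p) (oneLin P S hS C W hW hC hD t)
      - ⁅P.toFun x, oneLin P S hS C W hW hC hD t⁆
      = oneLin P S hS C W hW hC hD (charOp hD x t) := by
  have h1 : ∀ (m : ℕ) (v : CIndSum P S hS C W hW hC),
      (LieModule.toEnd F L (CIndSum P S hS C W hW hC) x ^ m) v
      = (LieModule.toEnd K (K ⊗[F] L) (CIndSum P S hS C W hW hC) ((1 : K) ⊗ₜ[F] x) ^ m) v := by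
    intro m v
    induction m with
    | zero => simp
    | succ m ih =>
      rw [pow_succ', Module.End.mul_apply, pow_succ', Module.End.mul_apply, ih]
      rfl
  have h2 : (LieModule.toEnd F L (CIndSum P S hS C W hW hC) x ^ p) (oneLin P S hS C W hW hC hD t)
      - ⁅P.toFun x, oneLin P S hS C W hW hC hD t⁆
      = phi P K (CIndSum P S hS C W hW hC) x (oneLin P S hS C W hW hC hD t) := by
    rw [h1]
    rfl
  refine CIndSum.ext fun c => ?_
  rw [h2, ← phi_map, CInd.hasCharacter, proj_oneLin, proj_oneLin, componentEquiv_charOp, map_smul]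

end CIndSum

/-! ### The coefficientwise Galois action and the F-form spanned by a basis -/

section BasisConj

variable {F K V κ : Type*} [Field F] [Field K] [Algebra F K] [AddCommGroup V]
  [Module K V] [Fintype κ] (B : Module.Basis κ K V) (α : K ≃ₐ[F] K)

theorem repr_basisConj (v : V) (i : κ) : B.repr (basisConj B α v) i = α (B.repr v i) := by
  rw [basisConj, B.repr_sum_self]

theorem basisConj_add (v w : V) : basisConj B α (v + w) = basisConj B α v + basisConj B α w :=
  B.ext_elem fun i => by simp [repr_basisConj]

theorem basisConj_smul (t : K) (v : V) : basisConj B α (t • v) = α t • basisConj B α v :=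
  B.ext_elem fun i => by simp [repr_basisConj]

variable [Module F V] [IsScalarTower F K V]

theorem mem_span_range_iff_basisConj [PerfectField F] [IsAlgClosure F K] (v : V) :
    v ∈ Submodule.span F (Set.range B) ↔ ∀ α : K ≃ₐ[F] K, basisConj B α v = v := by
  rw [B.mem_span_iff_repr_mem F]
  constructor
  · intro h α
    refine B.ext_elem fun i => ?_
    obtain ⟨a, ha⟩ := h i
    rw [repr_basisConj, ← ha, α.commutes]
  · intro h i
    refine mem_range_algebraMap_of_fixed _ fun α => ?_
    rw [← repr_basisConj, h α]

theorem isBaseChange_span_range :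
    IsBaseChange K (Submodule.span F (Set.range B)).subtype := by
  let bV := Module.Basis.span (B.linearIndependent.restrict_scalars' F)
  let e := (bV.baseChange K).equiv B (Equiv.refl κ)
  refine IsBaseChange.of_equiv e fun v => ?_
  have h : e.toLinearMap.restrictScalars F ∘ₗ TensorProduct.mk F K _ 1
      = (Submodule.span F (Set.range B)).subtype := by
    refine bV.ext fun i => ?_
    have h1 : (1 : K) ⊗ₜ[F] bV i = bV.baseChange K i := by simp
    have h2 : ((bV i : Submodule.span F (Set.range B)) : V) = B i := by
      simp [bV, Module.Basis.span_apply]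
    change e ((1 : K) ⊗ₜ[F] bV i) = bV i
    rw [h1, h2, Module.Basis.equiv_apply, Equiv.refl_apply]
  exact LinearMap.congr_fun h v

end BasisConj

/-! ### The C-induced module as an F-form -/

section RationalForm

variable {p : ℕ} [hp : Fact p.Prime] {F L : Type*} [Field F] [CharP F p] [LieRing L]
  [LieAlgebra F L] {P : PMap p F L} {S : LieSubalgebra F L} {hS : ∀ s ∈ S, P.toFun s ∈ S}
  {K : Type*} [Field K] [Algebra F K] {C : Set (L →ₗ[F] K)}
  {W : Type*} [AddCommGroup W] [Module F W] [LieRingModule S W] [LieModule F S W]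
  {hW : IsAmenable (P.restrict S hS) K W} {hC : cluster (P.restrict S hS) K W = resChar S '' C}
  (hD : IsComponentSum P S hS C W) {n : ℕ} {e : Fin n → L}

theorem eq_zero_of_sum_monomialLin_eq_zero [FiniteDimensional F L] (he : IsCobasis S e)
    (t : (Fin n → Fin p) → K ⊗[F] W)
    (ht : ∑ r, monomialLin P S hS C W hW hC hD e (fun j => (r j : ℕ)) (t r) = 0) : t = 0 := by
  funext r
  apply (componentEquiv hD).injective
  rw [Pi.zero_apply, map_zero]
  refine DFinsupp.ext fun c => ?_
  have h1 := congrArg (CIndSum.proj P S hS C W hW hC c) ht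
  rw [← LieModuleHom.coe_toLinearMap, map_sum, map_zero] at h1
  simp only [LieModuleHom.coe_toLinearMap, proj_monomialLin] at h1
  exact congrFun (CInd.sum_tmul_eq_zero P S hS c.1 _ he (fun r => componentEquiv hD (t r) c) h1) r

theorem oneLin_eq_monomialLin (t : K ⊗[F] W) :
    oneLin P S hS C W hW hC hD t = monomialLin P S hS C W hW hC hD e
      (fun j => (((fun _ => ⟨0, hp.out.pos⟩ : Fin n → Fin p) j : Fin p) : ℕ)) t := by
  rw [monomialLin_eq_prod]
  simp

theorem oneLin_injective [FiniteDimensional F L] :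
    Function.Injective (oneLin P S hS C W hW hC hD) := by
  obtain ⟨n, e, he⟩ := exists_isCobasis S
  rw [injective_iff_map_eq_zero]
  intro t ht
  rw [oneLin_eq_monomialLin hD (e := e)] at ht
  have h := eq_zero_of_sum_monomialLin_eq_zero (hW := hW) (hC := hC) hD he
    (Pi.single (fun _ => ⟨0, hp.out.pos⟩) t) (by
      rw [Finset.sum_eq_single_of_mem (fun _ => ⟨0, hp.out.pos⟩) (Finset.mem_univ _)]
      · rw [Pi.single_eq_same, ht]
      · intro r _ hr
        rw [Pi.single_eq_of_ne hr, map_zero])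
  simpa using congrFun h fun _ => ⟨0, hp.out.pos⟩

theorem lof_tmul_one (c : C) (w : wComp P S hS W c.1) :
    CIndSum.lof P S hS C W hW hC c (CInd.tmul P S hS c.1 (wComp_hasCharacter P S hS hW hC c) 1 w)
      = oneLin P S hS C W hW hC hD w := by
  classical
  refine CIndSum.ext fun d => ?_
  rw [proj_oneLin, componentEquiv_of]
  rcases eq_or_ne c d with rfl | h
  · have h1 : (DirectSum.lof K C (fun c : C => wComp P S hS W c.1) c w) c = w :=
      DirectSum.of_eq_same _ _
    rw [h1]
    exact DirectSum.of_eq_same _ _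
  · have h1 : (DirectSum.lof K C (fun c : C => wComp P S hS W c.1) c w) d = 0 :=
      DirectSum.of_eq_of_ne _ _ _ h.symm
    rw [h1, map_zero]
    exact DirectSum.of_eq_of_ne _ _ _ h.symm

variable (P S hS C W hW hC) in
/-- The `F`-space of the vectors `1 ⊗ w` for `w ∈ W`. -/
noncomputable def oneSpace (hD : IsComponentSum P S hS C W) :
    Submodule F (CIndSum P S hS C W hW hC) :=
  LinearMap.range ((oneLin P S hS C W hW hC hD).restrictScalars F ∘ₗ TensorProduct.mk F K W 1)

variable (P S hS C W hW hC) in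
/-- The `C`-induced module. -/
noncomputable def inducedModule (hD : IsComponentSum P S hS C W) :
    LieSubmodule F L (CIndSum P S hS C W hW hC) :=
  LieSubmodule.lieSpan F L (oneSpace P S hS C W hW hC hD)

theorem mem_oneSpace {v : CIndSum P S hS C W hW hC} : v ∈ oneSpace P S hS C W hW hC hD ↔
    ∃ w : W, oneLin P S hS C W hW hC hD ((1 : K) ⊗ₜ[F] w) = v := Iff.rfl

section

attribute [local instance 100] LieRing.ofAssociativeRing

/-- Straightening over `F`. The delicate hypothesis is `hpow`: e_i^p - e_i^[p] must carry 1 ⊗ W into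
itself, which is the rationality of `charOp`. -/
theorem lie_mem_monomialSpan_oneSpace [PerfectField F] [IsAlgClosure F K] (h : IsSimpleCluster C)
    (he : IsCobasis S e) (x : L) {v : CIndSum P S hS C W hW hC}
    (hv : v ∈ monomialSpan p (fun i => LieModule.toEnd F L (CIndSum P S hS C W hW hC) (e i))
      (oneSpace P S hS C W hW hC hD)) :
    ⁅x, v⁆ ∈ monomialSpan p (fun i => LieModule.toEnd F L (CIndSum P S hS C W hW hC) (e i))
      (oneSpace P S hS C W hW hC hD) := by
  have htop : Submodule.span F (Set.range e) ⊔ S.toSubmodule = ⊤ := by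
    rw [sup_comm]
    exact he.2.sup_eq_top
  have hH : ∀ a ∈ S.toSubmodule, ∀ w ∈ oneSpace P S hS C W hW hC hD,
      LieModule.toEnd F L (CIndSum P S hS C W hW hC) a w ∈ oneSpace P S hS C W hW hC hD := by
    intro a ha w hw
    obtain ⟨w, rfl⟩ := (mem_oneSpace hD).1 hw
    refine (mem_oneSpace hD).2 ⟨⁅(⟨a, ha⟩ : S), w⁆, ?_⟩
    rw [LieModule.toEnd_apply_apply]
    refine Eq.trans ?_ (lie_oneLin hD ⟨a, ha⟩ ((1 : K) ⊗ₜ[F] w)).symm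
    rw [LieAlgebra.ExtendScalars.bracket_tmul, one_mul]
  have hpow : ∀ i, ∀ w ∈ oneSpace P S hS C W hW hC hD, ∃ b : L,
      (LieModule.toEnd F L (CIndSum P S hS C W hW hC) (e i) ^ p) w
        - LieModule.toEnd F L (CIndSum P S hS C W hW hC) b w ∈ oneSpace P S hS C W hW hC hD := by
    intro i w hw
    obtain ⟨w, rfl⟩ := (mem_oneSpace hD).1 hw
    obtain ⟨w', hw'⟩ := exists_charOp_one_tmul hD h (e i) w
    refine ⟨P.toFun (e i), (mem_oneSpace hD).2 ⟨w', ?_⟩⟩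
    rw [LieModule.toEnd_apply_apply, toEnd_pow_sub_oneLin, hw']
  have hΛ : ∀ a b : L, LieModule.toEnd F L (CIndSum P S hS C W hW hC) ⁅a, b⁆
      = LieModule.toEnd F L (CIndSum P S hS C W hW hC) a *
        LieModule.toEnd F L (CIndSum P S hS C W hW hC) b
        - LieModule.toEnd F L (CIndSum P S hS C W hW hC) b *
        LieModule.toEnd F L (CIndSum P S hS C W hW hC) a := by
    intro a b
    rw [LieHom.map_lie, LieRing.of_associative_ring_bracket]
  exact lie_apply_mem_monomialSpan
    (LieModule.toEnd F L (CIndSum P S hS C W hW hC)).toLinearMap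
    hΛ e S.toSubmodule htop hH hpow x hv

end

/-- The left side involves no cobasis, so the same V serves for every cobasis. -/
theorem inducedModule_eq_monomialSpan [PerfectField F] [IsAlgClosure F K] (h : IsSimpleCluster C)
    (he : IsCobasis S e) :
    (inducedModule P S hS C W hW hC hD : Submodule F (CIndSum P S hS C W hW hC))
      = monomialSpan p (fun i => LieModule.toEnd F L (CIndSum P S hS C W hW hC) (e i))
        (oneSpace P S hS C W hW hC hD) := by
  apply le_antisymm
  · let N : LieSubmodule F L (CIndSum P S hS C W hW hC) :=
      { toSubmodule := monomialSpan p
          (fun i => LieModule.toEnd F L (CIndSum P S hS C W hW hC) (e i))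
          (oneSpace P S hS C W hW hC hD)
        lie_mem := fun hv => lie_mem_monomialSpan_oneSpace hD h he _ hv }
    refine LieSubmodule.lieSpan_le (N := N).2 fun w hw => ?_
    exact Submodule.subset_span ⟨fun _ => ⟨0, hp.out.pos⟩, w, hw, by simp⟩
  · refine Submodule.span_le.2 ?_
    rintro _ ⟨r, w, hw, rfl⟩
    have hpow : ∀ (x : L) (m : ℕ), ∀ v ∈ inducedModule P S hS C W hW hC hD,
        (LieModule.toEnd F L (CIndSum P S hS C W hW hC) x ^ m) v
          ∈ inducedModule P S hS C W hW hC hD := by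
      intro x m v hv
      induction m with
      | zero => simpa using hv
      | succ m ih =>
        rw [pow_succ', Module.End.mul_apply]
        exact LieSubmodule.lie_mem _ ih
    rw [List.ofFn_eq_map]
    generalize List.finRange n = l
    induction l with
    | nil => exact LieSubmodule.subset_lieSpan hw
    | cons j l ih =>
      rw [List.map_cons, List.prod_cons, Module.End.mul_apply]
      exact hpow _ _ _ ih

theorem inducedModule_eq_span [PerfectField F] [IsAlgClosure F K] (h : IsSimpleCluster C)
    (he : IsCobasis S e) {κ : Type*} (b : Module.Basis κ F W) :
    (inducedModule P S hS C W hW hC hD : Submodule F (CIndSum P S hS C W hW hC))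
      = Submodule.span F (Set.range fun q : (Fin n → Fin p) × κ =>
        monomialLin P S hS C W hW hC hD e (fun j => (q.1 j : ℕ)) ((1 : K) ⊗ₜ[F] b q.2)) := by
  rw [inducedModule_eq_monomialSpan hD h he]
  apply le_antisymm
  · refine Submodule.span_le.2 ?_
    rintro _ ⟨r, _, ⟨w, rfl⟩, rfl⟩
    let g : W →ₗ[F] CIndSum P S hS C W hW hC :=
      (monomialLin P S hS C W hW hC hD e fun j => (r j : ℕ)).restrictScalars F ∘ₗ
        TensorProduct.mk F K W 1
    have h1 : Submodule.span F (Set.range b) ≤ (Submodule.span F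
        (Set.range fun q : (Fin n → Fin p) × κ => monomialLin P S hS C W hW hC hD e
          (fun j => (q.1 j : ℕ)) ((1 : K) ⊗ₜ[F] b q.2))).comap g := by
      refine Submodule.span_le.2 ?_
      rintro _ ⟨i, rfl⟩
      exact Submodule.subset_span ⟨(r, i), rfl⟩
    have h2 := h1 (b.mem_span w)
    rw [Submodule.mem_comap] at h2
    have h3 : g w = _ := monomialLin_eq_prod hD e (fun j => (r j : ℕ)) ((1 : K) ⊗ₜ[F] w)
    rw [h3] at h2
    exact h2
  · refine Submodule.span_le.2 ?_
    rintro _ ⟨⟨r, i⟩, rfl⟩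
    exact Submodule.subset_span ⟨r, _, ⟨b i, rfl⟩,
      monomialLin_eq_prod hD e (fun j => (r j : ℕ)) ((1 : K) ⊗ₜ[F] b i)⟩

theorem linearIndependent_monomialLin [FiniteDimensional F L] (he : IsCobasis S e)
    {κ : Type*} [Finite κ] (b : Module.Basis κ F W) :
    LinearIndependent K fun q : (Fin n → Fin p) × κ =>
      monomialLin P S hS C W hW hC hD e (fun j => (q.1 j : ℕ)) ((1 : K) ⊗ₜ[F] b q.2) := by
  have := Fintype.ofFinite κ
  rw [Fintype.linearIndependent_iff]
  rintro g hg ⟨r, i⟩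
  have h1 := eq_zero_of_sum_monomialLin_eq_zero (hW := hW) (hC := hC) hD he
    (fun r => ∑ i, g (r, i) • (1 : K) ⊗ₜ[F] b i) (by
      rw [← hg, Fintype.sum_prod_type]
      refine Finset.sum_congr rfl fun r _ => ?_
      rw [map_sum]
      exact Finset.sum_congr rfl fun i _ => map_smul _ _ _)
  have h2 := Fintype.linearIndependent_iff.1 (b.baseChange K).linearIndependent (fun i => g (r, i))
    (by simpa using congrFun h1 r)
  exact h2 i

/-- The `K`-span is stable under `L`, because V is, and contains 1 ⊗ t for all t. Each summand is
generated by such vectors over u(L̄, c). -/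
theorem span_monomialLin_eq_top [PerfectField F] [IsAlgClosure F K] (h : IsSimpleCluster C)
    (he : IsCobasis S e) {κ : Type*} (b : Module.Basis κ F W) :
    Submodule.span K (Set.range fun q : (Fin n → Fin p) × κ =>
      monomialLin P S hS C W hW hC hD e (fun j => (q.1 j : ℕ)) ((1 : K) ⊗ₜ[F] b q.2)) = ⊤ := by
  set Y := Submodule.span K (Set.range fun q : (Fin n → Fin p) × κ =>
      monomialLin P S hS C W hW hC hD e (fun j => (q.1 j : ℕ)) ((1 : K) ⊗ₜ[F] b q.2)) with hY
  have hind : ∀ v ∈ inducedModule P S hS C W hW hC hD, v ∈ Y := by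
    intro v hv
    rw [← LieSubmodule.mem_toSubmodule, inducedModule_eq_span hD h he b] at hv
    exact Submodule.span_le_restrictScalars F K _ hv
  have hlie : ∀ (x : L), ∀ v ∈ Y, ⁅x, v⁆ ∈ Y := by
    intro x v hv
    have h1 : Y ≤ Y.comap (LieModule.toEnd K (K ⊗[F] L) (CIndSum P S hS C W hW hC)
        ((1 : K) ⊗ₜ[F] x)) := by
      refine Submodule.span_le.2 ?_
      rintro _ ⟨q, rfl⟩
      refine hind _ (LieSubmodule.lie_mem (inducedModule P S hS C W hW hC hD) ?_)
      change _ ∈ inducedModule P S hS C W hW hC hD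
      rw [← LieSubmodule.mem_toSubmodule, inducedModule_eq_span hD h he b]
      exact Submodule.subset_span ⟨q, rfl⟩
    exact h1 hv
  have hone : ∀ t, oneLin P S hS C W hW hC hD t ∈ Y := by
    intro t
    have h1 : (⊤ : Submodule K (K ⊗[F] W)) ≤ Y.comap (oneLin P S hS C W hW hC hD) := by
      rw [← (b.baseChange K).span_eq]
      refine Submodule.span_le.2 ?_
      rintro _ ⟨i, rfl⟩
      refine hind _ (LieSubmodule.subset_lieSpan ⟨b i, ?_⟩)
      simp
    exact h1 trivial
  rw [eq_top_iff]
  rintro v -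
  induction v using CIndSum.induction with
  | zero => exact zero_mem _
  | add v w hv hw => exact add_mem hv hw
  | lof c v =>
    induction v using CInd.induction with
    | add v w hv hw =>
      rw [← LieModuleHom.coe_toLinearMap, map_add]
      exact add_mem hv hw
    | tmul a m =>
      have h1 : ∀ a : ReducedEnv P c.1, CInd.tmul P S hS c.1 (wComp_hasCharacter P S hS hW hC c) a m
          = a • CInd.tmul P S hS c.1 (wComp_hasCharacter P S hS hW hC c) 1 m := fun a => by
        rw [CInd.smul_tmul, mul_one]
      -- The elements a of u(L̄, c) with a ⊗ m in the span; they include 1 and are stable under left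
      -- multiplication by `L`.
      let T : Submodule K (ReducedEnv P c.1) := Y.comap
        ((CIndSum.lof P S hS C W hW hC c : _ →ₗ[K] _) ∘ₗ (LinearMap.toSpanSingleton _ _
          (CInd.tmul P S hS c.1 (wComp_hasCharacter P S hS hW hC c) 1 m)).restrictScalars K)
      have hT : ∀ a, a ∈ T ↔ CIndSum.lof P S hS C W hW hC c
        (a • CInd.tmul P S hS c.1 (wComp_hasCharacter P S hS hW hC c) 1 m) ∈ Y := fun a => Iff.rfl
      have hT' : T = ⊤ := ReducedEnv.eq_top_of_mul_mem T
        (by rw [hT, one_smul, lof_tmul_one hD]; exact hone _) (by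
        intro x a ha
        rw [hT] at ha ⊢
        rw [mul_smul, ← CInd.lie_eq_smul, LieModuleHom.map_lie]
        exact hlie x _ ha)
      rw [h1, ← hT, hT']
      trivial

end RationalForm

/-! ### Vectors with a character -/

section CharSpace

variable {p : ℕ} [hp : Fact p.Prime] {F L : Type*} [Field F] [CharP F p] [LieRing L]
  [LieAlgebra F L] {P : PMap p F L} {K : Type*} [Field K] [Algebra F K]
  {M N : Type*} [AddCommGroup M] [Module K M] [LieRingModule (K ⊗[F] L) M]
  [LieModule K (K ⊗[F] L) M] [AddCommGroup N] [Module K N] [LieRingModule (K ⊗[F] L) N]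
  [LieModule K (K ⊗[F] L) N]

theorem map_mem_charSpace (f : M →ₗ⁅K, K ⊗[F] L⁆ N) {c : L →ₗ[F] K} {m : M}
    (hm : m ∈ charSpace P c M) : f m ∈ charSpace P c N := by
  rw [mem_charSpace] at hm ⊢
  intro x
  rw [phi_map, hm, ← LieModuleHom.coe_toLinearMap, map_smul]

theorem mem_component_of_mem_charSpace {c : L →ₗ[F] K} {m : M} (hm : m ∈ charSpace P c M) :
    m ∈ component P c M :=
  ⟨1, fun x => by
    rw [pow_one, LinearMap.sub_apply, mem_charSpace.1 hm, Module.algebraMap_end_apply, sub_self]⟩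

/-- On `m` the power (φ_x - d(x)^p)^r is the scalar (c(x)^p - d(x)^p)^r, which must vanish;
Frobenius is injective. -/
theorem eq_of_mem_charSpace_of_mem_component {c d : L →ₗ[F] K} {m : M} (hm0 : m ≠ 0)
    (hc : m ∈ charSpace P c M) (hd : m ∈ component P d M) : c = d := by
  have : CharP K p := charP_of_injective_algebraMap (algebraMap F K).injective p
  obtain ⟨r, hr⟩ := hd
  ext x
  have h : ∀ n : ℕ, ((phi P K M x - algebraMap K (Module.End K M) (d x ^ p)) ^ n) m
      = (c x ^ p - d x ^ p) ^ n • m := by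
    intro n
    induction n with
    | zero => simp
    | succ n ih =>
      rw [pow_succ', Module.End.mul_apply, ih, map_smul, LinearMap.sub_apply, mem_charSpace.1 hc,
        Module.algebraMap_end_apply, ← sub_smul, smul_smul, pow_succ]
  have h1 := (h r).symm.trans (hr x)
  have h2 := (smul_eq_zero.1 h1).resolve_right hm0
  exact frobenius_inj K p (sub_eq_zero.1 (eq_zero_of_pow_eq_zero h2))

end CharSpace

/-! ### The cluster of the induced module -/

section Cluster

variable {p : ℕ} [hp : Fact p.Prime] {F L : Type*} [Field F] [CharP F p] [LieRing L]
  [LieAlgebra F L] {P : PMap p F L} {S : LieSubalgebra F L} {hS : ∀ s ∈ S, P.toFun s ∈ S}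
  {K : Type*} [Field K] [Algebra F K] {C : Set (L →ₗ[F] K)}
  {W : Type*} [AddCommGroup W] [Module F W] [LieRingModule S W] [LieModule F S W]
  {hW : IsAmenable (P.restrict S hS) K W} {hC : cluster (P.restrict S hS) K W = resChar S '' C}
  (hD : IsComponentSum P S hS C W)

-- By amenability K ⊗ W is spanned by vectors whose characters have nonzero components. Every
-- composition factor then has such a character, and c|_S belongs to a composition factor.
include hW in
theorem wComp_ne_bot (hC : cluster (P.restrict S hS) K W = resChar S '' C)
    (hD : IsComponentSum P S hS C W) (c : C) : wComp P S hS W c.1 ≠ ⊥ := by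
  have hc : resChar S c.1 ∈ cluster (P.restrict S hS) K W := hC ▸ ⟨c.1, c.2, rfl⟩
  obtain ⟨A, B, -, hirr, hch⟩ := hc
  have : Nontrivial (B ⧸ A.comap B.incl) := LieModule.nontrivial_of_isIrreducible K (K ⊗[F] S) _
  refine mem_of_subquotient (P.restrict S hS)
    {d | component (P.restrict S hS) d (K ⊗[F] W) ≠ ⊥} (fun m => ?_) A B _ hch
  induction m using component_induction hD with
  | zero => exact zero_mem _
  | add a b ha hb => exact add_mem ha hb
  | mem d w =>
    by_cases hd : wComp P S hS W d.1 = ⊥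
    · have hw : (w : K ⊗[F] W) = 0 := (LieSubmodule.eq_bot_iff _).1 hd w w.2
      rw [hw]
      exact zero_mem _
    · refine Submodule.mem_iSup_of_mem _ (Submodule.mem_iSup_of_mem hd (mem_charSpace.2 fun x => ?_))
      have h1 := phi_map (P.restrict S hS) (wComp P S hS W d.1).incl x w
      rw [wComp_hasCharacter P S hS hW hC d] at h1
      exact h1

/-- The isomorphism of `K ⊗ V` with the module of which `V` is an `F`-form. -/
noncomputable def formEquiv (V : LieSubmodule F L (CIndSum P S hS C W hW hC))
    (hV : IsBaseChange K (V : Submodule F (CIndSum P S hS C W hW hC)).subtype) :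
    (K ⊗[F] V) ≃ₗ[K] CIndSum P S hS C W hW hC := hV.equiv

theorem formEquiv_lie (V : LieSubmodule F L (CIndSum P S hS C W hW hC))
    (hV : IsBaseChange K (V : Submodule F (CIndSum P S hS C W hW hC)).subtype)
    (y : K ⊗[F] L) (m : K ⊗[F] V) : formEquiv V hV ⁅y, m⁆ = ⁅y, formEquiv V hV m⁆ := by
  have hmul : ∀ (t : K) (v : V), formEquiv V hV (t ⊗ₜ[F] v) = t • (v : CIndSum P S hS C W hW hC) :=
    fun t v => hV.equiv_tmul t v
  induction m with
  | zero => rw [tensor_lie_zero, map_zero, lie_zero]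
  | add a b ha hb => rw [tensor_lie_add, map_add, ha, hb, map_add, lie_add]
  | tmul t v =>
    induction y with
    | zero =>
      have h1 : ⁅(0 : K ⊗[F] L), t ⊗ₜ[F] v⁆ = 0 := tensor_zero_lie _
      rw [h1, map_zero, zero_lie]
    | add a b ha hb =>
      have h1 : ⁅a + b, t ⊗ₜ[F] v⁆ = ⁅a, t ⊗ₜ[F] v⁆ + ⁅b, t ⊗ₜ[F] v⁆ := tensor_add_lie _ _ _
      rw [h1, map_add, ha, hb, add_lie]
    | tmul s x =>
      rw [LieAlgebra.ExtendScalars.bracket_tmul, hmul, hmul, lie_smul]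
      have h1 : s ⊗ₜ[F] x = s • ((1 : K) ⊗ₜ[F] x) := by
        rw [TensorProduct.smul_tmul', smul_eq_mul, mul_one]
      rw [h1, smul_lie, smul_smul, mul_comm]
      rfl

/-- The inverse of `formEquiv`, as a homomorphism of modules over `K ⊗ L`. -/
noncomputable def formHomInv (V : LieSubmodule F L (CIndSum P S hS C W hW hC))
    (hV : IsBaseChange K (V : Submodule F (CIndSum P S hS C W hW hC)).subtype) :
    CIndSum P S hS C W hW hC →ₗ⁅K, K ⊗[F] L⁆ (K ⊗[F] V) :=
  { (formEquiv V hV).symm.toLinearMap with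
    map_lie' := fun {y m} => by
      change (formEquiv V hV).symm ⁅y, m⁆ = ⁅y, (formEquiv V hV).symm m⁆
      rw [LinearEquiv.symm_apply_eq, formEquiv_lie, LinearEquiv.apply_symm_apply] }

-- One inclusion holds because V̄ is spanned by vectors with characters in `C`. For the other, 1 ⊗ w
-- with 0 ≠ w ∈ W̄_c is nonzero with character c, so the component of c contains an irreducible
-- submodule, and its character can only be c.
include hD in
theorem cluster_eq [IsAlgClosed K] [FiniteDimensional F L]
    (V : LieSubmodule F L (CIndSum P S hS C W hW hC))
    (hV : IsBaseChange K (V : Submodule F (CIndSum P S hS C W hW hC)).subtype)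
    [FiniteDimensional K (CIndSum P S hS C W hW hC)] : cluster P K V = C := by
  apply Set.Subset.antisymm
  · rintro c ⟨A, B, -, hirr, hch⟩
    have : Nontrivial (B ⧸ A.comap B.incl) := LieModule.nontrivial_of_isIrreducible K (K ⊗[F] L) _
    refine mem_of_subquotient P C (fun m => ?_) A B _ hch
    have h1 : (⨆ c ∈ C, charSpace P c (CIndSum P S hS C W hW hC)) ≤
        (⨆ c ∈ C, charSpace P c (K ⊗[F] V)).comap (formHomInv V hV).toLinearMap :=
      iSup₂_le fun c hc v hv =>
        Submodule.mem_iSup_of_mem c (Submodule.mem_iSup_of_mem hc (map_mem_charSpace _ hv))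
    have h2 := h1 (CIndSum.mem_iSup_charSpace (formEquiv V hV m))
    rw [Submodule.mem_comap] at h2
    have h3 : (formHomInv V hV).toLinearMap (formEquiv V hV m) = m := (formEquiv V hV).symm_apply_apply m
    rwa [h3] at h2
  · intro c hc
    have : Module.Finite K (K ⊗[F] V) := Module.Finite.equiv (formEquiv V hV).symm
    obtain ⟨w, hw, hw0⟩ := exists_mem_ne_zero_of_ne_bot _ (wComp_ne_bot (hW := hW) hC hD ⟨c, hc⟩)
    let v := formHomInv V hV (oneLin P S hS C W hW hC hD w)
    have hv0 : v ≠ 0 := fun h => hw0 <| oneLin_injective (hW := hW) (hC := hC) hD <| by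
      rw [map_zero]
      exact (formEquiv V hV).symm.injective (h.trans (map_zero _).symm)
    have hvc : v ∈ charSpace P c (K ⊗[F] V) := by
      refine map_mem_charSpace _ ?_
      have h1 := lof_tmul_one (hW := hW) (hC := hC) hD ⟨c, hc⟩ ⟨w, hw⟩
      rw [← h1]
      exact map_mem_charSpace _ (mem_charSpace.2 fun x => CInd.hasCharacter x _)
    have hT : component P c (K ⊗[F] V) ≠ ⊥ := fun h =>
      hv0 ((LieSubmodule.eq_bot_iff _).1 h v (mem_component_of_mem_charSpace hvc))
    obtain ⟨d, B, hB0, hBT, hBd, hirr, hch⟩ := exists_irreducible_hasCharacter P _ hT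
    obtain ⟨b, hb, hb0⟩ := exists_mem_ne_zero_of_ne_bot _ hB0
    have hdc := eq_of_mem_charSpace_of_mem_component hb0 (hBd b hb) (hBT hb)
    subst hdc
    exact ⟨⊥, B, bot_le, hirr, hch⟩

end Cluster

/-! ### The main theorem -/

theorem lemma6p4 {p : ℕ} [Fact p.Prime]
    {F : Type*} [Field F] [CharP F p] [PerfectField F]
    {K : Type*} [Field K] [Algebra F K] [IsAlgClosure F K]
    {L : Type*} [LieRing L] [LieAlgebra F L] [FiniteDimensional F L] (P : PMap p F L)
    (S : LieSubalgebra F L) (hS : ∀ s ∈ S, P.toFun s ∈ S)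
    (C : Set (L →ₗ[F] K)) (hCsimple : IsSimpleCluster C) (hCS : RestrictsSimply S C)
    (W : Type*) [AddCommGroup W] [Module F W] [LieRingModule S W] [LieModule F S W]
    [FiniteDimensional F W]
    (hW : IsAmenable (P.restrict S hS) K W)
    (hC : cluster (P.restrict S hS) K W = resChar S '' C) :
    ∃ hD : IsComponentSum P S hS C W,
    ∃ V : LieSubmodule F L (CIndSum P S hS C W hW hC),
      (∀ (n m : ℕ) (e : Fin n → L) (_ : IsCobasis S e) (b : Module.Basis (Fin m) F W),
        ∃ B : Module.Basis ((Fin n → Fin p) × Fin m) K (CIndSum P S hS C W hW hC),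
          (∀ (r : Fin n → Fin p) (i : Fin m),
            B (r, i) = monomialTmul P S hS hW hC hD e (fun j => (r j : ℕ)) ((1 : K) ⊗ₜ[F] b i)) ∧
          (∀ (α : K ≃ₐ[F] K) (r : Fin n → Fin p) (t : K ⊗[F] W),
            basisConj B α (monomialTmul P S hS hW hC hD e (fun j => (r j : ℕ)) t)
              = monomialTmul P S hS hW hC hD e (fun j => (r j : ℕ))
                  (LinearMap.rTensor W α.toLinearMap t)) ∧
          (∀ v : CIndSum P S hS C W hW hC,
            v ∈ V ↔ ∀ α : K ≃ₐ[F] K, basisConj B α v = v) ∧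
          (V : Submodule F (CIndSum P S hS C W hW hC)) = Submodule.span F (Set.range B)) ∧
      IsBaseChange K (V : Submodule F (CIndSum P S hS C W hW hC)).subtype ∧
      cluster P K V = C := by
  have : IsAlgClosed K := IsAlgClosure.isAlgClosed F
  have hD : IsComponentSum P S hS C W := isComponentSum hCS hC
  have hbasis : ∀ (n m : ℕ) (e : Fin n → L) (_ : IsCobasis S e) (b : Module.Basis (Fin m) F W),
      ∃ B : Module.Basis ((Fin n → Fin p) × Fin m) K (CIndSum P S hS C W hW hC),
        ⇑B = (fun q => monomialLin P S hS C W hW hC hD e (fun j => (q.1 j : ℕ))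
          ((1 : K) ⊗ₜ[F] b q.2)) ∧
        (inducedModule P S hS C W hW hC hD : Submodule F (CIndSum P S hS C W hW hC))
          = Submodule.span F (Set.range B) := by
    intro n m e he b
    let B := Module.Basis.mk (linearIndependent_monomialLin (hW := hW) (hC := hC) hD he b)
      (span_monomialLin_eq_top hD hCsimple he b).ge
    have hB : ⇑B = _ := Module.Basis.coe_mk _ _
    exact ⟨B, hB, by rw [hB, inducedModule_eq_span hD hCsimple he b]⟩
  refine ⟨hD, inducedModule P S hS C W hW hC hD, fun n m e he b => ?_, ?_⟩
  · obtain ⟨B, hB, hV⟩ := hbasis n m e he b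
    have hmem : ∀ v, v ∈ inducedModule P S hS C W hW hC hD
        ↔ ∀ α : K ≃ₐ[F] K, basisConj B α v = v := by
      intro v
      rw [← mem_span_range_iff_basisConj, ← hV, LieSubmodule.mem_toSubmodule]
    refine ⟨B, fun r i => ?_, fun α r t => ?_, hmem, hV⟩
    · rw [monomialTmul_eq, hB]
    · rw [monomialTmul_eq, monomialTmul_eq]
      -- For w ∈ W the vector e(r) ⊗ w lies in V and so is invariant; the general formula follows by
      -- semilinearity in t.
      have hfix : ∀ w : W, basisConj B α (monomialLin P S hS C W hW hC hD e
          (fun j => (r j : ℕ)) ((1 : K) ⊗ₜ[F] w)) = monomialLin P S hS C W hW hC hD e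
          (fun j => (r j : ℕ)) ((1 : K) ⊗ₜ[F] w) := by
        intro w
        refine (hmem _).1 ?_ α
        rw [← LieSubmodule.mem_toSubmodule, inducedModule_eq_monomialSpan hD hCsimple he]
        exact Submodule.subset_span ⟨r, _, ⟨w, rfl⟩,
          monomialLin_eq_prod hD e (fun j => (r j : ℕ)) ((1 : K) ⊗ₜ[F] w)⟩
      induction t with
      | zero => simp [basisConj]
      | add a b ha hb => rw [map_add, basisConj_add, ha, hb, map_add, map_add]
      | tmul s w =>
        have h1 : ∀ s : K, s ⊗ₜ[F] w = s • ((1 : K) ⊗ₜ[F] w) := fun s => by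
          rw [TensorProduct.smul_tmul', smul_eq_mul, mul_one]
        rw [LinearMap.rTensor_tmul, h1, h1 (α.toLinearMap s), map_smul, map_smul, basisConj_smul,
          hfix]
        rfl
  -- Base change and cluster do not mention a cobasis, so any one may be chosen.
  · obtain ⟨n, e, he⟩ := exists_isCobasis S
    obtain ⟨B, -, hV⟩ := hbasis n _ e he (Module.finBasis F W)
    have hbc : IsBaseChange K (inducedModule P S hS C W hW hC hD :
        Submodule F (CIndSum P S hS C W hW hC)).subtype := by
      rw [hV]
      exact isBaseChange_span_range B
    have : Module.Finite K (CIndSum P S hS C W hW hC) := Module.Finite.of_basis B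
    exact ⟨hbc, cluster_eq hD _ hbc⟩
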